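/- Let $0\le\gamma_i<1<\alpha_i\le 2$ for $i=1,2$, and let $\varphi,\psi\in L^1(\mathbb R)$ be real-valued. Let $N_{0,0}$ be a Poisson random measure on $\mathbb R\times\mathbb R$ with intensity $|x_1|^{-\gamma_1}|x_2|^{-\gamma_2}\,dx_1dx_2$. From each point $(x_1,x_2)$ of $N_{0,0}$ start two processes: $\xi^{x_1}$, a symmetric $\alpha_1$-stable Lévy process started at $x_1$, and $\zeta^{x_2}$, a symmetric $\alpha_2$-stable Lévy process started at $x_2$, normalized so that $E e^{iy(\xi^{x_1}_t-x_1)}=e^{-t|y|^{\alpha_1}}$ and $E e^{iy(\zeta^{x_2}_t-x_2)}=e^{-t|y|^{\alpha_2}}$; given $N_{0,0}$, all these processes are independent. For $u,v,s,t\ge 0$ put $$\langle N_{u,v},\varphi\otimes\psi\rangle=\sum_{(x_1,x_2)\in N_{0,0}}\varphi(\xi^{x_1}_u)\,\psi(\zeta^{x_2}_v),\qquad \langle L_{s,t},\varphi\otimes\psi\rangle=\int_0^s\!\int_0^t\langle N_{u,v},\varphi\otimes\psi\rangle\,dv\,du,$$ and for $T>0$ $$X_T(s,t)=\frac1{F_T}\Bigl(\langle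 L_{Ts,Tt},\varphi\otimes\psi\rangle-E\langle L_{Ts,Tt},\varphi\otimes\psi\rangle\Bigr),\qquad F_T=\prod_{i=1}^2T^{\,1-\frac{1+\gamma_i}{2\alpha_i}}.$$ Then these quantities are well defined: for all $s,t\ge0$, almost surely, the series converges absolutely for Lebesgue-almost every $(u,v)\in(0,s]\times(0,t]$ and its sum is integrable over this rectangle; and $\langle L_{s,t},\varphi\otimes\psi\rangle$ is an integrable random variable. Moreover, the finite-dimensional distributions of $(X_T(s,t))_{s,t\ge0}$ converge, as $T\to\infty$, to those of $D\,W$. Here $W=(W_{s,t})_{s,t\ge0}$ is the weighted fractional Brownian sheet with parameters $a_i=-\gamma_i/\alpha_i$, $b_i=1-1/\alpha_i$, that is, the centered Gaussian random field with covariance $$E(W_{s,t}W_{s',t'})=C^{(1)}(s,s')\,C^{(2)}(t,t'),\qquad C^{(i)}(u,v)=\int_0^{u\wedge v}r^{a_i}\bigl[(u-r)^{b_i}+(v-r)^{b_i}\bigr]dr,$$ and $$D=\int_{\mathbb R}\varphi(x)\,dx\int_{\mathbb R}\psi(x)\,dx\,\Biggl(\prod_{i=1}^2\frac{1}{1-1/\alpha_i}\,p_1^{\alpha_i}(0)\int_{\mathbb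 R}\frac{p_1^{\alpha_i}(x)}{|x|^{\gamma_i}}\,dx\Biggr)^{1/2},$$ where $p_t^{\alpha}(x)=\frac1{2\pi}\int_{\mathbb R}\exp\{-(ixy+t|y|^{\alpha})\}\,dy$ is the density at time $t$ of the symmetric $\alpha$-stable Lévy process started at $0$. -/

import Mathlib

open MeasureTheory ProbabilityTheory Filter Topology
open scoped NNReal ENNReal

noncomputable section

/-- `N` is a Poisson random measure on `E` with intensity `μ`. -/
structure IsPoissonRandomMeasure {Ω E : Type*} [MeasurableSpace Ω] [MeasurableSpace E]
    (N : Ω → Measure E) (μ : Measure E) (P : Measure Ω) : Prop where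
  aemeasurable : ∀ B, MeasurableSet B → AEMeasurable (fun ω => N ω B) P
  law : ∀ B, MeasurableSet B → μ B ≠ ∞ →
    P.map (fun ω => N ω B) = (poissonMeasure (μ B).toNNReal).map (fun k : ℕ => (k : ℝ≥0∞))
  law_top : ∀ B, MeasurableSet B → μ B = ∞ → ∀ᵐ ω ∂P, N ω B = ∞
  indep : ∀ (n : ℕ) (B : Fin n → Set E), (∀ i, MeasurableSet (B i)) →
    Pairwise (fun i j => Disjoint (B i) (B j)) → iIndepFun (fun i ω => N ω (B i)) P

/-- `ξ` is a symmetric `α`-stable Lévy process started at `0`, normalized so that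
`E exp (i y ξ_t) = exp (- t |y| ^ α)`, with almost surely càdlàg paths. -/
structure IsSymmetricStableProcess {Ω : Type*} [MeasurableSpace Ω]
    (α : ℝ) (ξ : ℝ≥0 → Ω → ℝ) (P : Measure Ω) : Prop where
  measurable : ∀ t, Measurable (ξ t)
  start : ∀ᵐ ω ∂P, ξ 0 ω = 0
  indep_increments : HasIndepIncrements ξ P
  charFun_increment : ∀ s t : ℝ≥0, s ≤ t → ∀ y : ℝ,
    charFun (P.map (fun ω => ξ t ω - ξ s ω)) y
      = ((Real.exp (-(((t : ℝ) - (s : ℝ)) * |y| ^ α)) : ℝ) : ℂ)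
  cadlag : ∀ᵐ ω ∂P, ∀ t : ℝ≥0, ContinuousWithinAt (fun r => ξ r ω) (Set.Ici t) t ∧
    ∃ l : ℝ, Tendsto (fun r => ξ r ω) (𝓝[<] t) (𝓝 l)

/-- The system of pairs of particles. The initial configuration `∑ₙ δ_{x n}` is a Poisson random
measure with intensity `μ`; the `n`-th pair, started at `x n = (x₁, x₂)`, is at time `(u, v)` at
`(x₁ + ξ n u, x₂ + ζ n v)`. All the processes `ξ n`, `ζ n` are independent of each other, and
together they are independent of the initial points. -/
structure IsStablePairSystem {Ω : Type*} [MeasurableSpace Ω] (α₁ α₂ : ℝ) (μ : Measure (ℝ × ℝ))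
    (x : ℕ → Ω → ℝ × ℝ) (ξ ζ : ℕ → ℝ≥0 → Ω → ℝ) (P : Measure Ω) : Prop where
  measurable_points : ∀ n, Measurable (x n)
  poisson : IsPoissonRandomMeasure (fun ω => Measure.sum fun n => Measure.dirac (x n ω)) μ P
  stable_fst : ∀ n, IsSymmetricStableProcess α₁ (ξ n) P
  stable_snd : ∀ n, IsSymmetricStableProcess α₂ (ζ n) P
  indep_motions : iIndepFun (fun (k : ℕ ⊕ ℕ) ω (t : ℝ≥0) => Sum.elim ξ ζ k t ω) P
  indep_points : IndepFun (fun ω (n : ℕ) => x n ω)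
    (fun ω (k : ℕ ⊕ ℕ) (t : ℝ≥0) => Sum.elim ξ ζ k t ω) P

/-- The measure `dx / |x| ^ γ` on `ℝ`. -/
def powerIntensity (γ : ℝ) : Measure ℝ :=
  (volume : Measure ℝ).withDensity fun x => ENNReal.ofReal (|x| ^ (-γ))

/-- The contribution `φ(ξ_u) ψ(ζ_v)` of the `n`-th pair to `⟨N_{u,v}, φ ⊗ ψ⟩`. -/
def pairTerm {Ω : Type*} (x : ℕ → Ω → ℝ × ℝ) (ξ ζ : ℕ → ℝ≥0 → Ω → ℝ) (φ ψ : ℝ → ℝ)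
    (u v : ℝ≥0) (ω : Ω) (n : ℕ) : ℝ :=
  φ ((x n ω).1 + ξ n u ω) * ψ ((x n ω).2 + ζ n v ω)

/-- The pairing `⟨N_{u,v}, φ ⊗ ψ⟩ = ∑ₙ φ(ξ_u) ψ(ζ_v)`, summed over all pairs. -/
def configurationPairing {Ω : Type*} (x : ℕ → Ω → ℝ × ℝ) (ξ ζ : ℕ → ℝ≥0 → Ω → ℝ) (φ ψ : ℝ → ℝ)
    (u v : ℝ≥0) (ω : Ω) : ℝ :=
  ∑' n, pairTerm x ξ ζ φ ψ u v ω n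

/-- The occupation time `⟨L_{s,t}, φ ⊗ ψ⟩ = ∫₀ˢ ∫₀ᵗ ⟨N_{u,v}, φ ⊗ ψ⟩ dv du`. -/
def occupationTime {Ω : Type*} (x : ℕ → Ω → ℝ × ℝ) (ξ ζ : ℕ → ℝ≥0 → Ω → ℝ) (φ ψ : ℝ → ℝ)
    (s t : ℝ≥0) (ω : Ω) : ℝ :=
  ∫ u in (0 : ℝ)..s, ∫ v in (0 : ℝ)..t,
    configurationPairing x ξ ζ φ ψ u.toNNReal v.toNNReal ω

/-- The norming `F_T = T ^ (1 - (1 + γ₁) / (2 α₁)) * T ^ (1 - (1 + γ₂) / (2 α₂))`. -/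
def fluctuationNorming (α₁ α₂ γ₁ γ₂ : ℝ) (T : ℝ≥0) : ℝ :=
  (T : ℝ) ^ (1 - (1 + γ₁) / (2 * α₁)) * (T : ℝ) ^ (1 - (1 + γ₂) / (2 * α₂))

/-- The rescaled occupation time fluctuation
`X_T(s,t) = (⟨L_{Ts,Tt}, φ ⊗ ψ⟩ - E ⟨L_{Ts,Tt}, φ ⊗ ψ⟩) / F_T`, at `z = (s, t)`. -/
def occupationFluctuation {Ω : Type*} [MeasurableSpace Ω] (P : Measure Ω) (α₁ α₂ γ₁ γ₂ : ℝ)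
    (x : ℕ → Ω → ℝ × ℝ) (ξ ζ : ℕ → ℝ≥0 → Ω → ℝ) (φ ψ : ℝ → ℝ)
    (T : ℝ≥0) (z : ℝ≥0 × ℝ≥0) (ω : Ω) : ℝ :=
  1 / fluctuationNorming α₁ α₂ γ₁ γ₂ T *
    (occupationTime x ξ ζ φ ψ (T * z.1) (T * z.2) ω
      - ∫ ω', occupationTime x ξ ζ φ ψ (T * z.1) (T * z.2) ω' ∂P)

/-- The covariance `∫₀^{u ∧ v} r ^ a ((u - r) ^ b + (v - r) ^ b) dr` of weighted fractional
Brownian motion with parameters `(a, b)`. -/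
def weightedFBMCov (a b : ℝ) (u v : ℝ≥0) : ℝ :=
  ∫ r in (0 : ℝ)..(min u v : ℝ≥0), r ^ a * (((u : ℝ) - r) ^ b + ((v : ℝ) - r) ^ b)

/-- `W` is a weighted fractional Brownian sheet with parameters `(a₁, b₁)`, `(a₂, b₂)`. -/
structure IsWeightedFBSheet {Ω : Type*} [MeasurableSpace Ω] (a₁ b₁ a₂ b₂ : ℝ)
    (W : ℝ≥0 × ℝ≥0 → Ω → ℝ) (P : Measure Ω) : Prop where
  gaussian : IsGaussianProcess W P
  centered : ∀ z, ∫ ω, W z ω ∂P = 0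
  covariance : ∀ z z', ∫ ω, W z ω * W z' ω ∂P
    = weightedFBMCov a₁ b₁ z.1 z'.1 * weightedFBMCov a₂ b₂ z.2 z'.2

/-- `p_t^α(x) = (1 / 2π) ∫ exp (-(i x y + t |y| ^ α)) dy`. The integral is real by symmetry, so
nothing is lost by taking the real part. -/
def stableDensity (α t x : ℝ) : ℝ :=
  (1 / (2 * Real.pi) : ℝ) *
    (∫ y : ℝ, Complex.exp (-(Complex.I * x * y + ((t * |y| ^ α : ℝ) : ℂ)))).re

/-- `(1 - 1/α)⁻¹ p_1^α(0) ∫ p_1^α(x) / |x| ^ γ dx`. -/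
def limitFactor (α γ : ℝ) : ℝ :=
  1 / (1 - 1 / α) * stableDensity α 1 0 * ∫ x : ℝ, stableDensity α 1 x / |x| ^ γ

/-- The constant `D` in front of the limit field. -/
def limitConstant (α₁ α₂ γ₁ γ₂ : ℝ) (φ ψ : ℝ → ℝ) : ℝ :=
  (∫ x, φ x) * (∫ x, ψ x) * Real.sqrt (limitFactor α₁ γ₁ * limitFactor α₂ γ₂)

end

/-! By Fubini the occupation time is a sum over the Poisson pairs of products A(s)·B(t), where A and
B are the time integrals of φ and ψ along the two particles (`ae_occupationTime_eq`). Starting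
points with independent motions attached form a marked Poisson process whose mean measure is m = m₁
⊗ m₂, each mᵢ being a power intensity times the law of a path. A linear combination of values of X_T
is therefore a compensated Poisson sum of some weight Z_T, with characteristic function exp (∫
(e^{iZ} - 1) dm - i ∫ Z dm) (`integral_exp_tsum_marked`, `integral_exp_occupationFluctuation`). When
∫ Z² dm → σ and ∫ |Z|³ dm → 0, the exponent tends to -σ/2 (`tendsto_integral_exp_sub_one_sub`), and
Lévy's continuity theorem gives the Gaussian limit.

Since m and the pair weights are products, the moment computations reduce to one coordinate. There
the second moment is a double time integral of mixed moments at times u < v. The position at u and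
the increment up to v have joint density V_u(y) p_{v-u}(b), with V_u(y) = ∫ |y - a|^{-γ} p_u(a) da.
Self-similarity gives V_u(y) = u^{-γ/α} V_1(u^{-1/α} y) and the analogous formula for p. At times
Tu, Tv the rescaled arguments tend to 0, so φ survives only through ∫ φ, and T^{(1+γ)/α} times the
mixed moment tends to (∫ φ)² V_1(0) p_1(0) u^{-γ/α} (v - u)^{-1/α} (`tendsto_pairMoment`). A
multiple of this kernel also dominates for every T > 0; it is integrable because γ/α < 1 and 1/α <
1, and its integral over a rectangle is the weighted fractional covariance divided by 1 - 1/α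
(`integral_covKernel`). The third moment grows at most like T to the power (1 - γ/α) + 2(1 - 1/α),
which falls short of the cubed norming by (1 - γ)/(2α).

Two points of measure theory remain. Evaluation of paths is not jointly measurable on the product
σ-algebra, so right-continuous paths are read through `cadlagEval`. The functions φ, ψ are only
almost everywhere measurable, but almost no particle spends positive time in a null set, so
measurable representatives can be used. -/

/-! ### Fourier inversion for finite measures -/

/-- The inverse Fourier transform of the characteristic function of `ν`. -/
noncomputable def charFunInv (ν : Measure ℝ) (x : ℝ) : ℂ :=
  (1 / (2 * Real.pi) : ℝ) * ∫ y : ℝ, Complex.exp (-(Complex.I * x * y)) * charFun ν y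

open scoped FourierTransform SchwartzMap in
-- Write g as the inverse transform of its transform and apply Fubini against ν; the
-- self-adjointness of the Fourier transform then moves it from g onto the characteristic function.
-- The factors 2π reconcile the kernel e^{-2πixy} with the kernel of `charFun`.
lemma integral_schwartz_eq_integral_mul_charFunInv (ν : Measure ℝ) [IsFiniteMeasure ν]
    (hν : Integrable (charFun ν)) (g : 𝓢(ℝ, ℂ)) :
    ∫ x, g x ∂ν = ∫ x, g x * charFunInv ν x := by
  have hpi : (2 * Real.pi) ≠ 0 := by positivity
  have hf : Integrable (fun y => charFun ν (2 * Real.pi * y)) := hν.comp_mul_left' hpi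
  have hg : Integrable (𝓕 (g : ℝ → ℂ)) := by
    rw [← SchwartzMap.fourier_coe]; exact (𝓕 g).integrable
  have hinv : ∀ x, g x =
      ∫ y, Complex.exp ((2 * Real.pi * x * y : ℝ) * Complex.I) * 𝓕 (g : ℝ → ℂ) y := by
    intro x
    have h := congrFun (g.continuous.fourierInv_fourier_eq g.integrable hg) x
    rw [← h, Real.fourierInv_eq']
    congr 1; ext y
    simp only [smul_eq_mul, Real.inner_apply]
    congr 3; push_cast; ring
  have hswap := VectorFourier.integral_fourierIntegral_smul_eq_flip (L := innerₗ ℝ)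
      (μ := (volume : Measure ℝ)) (ν := (volume : Measure ℝ)) (f := (g : ℝ → ℂ))
      (g := fun y => charFun ν (2 * Real.pi * y))
      (by exact Real.continuous_fourierChar) (by exact continuous_inner) g.integrable hf
  calc ∫ x, g x ∂ν
      = ∫ x, (∫ y, Complex.exp ((2 * Real.pi * x * y : ℝ) * Complex.I) * 𝓕 (g : ℝ → ℂ) y) ∂ν := by
        congr 1; ext x; exact hinv x
    _ = ∫ y, (∫ x, Complex.exp ((2 * Real.pi * x * y : ℝ) * Complex.I) * 𝓕 (g : ℝ → ℂ) y ∂ν) := by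
        apply integral_integral_swap
        have h1 : Integrable (fun z : ℝ × ℝ => 𝓕 (g : ℝ → ℂ) z.2) (ν.prod volume) := hg.comp_snd ν
        refine h1.bdd_mul (c := 1) (by fun_prop) ?_
        filter_upwards with z
        simp [Complex.norm_exp]
    _ = ∫ y, 𝓕 (g : ℝ → ℂ) y • charFun ν (2 * Real.pi * y) := by
        congr 1; ext y
        rw [integral_mul_const, charFun_apply_real, smul_eq_mul, mul_comm]
        congr 2; ext x; congr 1; push_cast; ring
    _ = ∫ x, g x * charFunInv ν x := by
        refine hswap.trans ?_
        congr 1; ext x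
        rw [smul_eq_mul]
        congr 1
        rw [Real.vector_fourierIntegral_eq_integral_exp_smul, charFunInv]
        have := Measure.integral_comp_mul_left
          (fun y : ℝ => Complex.exp (-(Complex.I * x * y)) * charFun ν y) (2 * Real.pi)
        rw [abs_of_pos (by positivity), Complex.real_smul] at this
        rw [one_div, ← this]
        congr 1; ext y
        rw [smul_eq_mul]
        congr 2
        simp [innerₗ_apply_apply]
        ring

lemma continuous_charFunInv (ν : Measure ℝ) [IsFiniteMeasure ν] (hν : Integrable (charFun ν)) :
    Continuous (charFunInv ν) := by
  unfold charFunInv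
  refine continuous_const.mul (continuous_of_dominated (bound := fun y => ‖charFun ν y‖)
    (fun x => ?_) (fun x => ?_) hν.norm ?_)
  · exact (by fun_prop : AEStronglyMeasurable _ _).mul hν.1
  · filter_upwards with y
    simp [Complex.norm_exp]
  · filter_upwards with y
    fun_prop

open scoped SchwartzMap ContDiff in
-- Smooth bumps increase to full height on the open ball, and both sides pass to the limit by
-- dominated convergence.
lemma measureReal_ball_eq_integral_charFunInv (ν : Measure ℝ) [IsFiniteMeasure ν]
    (hν : Integrable (charFun ν)) (c : ℝ) {r : ℝ} (hr : 0 < r) :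
    ν.real (Metric.ball c r) = ∫ x in Metric.ball c r, (charFunInv ν x).re := by
  have hrn : ∀ n : ℕ, 0 < r * (1 - 1 / ((n : ℝ) + 2)) := fun n => by
    have : 1 / ((n : ℝ) + 2) < 1 := by
      rw [div_lt_one (by positivity)]
      linarith [n.cast_nonneg (α := ℝ)]
    exact mul_pos hr (by linarith)
  have hrn' : ∀ n : ℕ, r * (1 - 1 / ((n : ℝ) + 2)) < r := fun n => by
    have : 0 < 1 / ((n : ℝ) + 2) := by positivity
    nlinarith
  -- The shift by 2 keeps the inner radius positive already at n = 0.
  let b : ℕ → ContDiffBump c := fun n => ⟨r * (1 - 1 / ((n : ℝ) + 2)), r, hrn n, hrn' n⟩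
  have hb_lim : ∀ x, Tendsto (fun n => b n x) atTop (𝓝 ((Metric.ball c r).indicator 1 x)) := by
    intro x
    by_cases hx : x ∈ Metric.ball c r
    · rw [Set.indicator_of_mem hx]
      apply tendsto_const_nhds.congr'
      have hlim : Tendsto (fun n : ℕ => r * (1 - 1 / ((n : ℝ) + 2))) atTop (𝓝 (r * (1 - 0))) := by
        refine tendsto_const_nhds.mul (tendsto_const_nhds.sub ?_)
        exact (tendsto_add_atTop_iff_nat (f := fun n : ℕ => 1 / (n : ℝ)) 2).2
          tendsto_one_div_atTop_nhds_zero_nat |>.congr (fun n => by push_cast; rfl)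
      rw [sub_zero, mul_one] at hlim
      filter_upwards [hlim.eventually (lt_mem_nhds (Metric.mem_ball.1 hx))] with n hn
      exact ((b n).one_of_mem_closedBall (Metric.mem_closedBall.2 hn.le)).symm
    · rw [Set.indicator_of_notMem hx]
      apply tendsto_const_nhds.congr
      intro n
      exact ((b n).zero_of_le_dist (by simpa [b] using hx)).symm
  have hcont := continuous_charFunInv ν hν
  have hre : Continuous fun x => (charFunInv ν x).re := Complex.continuous_re.comp hcont
  have hEq : ∀ n, ∫ x, b n x ∂ν = ∫ x, b n x * (charFunInv ν x).re := by
    intro n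
    have hcs : HasCompactSupport (fun x => ((b n x : ℝ) : ℂ)) :=
      (b n).hasCompactSupport.comp_left (g := fun x : ℝ => (x : ℂ)) (by simp)
    have hsm : ContDiff ℝ ∞ (fun x => ((b n x : ℝ) : ℂ)) :=
      Complex.ofRealCLM.contDiff.comp (b n).contDiff
    have h := integral_schwartz_eq_integral_mul_charFunInv ν hν (hcs.toSchwartzMap hsm)
    change ∫ x, ((b n x : ℝ) : ℂ) ∂ν = ∫ x, ((b n x : ℝ) : ℂ) * charFunInv ν x at h
    have h2 := congrArg Complex.re h
    rw [integral_complex_ofReal] at h2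
    have hint : Integrable (fun x => ((b n x : ℝ) : ℂ) * charFunInv ν x) :=
      (hsm.continuous.mul hcont).integrable_of_hasCompactSupport (hcs.mul_right)
    have h3 := Complex.reCLM.integral_comp_comm hint
    simp only [Complex.reCLM_apply, Complex.re_ofReal_mul] at h3
    rw [h3, ← h2]
    simp
  have h1 : Tendsto (fun n => ∫ x, b n x ∂ν) atTop
      (𝓝 (∫ x, (Metric.ball c r).indicator 1 x ∂ν)) := by
    refine tendsto_integral_of_dominated_convergence (fun _ => 1)
      (fun n => (b n).continuous.aestronglyMeasurable) (integrable_const _) (fun n => ?_) ?_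
    · filter_upwards with x
      rw [Real.norm_of_nonneg (b n).nonneg]; exact (b n).le_one
    · filter_upwards with x using hb_lim x
  have h2 : Tendsto (fun n => ∫ x, b n x * (charFunInv ν x).re) atTop
      (𝓝 (∫ x, (Metric.ball c r).indicator 1 x * (charFunInv ν x).re)) := by
    refine tendsto_integral_of_dominated_convergence
      ((Metric.ball c r).indicator fun x => ‖(charFunInv ν x).re‖)
      (fun n => ((b n).continuous.mul hre).aestronglyMeasurable) ?_ (fun n => ?_) ?_
    · rw [integrable_indicator_iff Metric.isOpen_ball.measurableSet]
      refine IntegrableOn.mono_set (t := Metric.closedBall c r) ?_ Metric.ball_subset_closedBall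
      exact ContinuousOn.integrableOn_compact (isCompact_closedBall c r) hre.norm.continuousOn
    · filter_upwards with x
      by_cases hx : x ∈ Metric.ball c r
      · rw [Set.indicator_of_mem hx, norm_mul, Real.norm_of_nonneg (b n).nonneg]
        exact mul_le_of_le_one_left (norm_nonneg _) (b n).le_one
      · rw [Set.indicator_of_notMem hx, (b n).zero_of_le_dist (by simpa [b] using hx)]
        simp
    · filter_upwards with x
      exact (hb_lim x).mul_const _
  have h3 := tendsto_nhds_unique h1 (h2.congr fun n => (hEq n).symm)
  rw [integral_indicator_one Metric.isOpen_ball.measurableSet] at h3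
  rw [h3, ← integral_indicator Metric.isOpen_ball.measurableSet]
  congr 1; ext x
  by_cases hx : x ∈ Metric.ball c r <;> simp [hx, Set.indicator_of_mem, Set.indicator_of_notMem]

/-- A negative value would persist on a small ball by continuity and force that ball to have
negative mass. -/
lemma charFunInv_re_nonneg (ν : Measure ℝ) [IsFiniteMeasure ν] (hν : Integrable (charFun ν))
    (x : ℝ) : 0 ≤ (charFunInv ν x).re := by
  by_contra! hneg
  have hcont : Continuous fun x => (charFunInv ν x).re :=
    Complex.continuous_re.comp (continuous_charFunInv ν hν)
  obtain ⟨δ, hδ, hball⟩ := Metric.mem_nhds_iff.1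
    (hcont.continuousAt.eventually (gt_mem_nhds
      (show (charFunInv ν x).re < (charFunInv ν x).re / 2 by linarith)))
  have h := measureReal_ball_eq_integral_charFunInv ν hν x hδ
  have hle : ∫ y in Metric.ball x δ, (charFunInv ν y).re
      ≤ ∫ y in Metric.ball x δ, (charFunInv ν x).re / 2 := by
    refine setIntegral_mono_on ?_ ?_ Metric.isOpen_ball.measurableSet (fun y hy => (hball hy).le)
    · exact (ContinuousOn.integrableOn_compact (isCompact_closedBall x δ)
        hcont.continuousOn).mono_set Metric.ball_subset_closedBall
    · exact integrableOn_const measure_ball_lt_top.ne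
  rw [setIntegral_const, smul_eq_mul, measureReal_def, Real.volume_ball,
    ENNReal.toReal_ofReal (by positivity)] at hle
  have := measureReal_nonneg (μ := ν) (s := Metric.ball x δ)
  nlinarith

/-- A finite measure on `ℝ` with integrable characteristic function has the inverse Fourier
transform of that function as a density. -/
theorem eq_withDensity_charFunInv (ν : Measure ℝ) [IsFiniteMeasure ν]
    (hν : Integrable (charFun ν)) :
    ν = volume.withDensity fun x => ENNReal.ofReal (charFunInv ν x).re := by
  refine Real.measure_ext_Ioo_rat fun a b => ?_
  rcases le_or_gt (b : ℝ) a with hab | hab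
  · simp [Set.Ioo_eq_empty (not_lt.2 hab)]
  have hcont : Continuous fun x => (charFunInv ν x).re :=
    Complex.continuous_re.comp (continuous_charFunInv ν hν)
  have hr : 0 < ((b : ℝ) - a) / 2 := by linarith
  have h := measureReal_ball_eq_integral_charFunInv ν hν ((a + b) / 2) hr
  rw [Real.ball_eq_Ioo, show ((a : ℝ) + b) / 2 - (b - a) / 2 = a by ring,
    show ((a : ℝ) + b) / 2 + (b - a) / 2 = b by ring] at h
  rw [withDensity_apply _ measurableSet_Ioo, ← ofReal_integral_eq_lintegral_ofReal, ← h,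
    ofReal_measureReal]
  · exact (hcont.integrableOn_Icc).mono_set Set.Ioo_subset_Icc_self
  · filter_upwards with x using charFunInv_re_nonneg ν hν x

/-! ### Stable densities: bounds and scaling -/

lemma integrable_comp_abs_of_integrableOn_Ioi {f : ℝ → ℝ} (hf : IntegrableOn f (Set.Ioi 0)) :
    Integrable fun y : ℝ => f |y| := by
  have hpos : IntegrableOn (fun y : ℝ => f |y|) (Set.Ioi 0) :=
    hf.congr_fun (fun y hy => by simp only [abs_of_pos (Set.mem_Ioi.1 hy)]) measurableSet_Ioi
  have hneg : IntegrableOn (fun y : ℝ => f |y|) (Set.Iic 0) := by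
    rw [← Measure.map_neg_eq_self (volume : Measure ℝ)]
    let m : MeasurableEmbedding fun x : ℝ => -x := (Homeomorph.neg ℝ).measurableEmbedding
    rw [m.integrableOn_map_iff]
    simp_rw [Function.comp_def, abs_neg, Set.neg_preimage, Set.neg_Iic, neg_zero]
    exact Iff.mpr integrableOn_Ici_iff_integrableOn_Ioi hpos
  rw [← integrableOn_univ, ← Set.Iic_union_Ioi (a := (0 : ℝ))]
  exact hneg.union hpos

lemma integrable_exp_neg_mul_abs_rpow {α t : ℝ} (hα : 0 < α) (ht : 0 < t) :
    Integrable fun y : ℝ => Real.exp (-(t * |y| ^ α)) := by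
  have h := integrableOn_rpow_mul_exp_neg_mul_rpow (p := α) (s := 0) (b := t) (by norm_num) hα ht
  exact integrable_comp_abs_of_integrableOn_Ioi (f := fun y => Real.exp (-(t * y ^ α)))
    (by simpa using h)

lemma stableDensity_eq_integral_re (α t x : ℝ) :
    stableDensity α t x = (1 / (2 * Real.pi) : ℝ) *
      (∫ y : ℝ, Complex.exp (-(Complex.I * x * y)) * ((Real.exp (-(t * |y| ^ α)) : ℝ) : ℂ)).re := by
  unfold stableDensity
  congr 3
  ext y
  rw [neg_add, Complex.exp_add, Complex.ofReal_exp]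
  push_cast
  rfl

lemma charFunInv_re_eq_stableDensity {α t : ℝ} {ν : Measure ℝ}
    (hν : ∀ y, charFun ν y = ((Real.exp (-(t * |y| ^ α)) : ℝ) : ℂ)) (x : ℝ) :
    (charFunInv ν x).re = stableDensity α t x := by
  rw [stableDensity_eq_integral_re, charFunInv, Complex.re_ofReal_mul]
  simp_rw [hν]

/-- The law of the symmetric `α`-stable process at time `t`. -/
noncomputable def stableLaw (α t : ℝ) : Measure ℝ :=
  volume.withDensity fun x => ENNReal.ofReal (stableDensity α t x)

lemma integrable_charFun_of_eq_exp {α t : ℝ} (hα : 0 < α) (ht : 0 < t) {ν : Measure ℝ}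
    (hν : ∀ y, charFun ν y = ((Real.exp (-(t * |y| ^ α)) : ℝ) : ℂ)) : Integrable (charFun ν) := by
  rw [funext hν]
  exact (integrable_exp_neg_mul_abs_rpow hα ht).ofReal

lemma eq_stableLaw_of_charFun {α t : ℝ} (hα : 0 < α) (ht : 0 < t) {ν : Measure ℝ}
    [IsFiniteMeasure ν] (hν : ∀ y, charFun ν y = ((Real.exp (-(t * |y| ^ α)) : ℝ) : ℂ)) :
    ν = stableLaw α t := by
  conv_lhs => rw [eq_withDensity_charFunInv ν (integrable_charFun_of_eq_exp hα ht hν)]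
  simp_rw [charFunInv_re_eq_stableDensity hν]
  rfl

/-- Positivity is not visible in the Fourier integral; it comes from the existence of a measure with
this characteristic function, here always the law of an increment of the given process. -/
lemma stableDensity_nonneg_of_charFun {α t : ℝ} (hα : 0 < α) (ht : 0 < t) {ν : Measure ℝ}
    [IsFiniteMeasure ν] (hν : ∀ y, charFun ν y = ((Real.exp (-(t * |y| ^ α)) : ℝ) : ℂ)) (x : ℝ) :
    0 ≤ stableDensity α t x := by
  rw [← charFunInv_re_eq_stableDensity hν]
  exact charFunInv_re_nonneg ν (integrable_charFun_of_eq_exp hα ht hν) x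

lemma continuous_stableDensity {α t : ℝ} (hα : 0 < α) (ht : 0 < t) :
    Continuous (stableDensity α t) := by
  rw [funext (stableDensity_eq_integral_re α t)]
  refine continuous_const.mul (Complex.continuous_re.comp (continuous_of_dominated
    (bound := fun y => Real.exp (-(t * |y| ^ α))) (fun x => ?_) (fun x => ?_)
    (integrable_exp_neg_mul_abs_rpow hα ht) ?_))
  · exact (by fun_prop : AEStronglyMeasurable _ _).mul
      (integrable_exp_neg_mul_abs_rpow hα ht).ofReal.1
  · filter_upwards with y
    rw [norm_mul]
    simp [Complex.norm_exp]
  · filter_upwards with y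
    fun_prop

/-- The integrand at 0 is the modulus of the integrand at x. -/
lemma abs_stableDensity_le {α t : ℝ} (x : ℝ) :
    |stableDensity α t x| ≤ stableDensity α t 0 := by
  rw [stableDensity_eq_integral_re, stableDensity_eq_integral_re, abs_mul,
    abs_of_pos (by positivity)]
  gcongr
  refine (Complex.abs_re_le_norm _).trans ((norm_integral_le_integral_norm _).trans (le_of_eq ?_))
  have : ∀ y : ℝ, Complex.exp (-(Complex.I * (0 : ℝ) * y)) * ((Real.exp (-(t * |y| ^ α)) : ℝ) : ℂ)
      = ((Real.exp (-(t * |y| ^ α)) : ℝ) : ℂ) := fun y => by simp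
  simp_rw [this]
  rw [integral_complex_ofReal, Complex.ofReal_re]
  congr 1; ext y
  rw [norm_mul, Complex.norm_real, Real.norm_of_nonneg (Real.exp_nonneg _)]
  simp [Complex.norm_exp]

/-- Substitute y ↦ t^{-1/α} y in the Fourier integral, which turns t|y|^α into |y|^α. -/
lemma stableDensity_scale {α t : ℝ} (hα : 0 < α) (ht : 0 < t) (x : ℝ) :
    stableDensity α t x = t ^ (-1 / α) * stableDensity α 1 (t ^ (-1 / α) * x) := by
  have hc : 0 < t ^ (-1 / α) := Real.rpow_pos_of_pos ht _
  rw [stableDensity_eq_integral_re, stableDensity_eq_integral_re]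
  have h := Measure.integral_comp_mul_left (fun y : ℝ => Complex.exp (-(Complex.I * x * y)) *
    ((Real.exp (-(t * |y| ^ α)) : ℝ) : ℂ)) (t ^ (-1 / α))
  rw [abs_of_pos (inv_pos.2 hc)] at h
  have h2 : (∫ y : ℝ, Complex.exp (-(Complex.I * ((t ^ (-1 / α) * x : ℝ) : ℂ) * y)) *
      ((Real.exp (-(1 * |y| ^ α)) : ℝ) : ℂ)) =
      ∫ y : ℝ, Complex.exp (-(Complex.I * x * ((t ^ (-1 / α) * y : ℝ) : ℂ))) *
      ((Real.exp (-(t * |t ^ (-1 / α) * y| ^ α)) : ℝ) : ℂ) := by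
    congr 1; ext y
    have e1 : t * |t ^ (-1 / α) * y| ^ α = 1 * |y| ^ α := by
      rw [abs_mul, abs_of_pos hc, Real.mul_rpow hc.le (abs_nonneg _), ← Real.rpow_mul ht.le,
        div_mul_cancel₀ _ hα.ne', Real.rpow_neg_one, ← mul_assoc, mul_inv_cancel₀ ht.ne']
    rw [e1]
    congr 2
    push_cast; ring
  rw [h2, h, Complex.real_smul, Complex.re_ofReal_mul]
  field_simp

lemma stableDensity_le {α t : ℝ} (hα : 0 < α) (ht : 0 < t) (x : ℝ) :
    stableDensity α t x ≤ t ^ (-1 / α) * stableDensity α 1 0 := by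
  rw [stableDensity_scale hα ht]
  gcongr
  exact (le_abs_self _).trans (abs_stableDensity_le _)

lemma stableLaw_le {α t : ℝ} (hα : 0 < α) (ht : 0 < t) :
    stableLaw α t ≤ ENNReal.ofReal (t ^ (-1 / α) * stableDensity α 1 0) • volume := by
  rw [← withDensity_const]
  exact withDensity_mono (ae_of_all _ fun x => ENNReal.ofReal_le_ofReal (stableDensity_le hα ht x))

lemma measurable_stableDensity {α t : ℝ} (hα : 0 < α) (ht : 0 < t) :
    Measurable (stableDensity α t) := (continuous_stableDensity hα ht).measurable

lemma lintegral_stableLaw {α t : ℝ} (hα : 0 < α) (ht : 0 < t) {f : ℝ → ℝ≥0∞} (hf : Measurable f) :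
    ∫⁻ x, f x ∂(stableLaw α t) = ∫⁻ x, ENNReal.ofReal (stableDensity α t x) * f x := by
  rw [stableLaw, lintegral_withDensity_eq_lintegral_mul _
    (measurable_stableDensity hα ht).ennreal_ofReal hf]
  rfl

lemma lintegral_stableLaw_scale {α t : ℝ} (hα : 0 < α) (ht : 0 < t) {f : ℝ → ℝ≥0∞}
    (hf : Measurable f) :
    ∫⁻ x, f x ∂(stableLaw α t) = ∫⁻ x, f (t ^ (1 / α) * x) ∂(stableLaw α 1) := by
  have hc : 0 < t ^ (1 / α) := Real.rpow_pos_of_pos ht _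
  have hcc : t ^ (-1 / α) * t ^ (1 / α) = 1 := by
    rw [← Real.rpow_add ht]; ring_nf; simp
  rw [lintegral_stableLaw hα ht hf, lintegral_stableLaw hα one_pos
    (f := fun x => f (t ^ (1 / α) * x)) (hf.comp (measurable_const_mul _))]
  have hg : Measurable fun x => ENNReal.ofReal (stableDensity α t x) * f x :=
    (measurable_stableDensity hα ht).ennreal_ofReal.mul hf
  have h := lintegral_map (μ := (volume : Measure ℝ)) hg (measurable_const_mul (t ^ (1 / α)))
  rw [Real.map_volume_mul_left hc.ne', lintegral_smul_measure, abs_of_pos (inv_pos.2 hc)] at h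
  rw [smul_eq_mul] at h
  have h' : ∫⁻ x, ENNReal.ofReal (stableDensity α t x) * f x = ENNReal.ofReal (t ^ (1 / α)) *
      ∫⁻ x, ENNReal.ofReal (stableDensity α t (t ^ (1 / α) * x)) * f (t ^ (1 / α) * x) := by
    rw [← h, ← mul_assoc, ← ENNReal.ofReal_mul hc.le, mul_inv_cancel₀ hc.ne', ENNReal.ofReal_one,
      one_mul]
  rw [h', ← lintegral_const_mul _ (show Measurable fun x => ENNReal.ofReal
    (stableDensity α t (t ^ (1 / α) * x)) * f (t ^ (1 / α) * x) from
      hg.comp (measurable_const_mul _))]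
  congr 1; ext x
  rw [← mul_assoc, ← ENNReal.ofReal_mul hc.le, stableDensity_scale hα ht, ← mul_assoc, ← mul_assoc,
    mul_comm (t ^ (1 / α)), hcc, one_mul, one_mul]

/-! ### The potential of the initial intensity -/

/-- The Riesz-type potential `∫ |z - a| ^ (-γ) p_t^α(a) da`. -/
noncomputable def stablePotential (α γ t z : ℝ) : ℝ≥0∞ :=
  ∫⁻ a, ENNReal.ofReal (|z - a| ^ (-γ)) ∂(stableLaw α t)

instance (α t : ℝ) : SFinite (stableLaw α t) := by unfold stableLaw; infer_instance

lemma measurable_stablePotential (α γ t : ℝ) : Measurable (stablePotential α γ t) := by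
  unfold stablePotential
  exact Measurable.lintegral_prod_right' (ν := stableLaw α t)
    (f := fun p : ℝ × ℝ => ENNReal.ofReal (|p.1 - p.2| ^ (-γ))) (by fun_prop)

lemma stablePotential_scale {α γ t : ℝ} (hα : 0 < α) (ht : 0 < t) (z : ℝ) :
    stablePotential α γ t z =
      ENNReal.ofReal (t ^ (-γ / α)) * stablePotential α γ 1 (t ^ (-1 / α) * z) := by
  have hc : 0 < t ^ (1 / α) := Real.rpow_pos_of_pos ht _
  have hcc : t ^ (1 / α) * t ^ (-1 / α) = 1 := by
    rw [← Real.rpow_add ht]; ring_nf; simp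
  unfold stablePotential
  rw [lintegral_stableLaw_scale hα ht (by fun_prop), ← lintegral_const_mul _ (by fun_prop)]
  congr 1; ext a
  rw [← ENNReal.ofReal_mul (by positivity)]
  congr 1
  have : z - t ^ (1 / α) * a = t ^ (1 / α) * (t ^ (-1 / α) * z - a) := by
    rw [mul_sub, ← mul_assoc, hcc, one_mul]
  rw [this, abs_mul, abs_of_pos hc, Real.mul_rpow hc.le (abs_nonneg _), ← Real.rpow_mul ht.le]
  congr 2
  ring

lemma integrableOn_rpow_neg_Ioc {γ : ℝ} (hγ : γ < 1) (S : ℝ) :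
    IntegrableOn (fun x : ℝ => x ^ (-γ)) (Set.Ioc 0 S) := by
  rcases le_or_gt S 0 with h | h
  · simp [Set.Ioc_eq_empty (not_lt.2 h)]
  · rw [← intervalIntegrable_iff_integrableOn_Ioc_of_le h.le]
    exact intervalIntegral.intervalIntegrable_rpow' (by linarith)

lemma lintegral_ofReal_abs_rpow_neg_sub_one_lt_top {γ : ℝ} (hγ : 0 ≤ γ) (hγ' : γ < 1) :
    ∫⁻ b : ℝ, ENNReal.ofReal (|b| ^ (-γ) - 1) < ∞ := by
  have h1 : Integrable fun b : ℝ => (Set.Iic 1).indicator (fun x => x ^ (-γ)) |b| := by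
    apply integrable_comp_abs_of_integrableOn_Ioi
    rw [IntegrableOn, integrable_indicator_iff measurableSet_Iic, IntegrableOn,
      Measure.restrict_restrict measurableSet_Iic, Set.inter_comm, Set.Ioi_inter_Iic]
    exact integrableOn_rpow_neg_Ioc hγ' 1
  refine lt_of_le_of_lt (lintegral_mono fun b => ?_) h1.2
  dsimp only
  by_cases hb : |b| ≤ 1
  · rw [Set.indicator_of_mem (show |b| ∈ Set.Iic 1 from hb), Real.enorm_eq_ofReal (by positivity)]
    exact ENNReal.ofReal_le_ofReal (by linarith)
  · have : |b| ^ (-γ) ≤ 1 := Real.rpow_le_one_of_one_le_of_nonpos (by linarith) (by linarith)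
    rw [ENNReal.ofReal_of_nonpos (by linarith)]
    exact zero_le

lemma ofReal_eq_ofReal_min_add_ofReal_sub (x : ℝ) :
    ENNReal.ofReal x = ENNReal.ofReal (min x 1) + ENNReal.ofReal (x - 1) := by
  rcases le_total x 1 with h | h
  · rw [min_eq_left h, ENNReal.ofReal_of_nonpos (p := x - 1) (by linarith), add_zero]
  · rw [min_eq_right h, ← ENNReal.ofReal_add (by norm_num) (by linarith)]
    congr 1; ring

/-- The singularity is separated: the truncated power is bounded by 1 and integrated against a
probability, while the excess lives on |b| ≤ 1, is integrable there because γ < 1, and meets a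
bounded continuous density. In the second term z appears only in the density, so both the uniform
bound and the continuity at 0 follow by domination. -/
lemma stablePotential_eq_add {α γ : ℝ} (hα : 0 < α) (z : ℝ) :
    stablePotential α γ 1 z =
      ∫⁻ a, ENNReal.ofReal (min (|z - a| ^ (-γ)) 1) ∂(stableLaw α 1) +
      ∫⁻ b, ENNReal.ofReal (stableDensity α 1 (z - b)) * ENNReal.ofReal (|b| ^ (-γ) - 1) := by
  unfold stablePotential
  simp_rw [fun a : ℝ => ofReal_eq_ofReal_min_add_ofReal_sub (|z - a| ^ (-γ))]
  rw [lintegral_add_left (by fun_prop)]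
  congr 1
  rw [lintegral_stableLaw hα one_pos (by fun_prop),
    ← lintegral_sub_left_eq_self _ z]
  simp

lemma stablePotential_le {α γ : ℝ} (hα : 0 < α) [IsProbabilityMeasure (stableLaw α 1)] (z : ℝ) :
    stablePotential α γ 1 z ≤
      1 + ENNReal.ofReal (stableDensity α 1 0) * ∫⁻ b : ℝ, ENNReal.ofReal (|b| ^ (-γ) - 1) := by
  rw [stablePotential_eq_add hα]
  gcongr
  · calc _ ≤ ∫⁻ a, 1 ∂(stableLaw α 1) := by
          refine lintegral_mono fun a => ?_
          rw [← ENNReal.ofReal_one]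
          exact ENNReal.ofReal_le_ofReal (min_le_right _ _)
      _ = 1 := by simp
  · rw [← lintegral_const_mul _ (by fun_prop)]
    refine lintegral_mono fun b => ?_
    gcongr
    exact (le_abs_self _).trans (abs_stableDensity_le _)

lemma exists_stablePotential_bound {α γ : ℝ} (hα : 0 < α) (hγ : 0 ≤ γ) (hγ' : γ < 1)
    [IsProbabilityMeasure (stableLaw α 1)] :
    ∃ C : ℝ≥0, ∀ z, stablePotential α γ 1 z ≤ C := by
  have h : 1 + ENNReal.ofReal (stableDensity α 1 0) *
      ∫⁻ b : ℝ, ENNReal.ofReal (|b| ^ (-γ) - 1) ≠ ∞ :=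
    ENNReal.add_ne_top.2 ⟨ENNReal.one_ne_top, ENNReal.mul_ne_top ENNReal.ofReal_ne_top
      (lintegral_ofReal_abs_rpow_neg_sub_one_lt_top hγ hγ').ne⟩
  refine ⟨(1 + ENNReal.ofReal (stableDensity α 1 0) *
    ∫⁻ b : ℝ, ENNReal.ofReal (|b| ^ (-γ) - 1)).toNNReal, fun z => ?_⟩
  rw [ENNReal.coe_toNNReal h]
  exact stablePotential_le hα z

lemma tendsto_stablePotential_zero {α γ : ℝ} (hα : 0 < α) (hγ : 0 ≤ γ) (hγ' : γ < 1)
    [IsProbabilityMeasure (stableLaw α 1)] :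
    Tendsto (stablePotential α γ 1) (𝓝 0) (𝓝 (stablePotential α γ 1 0)) := by
  rw [stablePotential_eq_add hα, funext (stablePotential_eq_add (γ := γ) hα)]
  refine Tendsto.add ?_ ?_
  · refine tendsto_lintegral_filter_of_dominated_convergence (fun _ => 1)
      (Eventually.of_forall fun z => by fun_prop) (Eventually.of_forall fun z => ?_) (by simp) ?_
    · filter_upwards with a
      rw [← ENNReal.ofReal_one]
      exact ENNReal.ofReal_le_ofReal (min_le_right _ _)
    · have h0 : ∀ᵐ a ∂(stableLaw α 1), a ≠ 0 := by
        refine (withDensity_absolutelyContinuous _ _).ae_le ?_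
        exact compl_mem_ae_iff.2 (measure_singleton (0 : ℝ))
      filter_upwards [h0] with a ha
      refine ENNReal.tendsto_ofReal (Tendsto.min ?_ tendsto_const_nhds)
      refine ContinuousAt.tendsto (f := fun z : ℝ => |z - a| ^ (-γ)) ?_
      exact ContinuousAt.rpow_const (by fun_prop) (Or.inl (by simpa using ha))
  · refine tendsto_lintegral_filter_of_dominated_convergence
      (fun b => ENNReal.ofReal (stableDensity α 1 0) * ENNReal.ofReal (|b| ^ (-γ) - 1))
      (Eventually.of_forall fun z => ?_) (Eventually.of_forall fun z => ?_) ?_ ?_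
    · exact ((measurable_stableDensity hα one_pos).comp (by fun_prop)).ennreal_ofReal.mul
        (by fun_prop)
    · filter_upwards with b
      gcongr
      exact (le_abs_self _).trans (abs_stableDensity_le _)
    · rw [lintegral_const_mul _ (by fun_prop)]
      exact ENNReal.mul_ne_top ENNReal.ofReal_ne_top
        (lintegral_ofReal_abs_rpow_neg_sub_one_lt_top hγ hγ').ne
    · filter_upwards with b
      refine ENNReal.Tendsto.mul_const (ENNReal.tendsto_ofReal ?_) (Or.inr ENNReal.ofReal_ne_top)
      exact ((continuous_stableDensity hα one_pos).comp (continuous_sub_right b)).tendsto 0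

lemma toReal_stablePotential_zero {α γ : ℝ} (hα : 0 < α)
    (hp : ∀ x, 0 ≤ stableDensity α 1 x) :
    (stablePotential α γ 1 0).toReal = ∫ x : ℝ, stableDensity α 1 x / |x| ^ γ := by
  have hm := measurable_stableDensity hα one_pos
  rw [integral_eq_lintegral_of_nonneg_ae (ae_of_all _ fun x => div_nonneg (hp x) (by positivity))
    (hm.div (by fun_prop)).aestronglyMeasurable, stablePotential,
    lintegral_stableLaw hα one_pos (by fun_prop)]
  congr 2; ext x
  rw [← ENNReal.ofReal_mul (hp x), zero_sub, abs_neg, Real.rpow_neg (abs_nonneg _)]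
  rfl

/-! ### Measurable evaluation of right-continuous paths -/

/-- The first point of the grid `ℕ / (k + 1)` to the right of `t`. -/
noncomputable def gridPoint (k : ℕ) (t : ℝ≥0) : ℝ≥0 := (⌊t * (k + 1)⌋₊ + 1) / (k + 1)

lemma lt_gridPoint (k : ℕ) (t : ℝ≥0) : t < gridPoint k t := by
  rw [gridPoint, lt_div_iff₀ (by positivity)]
  exact Nat.lt_floor_add_one _

lemma gridPoint_le (k : ℕ) (t : ℝ≥0) : gridPoint k t ≤ t + 1 / (k + 1) := by
  rw [gridPoint, div_le_iff₀ (by positivity), add_mul, one_div_mul_cancel (by positivity)]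
  gcongr
  exact Nat.floor_le zero_le

lemma tendsto_gridPoint (t : ℝ≥0) : Tendsto (fun k => gridPoint k t) atTop (𝓝[≥] t) := by
  refine tendsto_nhdsWithin_iff.2 ⟨?_, Eventually.of_forall fun k => (lt_gridPoint k t).le⟩
  refine tendsto_of_tendsto_of_tendsto_of_le_of_le tendsto_const_nhds ?_
    (fun k => (lt_gridPoint k t).le) (fun k => gridPoint_le k t)
  have : Tendsto (fun k : ℕ => t + 1 / ((k : ℝ≥0) + 1)) atTop (𝓝 (t + 0)) :=
    tendsto_const_nhds.add (tendsto_one_div_add_atTop_nhds_zero_nat (𝕜 := ℝ≥0))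
  simpa using this

/-- The value at `t` of a right-continuous path, read off from its values at rational times.
Unlike the evaluation of paths it is jointly measurable in the path and in time. -/
noncomputable def cadlagEval (w : ℝ≥0 → ℝ) (t : ℝ≥0) : ℝ :=
  limsup (fun k => w (gridPoint k t)) atTop

lemma cadlagEval_eq {w : ℝ≥0 → ℝ} {t : ℝ≥0} (h : ContinuousWithinAt w (Set.Ici t) t) :
    cadlagEval w t = w t :=
  (Tendsto.comp h (tendsto_gridPoint t)).limsup_eq

/-- For fixed k the grid point depends on time only through a natural number, so measurability is
needed only on a product with a countable space; the limsup preserves it. -/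
lemma measurable_cadlagEval : Measurable fun p : (ℝ≥0 → ℝ) × ℝ≥0 => cadlagEval p.1 p.2 := by
  refine Measurable.limsup fun k => ?_
  have h : Measurable fun p : (ℝ≥0 → ℝ) × ℕ => p.1 ((p.2 + 1) / (k + 1)) :=
    measurable_from_prod_countable_left fun j =>
      (measurable_pi_apply ((j + 1 : ℝ≥0) / (k + 1)) : Measurable fun w : ℝ≥0 → ℝ => w _)
  exact h.comp (measurable_fst.prodMk
    (Nat.measurable_floor.comp (measurable_snd.mul_const _)))

lemma measurable_cadlagEval_time (t : ℝ≥0) : Measurable fun w : ℝ≥0 → ℝ => cadlagEval w t :=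
  Measurable.limsup fun k => measurable_pi_apply (gridPoint k t)

attribute [irreducible] cadlagEval

/-! ### Laws of stable processes -/

section StableProcess

variable {Ω : Type*} [MeasurableSpace Ω] {P : Measure Ω} {α : ℝ} {ξ ξ' : ℝ≥0 → Ω → ℝ}

lemma IsSymmetricStableProcess.ae_cadlagEval_eq (h : IsSymmetricStableProcess α ξ P) :
    ∀ᵐ ω ∂P, ∀ t, cadlagEval (fun s => ξ s ω) t = ξ t ω := by
  filter_upwards [h.cadlag] with ω hω t
  exact cadlagEval_eq (hω t).1

lemma IsSymmetricStableProcess.measurable_path (h : IsSymmetricStableProcess α ξ P) :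
    Measurable fun ω t => ξ t ω := measurable_pi_lambda _ h.measurable

/-- Telescoping along the sorted times, with time 0 put in front. -/
lemma Finset.restrict_eq_sum_increments (I : Finset ℝ≥0) (w : ℝ≥0 → ℝ) (h0 : w 0 = 0) (i : I) :
    w i = ∑ j ∈ Finset.Iic ((I.orderIsoOfFin rfl).symm i),
      (w ((Fin.cons 0 (I.orderEmbOfFin rfl) : Fin (I.card + 1) → ℝ≥0) j.succ) -
        w ((Fin.cons 0 (I.orderEmbOfFin rfl) : Fin (I.card + 1) → ℝ≥0) j.castSucc)) := by
  rw [Fin.sum_Iic_sub _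
    (fun j => w ((Fin.cons 0 (I.orderEmbOfFin rfl) : Fin (I.card + 1) → ℝ≥0) j))]
  simp [h0, Finset.orderEmbOfFin]

lemma monotone_cons_zero_orderEmbOfFin (I : Finset ℝ≥0) :
    Monotone (Fin.cons 0 (I.orderEmbOfFin rfl) : Fin (I.card + 1) → ℝ≥0) := by
  intro i j hij
  induction i using Fin.cases with
  | zero => simp
  | succ i =>
    induction j using Fin.cases with
    | zero => simp at hij
    | succ j => simpa using hij

/-- Two symmetric stable processes with the same index have the same law. -/
theorem IsSymmetricStableProcess.map_eq_map [IsProbabilityMeasure P]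
    (h : IsSymmetricStableProcess α ξ P) (h' : IsSymmetricStableProcess α ξ' P) :
    P.map (fun ω t => ξ t ω) = P.map (fun ω t => ξ' t ω) := by
  rw [map_eq_iff_forall_finset_map_restrict_eq h.measurable_path.aemeasurable
    h'.measurable_path.aemeasurable]
  intro I
  let τ : Fin (I.card + 1) → ℝ≥0 := Fin.cons 0 (I.orderEmbOfFin rfl)
  let F : (Fin I.card → ℝ) → (I → ℝ) :=
    fun d i => ∑ j ∈ Finset.Iic ((I.orderIsoOfFin rfl).symm i), d j
  have hF : Measurable F := by fun_prop
  -- A finite-dimensional law is the image under partial sums of the product of its increment laws,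
  -- and each of these is determined by its characteristic function.
  have key : ∀ {η : ℝ≥0 → Ω → ℝ}, IsSymmetricStableProcess α η P →
      P.map (fun ω => I.restrict fun t => η t ω) =
        (Measure.pi fun j : Fin I.card =>
          P.map fun ω => η (τ j.succ) ω - η (τ j.castSucc) ω).map F := by
    intro η hη
    have hm : ∀ j : Fin I.card, Measurable fun ω => η (τ j.succ) ω - η (τ j.castSucc) ω :=
      fun j => (hη.measurable _).sub (hη.measurable _)
    have hind := hη.indep_increments _ τ (monotone_cons_zero_orderEmbOfFin I)
    rw [iIndepFun_iff_map_fun_eq_pi_map fun j => (hm j).aemeasurable] at hind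
    rw [← hind, Measure.map_map hF (measurable_pi_lambda _ hm)]
    refine Measure.map_congr ?_
    filter_upwards [hη.start] with ω hω
    ext i
    exact Finset.restrict_eq_sum_increments I (fun t => η t ω) hω i
  rw [key h, key h']
  congr 2
  ext1 j
  have := Measure.isProbabilityMeasure_map (μ := P)
    ((h.measurable (τ j.succ)).sub (h.measurable (τ j.castSucc))).aemeasurable
  have := Measure.isProbabilityMeasure_map (μ := P)
    ((h'.measurable (τ j.succ)).sub (h'.measurable (τ j.castSucc))).aemeasurable
  refine Measure.ext_of_charFun (funext fun y => ?_)
  have hτ := monotone_cons_zero_orderEmbOfFin I (Fin.castSucc_le_succ j)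
  rw [h.charFun_increment _ _ hτ, h'.charFun_increment _ _ hτ]

variable [IsProbabilityMeasure P]

lemma IsSymmetricStableProcess.map_sub_eq_stableLaw (h : IsSymmetricStableProcess α ξ P)
    (hα : 0 < α) {s t : ℝ≥0} (hst : s < t) :
    P.map (fun ω => ξ t ω - ξ s ω) = stableLaw α (t - s) := by
  have := Measure.isProbabilityMeasure_map (μ := P)
    ((h.measurable t).sub (h.measurable s)).aemeasurable
  exact eq_stableLaw_of_charFun hα (sub_pos.2 (NNReal.coe_lt_coe.2 hst))
    (h.charFun_increment s t hst.le)

lemma IsSymmetricStableProcess.map_eq_stableLaw (h : IsSymmetricStableProcess α ξ P)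
    (hα : 0 < α) {t : ℝ≥0} (ht : 0 < t) : P.map (ξ t) = stableLaw α t := by
  have h1 := h.map_sub_eq_stableLaw hα ht
  simp only [NNReal.coe_zero, sub_zero] at h1
  rw [← h1]
  refine Measure.map_congr ?_
  filter_upwards [h.start] with ω hω
  rw [hω, sub_zero]

lemma IsSymmetricStableProcess.isProbabilityMeasure_stableLaw (h : IsSymmetricStableProcess α ξ P)
    (hα : 0 < α) {t : ℝ} (ht : 0 < t) : IsProbabilityMeasure (stableLaw α t) := by
  lift t to ℝ≥0 using ht.le
  rw [← h.map_eq_stableLaw hα (by exact_mod_cast ht)]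
  exact Measure.isProbabilityMeasure_map (h.measurable _).aemeasurable

lemma IsSymmetricStableProcess.stableDensity_nonneg (h : IsSymmetricStableProcess α ξ P)
    (hα : 0 < α) {t : ℝ} (ht : 0 < t) (x : ℝ) : 0 ≤ stableDensity α t x := by
  have := Measure.isProbabilityMeasure_map (μ := P)
    ((h.measurable t.toNNReal).sub (h.measurable 0)).aemeasurable
  have h1 := h.charFun_increment 0 t.toNNReal zero_le
  simp only [NNReal.coe_zero, sub_zero, Real.coe_toNNReal t ht.le] at h1
  exact stableDensity_nonneg_of_charFun hα ht h1 x

lemma IsSymmetricStableProcess.map_increments_eq_prod (h : IsSymmetricStableProcess α ξ P)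
    (hα : 0 < α) {s t r : ℝ≥0} (hs : 0 < s) (hst : s < t) (htr : t < r) :
    P.map (fun ω => (ξ s ω, ξ t ω - ξ s ω, ξ r ω - ξ t ω)) =
      (stableLaw α s).prod ((stableLaw α (t - s)).prod (stableLaw α (r - t))) := by
  have hind := h.indep_increments 3 ![0, s, t, r] (by
    intro i j hij
    fin_cases i <;> fin_cases j <;> simp_all [hs.le, hst.le, htr.le, hst.le.trans htr.le])
  have hm : ∀ i : Fin 3, Measurable fun ω =>
      ξ ((![0, s, t, r] : Fin 4 → ℝ≥0) i.succ) ω - ξ ((![0, s, t, r] : Fin 4 → ℝ≥0) i.castSucc) ω :=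
    fun i => (h.measurable _).sub (h.measurable _)
  have h12 := hind.indepFun (show (1 : Fin 3) ≠ 2 by decide)
  have h0 := (hind.indepFun_prodMk hm 1 2 0 (by decide) (by decide)).symm
  change IndepFun (fun ω => ξ t ω - ξ s ω) (fun ω => ξ r ω - ξ t ω) P at h12
  change IndepFun (fun ω => ξ s ω - ξ 0 ω) (fun ω => (ξ t ω - ξ s ω, ξ r ω - ξ t ω)) P at h0
  have hm' : ∀ a b, Measurable fun ω => ξ a ω - ξ b ω :=
    fun a b => (h.measurable a).sub (h.measurable b)
  rw [indepFun_iff_map_prod_eq_prod_map_map (hm' t s).aemeasurable (hm' r t).aemeasurable] at h12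
  rw [indepFun_iff_map_prod_eq_prod_map_map (hm' s 0).aemeasurable
    ((hm' t s).prodMk (hm' r t)).aemeasurable] at h0
  rw [h12] at h0
  rw [h.map_sub_eq_stableLaw hα hst, h.map_sub_eq_stableLaw hα htr,
    h.map_sub_eq_stableLaw hα hs] at h0
  simp only [NNReal.coe_zero, sub_zero] at h0
  rw [← h0]
  refine Measure.map_congr ?_
  filter_upwards [h.start] with ω hω
  rw [hω, sub_zero]

end StableProcess

/-! ### One particle at up to three times -/

/-- `κ` is the law on path space of a symmetric `α`-stable process started at `0`, as far as three
successive increments are concerned. -/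
structure IsStablePathLaw (α : ℝ) (κ : Measure (ℝ≥0 → ℝ)) : Prop where
  isProbabilityMeasure : IsProbabilityMeasure κ
  isProbabilityMeasure_stableLaw : ∀ t : ℝ, 0 < t → IsProbabilityMeasure (stableLaw α t)
  stableDensity_nonneg : ∀ t : ℝ, 0 < t → ∀ x, 0 ≤ stableDensity α t x
  map_increments : ∀ s t r : ℝ≥0, 0 < s → s < t → t < r →
    κ.map (fun w => (cadlagEval w s, cadlagEval w t - cadlagEval w s,
      cadlagEval w r - cadlagEval w t)) =
      (stableLaw α s).prod ((stableLaw α (t - s)).prod (stableLaw α (r - t)))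

lemma IsSymmetricStableProcess.isStablePathLaw {Ω : Type*} [MeasurableSpace Ω] {P : Measure Ω}
    [IsProbabilityMeasure P] {α : ℝ} {ξ : ℝ≥0 → Ω → ℝ} (h : IsSymmetricStableProcess α ξ P)
    (hα : 0 < α) : IsStablePathLaw α (P.map fun ω t => ξ t ω) where
  isProbabilityMeasure := Measure.isProbabilityMeasure_map h.measurable_path.aemeasurable
  isProbabilityMeasure_stableLaw _ ht := h.isProbabilityMeasure_stableLaw hα ht
  stableDensity_nonneg _ ht := h.stableDensity_nonneg hα ht
  map_increments s t r hs hst htr := by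
    have hm := measurable_cadlagEval_time
    rw [Measure.map_map (by fun_prop) h.measurable_path,
      ← h.map_increments_eq_prod hα hs hst htr]
    refine Measure.map_congr ?_
    filter_upwards [h.ae_cadlagEval_eq] with ω hω
    simp only [Function.comp, hω]

instance (γ : ℝ) : SigmaFinite (powerIntensity γ) := by
  unfold powerIntensity
  exact SigmaFinite.withDensity_of_ne_top (ae_of_all _ fun x => ENNReal.ofReal_ne_top)

/-- The intensity of the particles at time `t`. -/
noncomputable def particleIntensity (α γ t : ℝ) : Measure ℝ :=
  volume.withDensity (stablePotential α γ t)

instance (α γ t : ℝ) : SFinite (particleIntensity α γ t) := by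
  unfold particleIntensity; infer_instance

/-- The intensity of positions is the convolution of the initial intensity with the stable law, so
the potential is its Lebesgue density. -/
lemma map_add_powerIntensity_prod_stableLaw (α γ t : ℝ) :
    ((powerIntensity γ).prod (stableLaw α t)).map (fun p => p.1 + p.2)
      = particleIntensity α γ t := by
  refine Measure.ext_of_lintegral _ fun f hf => ?_
  rw [lintegral_map hf (by fun_prop), lintegral_prod_symm' _ (by fun_prop), particleIntensity,
    lintegral_withDensity_eq_lintegral_mul _ (measurable_stablePotential α γ t) hf]
  have h1 : ∀ a, ∫⁻ x, f (x + a) ∂(powerIntensity γ) =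
      ∫⁻ y, ENNReal.ofReal (|y - a| ^ (-γ)) * f y := by
    intro a
    rw [powerIntensity, lintegral_withDensity_eq_lintegral_mul _ (by fun_prop) (by fun_prop),
      ← lintegral_sub_right_eq_self _ a]
    simp
  simp_rw [h1]
  rw [lintegral_lintegral_swap (by fun_prop)]
  congr 1; ext y
  rw [lintegral_mul_const _ (by fun_prop)]
  rfl

section

variable {α γ : ℝ} {κ : Measure (ℝ≥0 → ℝ)}

/-- Independence of increments leaves the later two untouched when the displacement up to s is added
to the starting point; only that addition changes a factor of the product. -/
lemma IsStablePathLaw.map_triple (h : IsStablePathLaw α κ) {s t r : ℝ≥0}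
    (hs : 0 < s) (hst : s < t) (htr : t < r) :
    ((powerIntensity γ).prod κ).map (fun p => (p.1 + cadlagEval p.2 s,
      cadlagEval p.2 t - cadlagEval p.2 s, cadlagEval p.2 r - cadlagEval p.2 t)) =
    (particleIntensity α γ s).prod ((stableLaw α (t - s)).prod (stableLaw α (r - t))) := by
  have := h.isProbabilityMeasure
  have := h.isProbabilityMeasure_stableLaw s (by exact_mod_cast hs)
  have := h.isProbabilityMeasure_stableLaw (t - s) (sub_pos.2 (by exact_mod_cast hst))
  have := h.isProbabilityMeasure_stableLaw (r - t) (sub_pos.2 (by exact_mod_cast htr))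
  have hm := measurable_cadlagEval_time
  have h1 := Measure.map_prod_map (powerIntensity γ) κ measurable_id
    (show Measurable (fun w => (cadlagEval w s, cadlagEval w t - cadlagEval w s,
      cadlagEval w r - cadlagEval w t)) by fun_prop)
  rw [h.map_increments s t r hs hst htr, Measure.map_id] at h1
  have h2 := Measure.map_prod_map ((powerIntensity γ).prod (stableLaw α s))
    ((stableLaw α (t - s)).prod (stableLaw α (r - t)))
    (show Measurable (fun p : ℝ × ℝ => p.1 + p.2) by fun_prop) measurable_id
  rw [Measure.map_id, map_add_powerIntensity_prod_stableLaw] at h2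
  have h3 := ((measurePreserving_prodAssoc (powerIntensity γ) (stableLaw α s)
    ((stableLaw α (t - s)).prod (stableLaw α (r - t)))).symm).map_eq
  rw [h2, ← h3, h1, Measure.map_map (by fun_prop) (by fun_prop),
    Measure.map_map (by fun_prop) (by fun_prop)]
  rfl

lemma IsStablePathLaw.map_double (h : IsStablePathLaw α κ) {s t : ℝ≥0} (hs : 0 < s) (hst : s < t) :
    ((powerIntensity γ).prod κ).map (fun p => (p.1 + cadlagEval p.2 s,
      cadlagEval p.2 t - cadlagEval p.2 s)) =
    (particleIntensity α γ s).prod (stableLaw α (t - s)) := by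
  -- Any later third time serves, since its increment is integrated out with total mass 1.
  have htr : t < t + 1 := by simp
  have := h.isProbabilityMeasure_stableLaw (t - s) (sub_pos.2 (by exact_mod_cast hst))
  have := h.isProbabilityMeasure_stableLaw ((t + 1 : ℝ≥0) - t) (sub_pos.2 (by exact_mod_cast htr))
  have hm := measurable_cadlagEval_time
  have h1 := Measure.map_prod_map (particleIntensity α γ s)
    ((stableLaw α (t - s)).prod (stableLaw α ((t + 1 : ℝ≥0) - t))) measurable_id measurable_fst
  rw [Measure.map_id, Measure.map_fst_prod, measure_univ, one_smul,
    ← h.map_triple hs hst htr, Measure.map_map (by fun_prop) (by fun_prop)] at h1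
  rw [h1]
  rfl

lemma IsStablePathLaw.map_single (h : IsStablePathLaw α κ) {s : ℝ≥0} (hs : 0 < s) :
    ((powerIntensity γ).prod κ).map (fun p => p.1 + cadlagEval p.2 s) =
    particleIntensity α γ s := by
  have hst : s < s + 1 := by simp
  have := h.isProbabilityMeasure_stableLaw ((s + 1 : ℝ≥0) - s) (sub_pos.2 (by exact_mod_cast hst))
  have hm := measurable_cadlagEval_time
  have h1 := Measure.map_fst_prod (μ := particleIntensity α γ s)
    (ν := stableLaw α ((s + 1 : ℝ≥0) - s))
  rw [measure_univ, one_smul, ← h.map_double hs hst,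
    Measure.map_map (by fun_prop) (by fun_prop)] at h1
  exact h1

lemma lintegral_comp_add_le {ρ : Measure ℝ} {K : ℝ≥0∞} (hρ : ρ ≤ K • volume) (f : ℝ → ℝ≥0∞)
    (y : ℝ) : ∫⁻ b, f (y + b) ∂ρ ≤ K * ∫⁻ x, f x := by
  calc ∫⁻ b, f (y + b) ∂ρ ≤ ∫⁻ b, f (y + b) ∂(K • volume) := lintegral_mono' hρ le_rfl
    _ = K * ∫⁻ x, f x := by rw [lintegral_smul_measure, lintegral_add_left_eq_self, smul_eq_mul]

/-- A constant bounding the densities of the particles: `C` bounds the potential, and the transition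
density at time `t` is at most `t ^ (-1 / α) * p_1^α(0)`. -/
lemma particleIntensity_le (hα : 0 < α) {C : ℝ≥0} (hC : ∀ z, stablePotential α γ 1 z ≤ C)
    {t : ℝ} (ht : 0 < t) :
    particleIntensity α γ t ≤ (ENNReal.ofReal (t ^ (-γ / α)) * C) • volume := by
  rw [particleIntensity, ← withDensity_const]
  refine withDensity_mono (ae_of_all _ fun x => ?_)
  rw [stablePotential_scale hα ht]
  exact mul_le_mul_right (hC _) _

lemma IsStablePathLaw.lintegral_single_le (h : IsStablePathLaw α κ) (hα : 0 < α) {C : ℝ≥0}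
    (hC : ∀ z, stablePotential α γ 1 z ≤ C) {f : ℝ → ℝ≥0∞} (hf : Measurable f) {s : ℝ≥0}
    (hs : 0 < s) :
    ∫⁻ p, f (p.1 + cadlagEval p.2 s) ∂((powerIntensity γ).prod κ) ≤
      ENNReal.ofReal ((s : ℝ) ^ (-γ / α)) * C * ∫⁻ x, f x := by
  have hm := measurable_cadlagEval_time
  rw [← lintegral_map (f := f) (g := fun p : ℝ × (ℝ≥0 → ℝ) => p.1 + cadlagEval p.2 s) hf
    (by fun_prop), h.map_single hs]
  simpa using lintegral_comp_add_le (particleIntensity_le hα hC (by exact_mod_cast hs)) f 0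

/-- Integrate the increment first: its density is at most its value at 0, uniformly in the position
at s. What remains is controlled by the bound on the intensity at time s. -/
lemma IsStablePathLaw.lintegral_double_le (h : IsStablePathLaw α κ) (hα : 0 < α) {C : ℝ≥0}
    (hC : ∀ z, stablePotential α γ 1 z ≤ C) {f : ℝ → ℝ≥0∞} (hf : Measurable f) {s t : ℝ≥0}
    (hs : 0 < s) (hst : s < t) :
    ∫⁻ p, f (p.1 + cadlagEval p.2 s) * f (p.1 + cadlagEval p.2 t) ∂((powerIntensity γ).prod κ) ≤
      ENNReal.ofReal ((s : ℝ) ^ (-γ / α)) * C *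
      ENNReal.ofReal (((t : ℝ) - s) ^ (-1 / α) * stableDensity α 1 0) * (∫⁻ x, f x) ^ 2 := by
  have hm := measurable_cadlagEval_time
  have e : ∀ p : ℝ × (ℝ≥0 → ℝ), f (p.1 + cadlagEval p.2 s) * f (p.1 + cadlagEval p.2 t) =
    (fun q : ℝ × ℝ => f q.1 * f (q.1 + q.2))
      (p.1 + cadlagEval p.2 s, cadlagEval p.2 t - cadlagEval p.2 s) := fun p => by
    dsimp only
    rw [add_add_sub_cancel]
  have hts : (0 : ℝ) < t - s := sub_pos.2 (by exact_mod_cast hst)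
  simp_rw [e]
  rw [← lintegral_map (f := fun q : ℝ × ℝ => f q.1 * f (q.1 + q.2))
    (g := fun p : ℝ × (ℝ≥0 → ℝ) => (p.1 + cadlagEval p.2 s, cadlagEval p.2 t - cadlagEval p.2 s))
    (by fun_prop) (by fun_prop), h.map_double hs hst, lintegral_prod _ (by fun_prop)]
  calc _ ≤ ∫⁻ y, f y * (ENNReal.ofReal (((t : ℝ) - s) ^ (-1 / α) * stableDensity α 1 0) *
          ∫⁻ x, f x) ∂(particleIntensity α γ s) := by
        refine lintegral_mono fun y => ?_
        dsimp only
        rw [lintegral_const_mul _ (by fun_prop)]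
        gcongr
        exact lintegral_comp_add_le (stableLaw_le hα hts) f y
    _ ≤ _ := by
        rw [lintegral_mul_const _ hf]
        have := lintegral_comp_add_le (particleIntensity_le hα hC
          (show (0 : ℝ) < s by exact_mod_cast hs)) f 0
        simp only [zero_add] at this
        refine (mul_le_mul_left this _).trans (le_of_eq ?_)
        ring

/-- Integrate out the increments from the last one backwards, each costing the supremum of its
transition density. -/
lemma IsStablePathLaw.lintegral_triple_le (h : IsStablePathLaw α κ) (hα : 0 < α) {C : ℝ≥0}
    (hC : ∀ z, stablePotential α γ 1 z ≤ C) {f : ℝ → ℝ≥0∞} (hf : Measurable f) {s t r : ℝ≥0}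
    (hs : 0 < s) (hst : s < t) (htr : t < r) :
    ∫⁻ p, f (p.1 + cadlagEval p.2 s) * (f (p.1 + cadlagEval p.2 t) * f (p.1 + cadlagEval p.2 r))
        ∂((powerIntensity γ).prod κ) ≤
      ENNReal.ofReal ((s : ℝ) ^ (-γ / α)) * C *
      ENNReal.ofReal (((t : ℝ) - s) ^ (-1 / α) * stableDensity α 1 0) *
      ENNReal.ofReal (((r : ℝ) - t) ^ (-1 / α) * stableDensity α 1 0) * (∫⁻ x, f x) ^ 3 := by
  have hm := measurable_cadlagEval_time
  have e : ∀ p : ℝ × (ℝ≥0 → ℝ), f (p.1 + cadlagEval p.2 s) *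
    (f (p.1 + cadlagEval p.2 t) * f (p.1 + cadlagEval p.2 r)) =
    (fun q : ℝ × ℝ × ℝ => f q.1 * (f (q.1 + q.2.1) * f (q.1 + q.2.1 + q.2.2)))
      (p.1 + cadlagEval p.2 s, cadlagEval p.2 t - cadlagEval p.2 s,
        cadlagEval p.2 r - cadlagEval p.2 t) := fun p => by
    dsimp only
    rw [add_add_sub_cancel, add_add_sub_cancel]
  have hts : (0 : ℝ) < t - s := sub_pos.2 (by exact_mod_cast hst)
  have hrt : (0 : ℝ) < r - t := sub_pos.2 (by exact_mod_cast htr)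
  have := h.isProbabilityMeasure_stableLaw _ hts
  have := h.isProbabilityMeasure_stableLaw _ hrt
  simp_rw [e]
  rw [← lintegral_map
    (f := fun q : ℝ × ℝ × ℝ => f q.1 * (f (q.1 + q.2.1) * f (q.1 + q.2.1 + q.2.2)))
    (g := fun p : ℝ × (ℝ≥0 → ℝ) => (p.1 + cadlagEval p.2 s, cadlagEval p.2 t - cadlagEval p.2 s,
      cadlagEval p.2 r - cadlagEval p.2 t))
    (by fun_prop) (by fun_prop), h.map_triple hs hst htr, lintegral_prod _ (by fun_prop)]
  calc _ ≤ ∫⁻ y, f y * (ENNReal.ofReal (((t : ℝ) - s) ^ (-1 / α) * stableDensity α 1 0) *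
          (∫⁻ x, f x) * (ENNReal.ofReal (((r : ℝ) - t) ^ (-1 / α) * stableDensity α 1 0) *
          ∫⁻ x, f x)) ∂(particleIntensity α γ s) := by
        refine lintegral_mono fun y => ?_
        dsimp only
        rw [lintegral_const_mul _ (by fun_prop), lintegral_prod _ (by fun_prop)]
        gcongr
        calc _ ≤ ∫⁻ b, f (y + b) * (ENNReal.ofReal (((r : ℝ) - t) ^ (-1 / α) *
              stableDensity α 1 0) * ∫⁻ x, f x) ∂(stableLaw α (t - s)) := by
              refine lintegral_mono fun b => ?_
              dsimp only
              rw [lintegral_const_mul _ (by fun_prop)]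
              gcongr
              exact lintegral_comp_add_le (stableLaw_le hα hrt) f _
          _ ≤ _ := by
              rw [lintegral_mul_const _ (by fun_prop)]
              gcongr
              exact lintegral_comp_add_le (stableLaw_le hα hts) f _
    _ ≤ _ := by
        rw [lintegral_mul_const _ hf]
        have := lintegral_comp_add_le (particleIntensity_le hα hC
          (show (0 : ℝ) < s by exact_mod_cast hs)) f 0
        simp only [zero_add] at this
        refine (mul_le_mul_left this _).trans (le_of_eq ?_)
        ring

end

/-! ### Poisson random measures and their counts -/

lemma hasSum_poisson_mean (r : ℝ≥0) :
    HasSum (fun n : ℕ => Real.exp (-r) * r ^ n / n.factorial * (n : ℝ)) r := by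
  rw [← hasSum_nat_add_iff' 1]
  have h := (hasSum_one_poissonMeasure r).mul_left (r : ℝ)
  simp only [Finset.range_one, Finset.sum_singleton, Nat.cast_zero, mul_zero, sub_zero]
  rw [mul_one] at h
  refine h.congr_fun fun n => ?_
  rw [Nat.factorial_succ]
  push_cast
  field_simp
  ring

lemma lintegral_natCast_poissonMeasure (r : ℝ≥0) :
    ∫⁻ k : ℕ, (k : ℝ≥0∞) ∂(poissonMeasure r) = r := by
  have h := hasSum_poisson_mean r
  rw [poissonMeasure, lintegral_sum_measure]
  simp only [lintegral_smul_measure, lintegral_dirac, smul_eq_mul]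
  have e : ∀ n : ℕ, ENNReal.ofReal (Real.exp (-r) * r ^ n / n.factorial) * n =
      ENNReal.ofReal (Real.exp (-r) * r ^ n / n.factorial * (n : ℝ)) := fun n => by
    rw [ENNReal.ofReal_mul (by positivity), ENNReal.ofReal_natCast]
  simp_rw [e]
  rw [← ENNReal.ofReal_tsum_of_nonneg (fun n => by positivity) h.summable, h.tsum_eq]
  simp

lemma integral_pow_poissonMeasure (r : ℝ≥0) (b : ℂ) :
    ∫ k : ℕ, b ^ k ∂(poissonMeasure r) = Complex.exp (r * (b - 1)) := by
  rw [integral_poissonMeasure]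
  have h := (NormedSpace.expSeries_div_hasSum_exp ((r : ℂ) * b)).tsum_eq
  rw [← Complex.exp_eq_exp_ℂ] at h
  have e : ∀ n : ℕ, (Real.exp (-r) * r ^ n / n.factorial : ℝ) • b ^ n =
      (Real.exp (-r) : ℂ) * (((r : ℂ) * b) ^ n / n.factorial) := fun n => by
    rw [Complex.real_smul]
    push_cast
    rw [mul_pow]
    ring
  simp_rw [e]
  rw [tsum_mul_left, h, Complex.ofReal_exp, ← Complex.exp_add]
  congr 1
  push_cast
  ring

lemma sum_dirac_apply_eq_encard {Ω E : Type*} [MeasurableSpace E] {x : ℕ → Ω → E} {B : Set E}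
    (hB : MeasurableSet B) (ω : Ω) :
    (Measure.sum fun n => Measure.dirac (x n ω)) B = ({n | x n ω ∈ B}.encard : ℝ≥0∞) := by
  rw [Measure.sum_apply _ hB, ← ENNReal.tsum_set_one,
    tsum_subtype {n | x n ω ∈ B} (fun _ => (1 : ℝ≥0∞))]
  congr 1; ext n
  rw [Measure.dirac_apply' _ hB]
  rfl

section Poisson

variable {Ω E : Type*} [MeasurableSpace Ω] [MeasurableSpace E] {P : Measure Ω}
  {μ : Measure E} {x : ℕ → Ω → E}

/-- The mean measure of a Poisson random measure is its intensity. -/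
theorem IsPoissonRandomMeasure.sum_map_eq [SigmaFinite μ] (hx : ∀ n, Measurable (x n))
    (h : IsPoissonRandomMeasure (fun ω => Measure.sum fun n => Measure.dirac (x n ω)) μ P) :
    Measure.sum (fun n => P.map (x n)) = μ := by
  have hfin : ∀ B, MeasurableSet B → μ B ≠ ∞ → Measure.sum (fun n => P.map (x n)) B = μ B := by
    intro B hB hμB
    have h1 : ∫⁻ ω, (Measure.sum fun n => Measure.dirac (x n ω)) B ∂P = μ B := by
      have := lintegral_map' (μ := P) (f := fun a : ℝ≥0∞ => a) measurable_id.aemeasurable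
        (h.aemeasurable B hB)
      rw [← this, h.law B hB hμB, lintegral_map (f := fun a : ℝ≥0∞ => a) measurable_id .of_discrete,
        lintegral_natCast_poissonMeasure, ENNReal.coe_toNNReal hμB]
    rw [← h1, Measure.sum_apply _ hB]
    simp_rw [Measure.sum_apply _ hB]
    rw [lintegral_tsum]
    · congr 1; ext n
      simp_rw [Measure.dirac_apply' _ hB]
      rw [Measure.map_apply (hx n) hB]
      have : (fun ω => B.indicator (1 : E → ℝ≥0∞) (x n ω)) = (x n ⁻¹' B).indicator 1 := rfl
      rw [this, lintegral_indicator_one (hx n hB)]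
    · intro n
      simp_rw [Measure.dirac_apply' _ hB]
      exact ((measurable_one.indicator hB).comp (hx n)).aemeasurable
  refine (Measure.ext_iff_of_iUnion_eq_univ (iUnion_spanningSets μ)).2 fun i => ?_
  ext B hB
  rw [Measure.restrict_apply hB, Measure.restrict_apply hB]
  refine hfin _ (hB.inter (measurableSet_spanningSets μ i)) ?_
  exact (measure_mono Set.inter_subset_right).trans_lt (measure_spanningSets_lt_top μ i) |>.ne

/-- Only k indices contribute a factor, so the partial products are eventually constant. -/
lemma tendsto_prod_ite_of_encard_eq {p : ℕ → Prop} [DecidablePred p] {k : ℕ}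
    (h : ({n | p n}.encard : ℝ≥0∞) = k) (b : ℂ) :
    Tendsto (fun m => ∏ n ∈ Finset.range m, if p n then b else 1) atTop (𝓝 (b ^ k)) := by
  have h' : {n | p n}.encard = k := by
    have : ((k : ℕ∞) : ℝ≥0∞) = k := by simp
    rw [← this] at h
    exact ENat.toENNReal_inj.1 h
  have hfin : {n | p n}.Finite := Set.finite_of_encard_eq_coe h'
  obtain ⟨M, hM⟩ := hfin.bddAbove
  apply tendsto_const_nhds.congr'
  filter_upwards [eventually_gt_atTop M] with m hm
  rw [Finset.prod_ite, Finset.prod_const_one, mul_one, Finset.prod_const]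
  congr 1
  have : ((Finset.range m).filter p : Set ℕ) = {n | p n} := by
    ext n
    simp only [Finset.coe_filter, Finset.mem_range, Set.mem_ofPred_eq, and_iff_right_iff_imp]
    intro hn
    exact lt_of_le_of_lt (hM hn) hm
  rw [← this, Set.encard_coe_eq_coe_finsetCard] at h'
  exact_mod_cast h'.symm

lemma IsPoissonRandomMeasure.ae_exists_natCast
    {N : Ω → Measure E} (h : IsPoissonRandomMeasure N μ P) {B : Set E} (hB : MeasurableSet B)
    (hμB : μ B ≠ ∞) : ∀ᵐ ω ∂P, ∃ k : ℕ, N ω B = k := by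
  have h1 : ∀ᵐ a ∂(P.map fun ω => N ω B), a ∈ Set.range (fun k : ℕ => (k : ℝ≥0∞)) := by
    rw [h.law B hB hμB]
    have hmeas : MeasurableSet (Set.range (fun k : ℕ => (k : ℝ≥0∞))) :=
      (Set.countable_range _).measurableSet
    exact (ae_map_iff Measurable.of_discrete.aemeasurable hmeas).2 (ae_of_all _ fun k => ⟨k, rfl⟩)
  filter_upwards [ae_of_ae_map (h.aemeasurable B hB) h1] with ω hω
  obtain ⟨k, hk⟩ := hω
  exact ⟨k, hk.symm⟩

lemma measurable_pow_floor_toReal (b : ℂ) : Measurable fun a : ℝ≥0∞ => b ^ ⌊a.toReal⌋₊ :=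
  (Measurable.of_discrete (f := fun k : ℕ => b ^ k)).comp
    (Nat.measurable_floor.comp ENNReal.measurable_toReal)

/-- The floor recovers the integer from the extended-real count, which is almost surely a natural
number; the claim is then the generating function of the Poisson law. -/
lemma IsPoissonRandomMeasure.integral_pow
    {N : Ω → Measure E} (h : IsPoissonRandomMeasure N μ P) {B : Set E} (hB : MeasurableSet B)
    (hμB : μ B ≠ ∞) (b : ℂ) :
    ∫ ω, b ^ ⌊(N ω B).toReal⌋₊ ∂P = Complex.exp (μ.real B * (b - 1)) := by
  have h1 := integral_map (μ := P) (f := fun a : ℝ≥0∞ => b ^ ⌊a.toReal⌋₊) (h.aemeasurable B hB)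
    (measurable_pow_floor_toReal b).aestronglyMeasurable
  rw [← h1, h.law B hB hμB, integral_map Measurable.of_discrete.aemeasurable
    (measurable_pow_floor_toReal b).aestronglyMeasurable]
  simp only [ENNReal.toReal_natCast, Nat.floor_natCast]
  rw [integral_pow_poissonMeasure]
  rfl

lemma IsPoissonRandomMeasure.iIndepFun_finset {ι : Type*}
    {N : Ω → Measure E} (h : IsPoissonRandomMeasure N μ P) (s : Finset ι) (B : ι → Set E)
    (hB : ∀ i, MeasurableSet (B i)) (hd : Pairwise fun i j => Disjoint (B i) (B j)) :
    iIndepFun (fun (i : s) ω => N ω (B i)) P := by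
  have h1 := h.indep s.card (fun i => B (s.equivFin.symm i)) (fun i => hB _)
    (fun i j hij => hd fun hc => hij (s.equivFin.symm.injective (Subtype.ext hc)))
  have h2 := h1.precomp s.equivFin.injective
  simpa using h2

open Classical in
-- Grouping the points by the value of f turns the infinite product into a finite one of (1 +
-- c)^{N(f = c)}. The counts are independent Poisson variables, so the expectation is the product of
-- the exp (μ(f = c) c). The bound on 1 + f dominates the partial products.
lemma IsPoissonRandomMeasure.tendsto_integral_prod_simpleFunc [IsProbabilityMeasure P]
    (hx : ∀ n, Measurable (x n))
    (h : IsPoissonRandomMeasure (fun ω => Measure.sum fun n => Measure.dirac (x n ω)) μ P)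
    (f : SimpleFunc E ℂ) (hf : Integrable f μ) (hf1 : ∀ y, ‖1 + f y‖ ≤ 1) :
    Tendsto (fun m => ∫ ω, ∏ n ∈ Finset.range m, (1 + f (x n ω)) ∂P) atTop
      (𝓝 (Complex.exp (∫ y, f y ∂μ))) := by
  -- The value 0 is dropped because its level set may have infinite intensity; its points contribute
  -- the factor 1.
  let s : Finset ℂ := f.range.erase 0
  have hB : ∀ c : ℂ, MeasurableSet (f ⁻¹' {c}) := fun c => f.measurableSet_fiber c
  have hfin : ∀ c ∈ s, μ (f ⁻¹' {c}) ≠ ∞ := fun c hc =>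
    (f.measure_preimage_lt_top_of_integrable hf (Finset.ne_of_mem_erase hc)).ne
  have hprod : ∀ y, 1 + f y = ∏ c ∈ s, if f y = c then 1 + c else 1 := by
    intro y
    rw [Finset.prod_ite_eq]
    split_ifs with hy
    · rfl
    · have : f y = 0 := by
        by_contra hne
        exact hy (Finset.mem_erase.2 ⟨hne, f.mem_range_self y⟩)
      rw [this, add_zero]
  have hlim : ∀ᵐ ω ∂P, Tendsto (fun m => ∏ n ∈ Finset.range m, (1 + f (x n ω))) atTop
      (𝓝 (∏ c ∈ s, (1 + c) ^
        ⌊((Measure.sum fun n => Measure.dirac (x n ω)) (f ⁻¹' {c})).toReal⌋₊)) := by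
    have hae : ∀ᵐ ω ∂P, ∀ c ∈ s, ∃ k : ℕ,
        (Measure.sum fun n => Measure.dirac (x n ω)) (f ⁻¹' {c}) = k := by
      rw [Filter.eventually_all_finset]
      exact fun c hc => h.ae_exists_natCast (hB c) (hfin c hc)
    filter_upwards [hae] with ω hω
    simp_rw [hprod]
    simp_rw [Finset.prod_comm (s := Finset.range _)]
    refine tendsto_finsetProd _ fun c hc => ?_
    obtain ⟨k, hk⟩ := hω c hc
    rw [hk, ENNReal.toReal_natCast, Nat.floor_natCast]
    rw [sum_dirac_apply_eq_encard (hB c)] at hk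
    exact tendsto_prod_ite_of_encard_eq hk _
  have h1 : Tendsto (fun m => ∫ ω, ∏ n ∈ Finset.range m, (1 + f (x n ω)) ∂P) atTop
      (𝓝 (∫ ω, ∏ c ∈ s, (1 + c) ^
        ⌊((Measure.sum fun n => Measure.dirac (x n ω)) (f ⁻¹' {c})).toReal⌋₊ ∂P)) := by
    refine tendsto_integral_of_dominated_convergence (fun _ => 1) (fun m => ?_)
      (integrable_const _) (fun m => ?_) hlim
    · have hfm := f.measurable
      have : Measurable fun ω => ∏ n ∈ Finset.range m, (1 + f (x n ω)) :=
        Finset.measurable_fun_prod _ fun n _ => measurable_const.add (hfm.comp (hx n))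
      exact this.aestronglyMeasurable
    · filter_upwards with ω
      rw [norm_prod]
      exact Finset.prod_le_one (fun _ _ => norm_nonneg _) fun n _ => hf1 _
  convert h1 using 2
  have hind := h.iIndepFun_finset s (fun c : ℂ => f ⁻¹' {c}) hB fun c d hcd =>
    Disjoint.preimage _ (by simpa using hcd)
  have hint := hind.integral_fun_prod_comp
    (f := fun (c : s) (a : ℝ≥0∞) => (1 + (c : ℂ)) ^ ⌊a.toReal⌋₊)
    (fun c => h.aemeasurable _ (hB c)) fun c => (measurable_pow_floor_toReal _).aestronglyMeasurable
  simp_rw [← Finset.prod_coe_sort s]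
  rw [hint]
  have : ∀ c : s, ∫ ω, (1 + (c : ℂ)) ^
      ⌊((Measure.sum fun n => Measure.dirac (x n ω)) (f ⁻¹' {(c : ℂ)})).toReal⌋₊ ∂P =
      Complex.exp (μ.real (f ⁻¹' {(c : ℂ)}) * c) := fun c => by
    rw [h.integral_pow (hB c) (hfin c c.2), add_sub_cancel_left]
  simp_rw [this]
  rw [Finset.prod_coe_sort s (fun c => Complex.exp (μ.real (f ⁻¹' {c}) * c)), ← Complex.exp_sum,
    ← SimpleFunc.integral_eq_integral _ hf, SimpleFunc.integral_eq]
  congr 1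
  simp_rw [Complex.real_smul]
  exact (Finset.sum_erase _ (by simp)).symm

end Poisson

lemma norm_prod_sub_prod_le_sum {ι : Type*} (s : Finset ι) (a b : ι → ℂ) (ha : ∀ i, ‖a i‖ ≤ 1)
    (hb : ∀ i, ‖b i‖ ≤ 1) : ‖∏ i ∈ s, a i - ∏ i ∈ s, b i‖ ≤ ∑ i ∈ s, ‖a i - b i‖ := by
  classical
  induction s using Finset.induction_on with
  | empty => simp
  | insert i s hi ih =>
    rw [Finset.prod_insert hi, Finset.prod_insert hi, Finset.sum_insert hi]
    have hp : ‖∏ i ∈ s, a i‖ ≤ 1 := by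
      rw [norm_prod]; exact Finset.prod_le_one (fun _ _ => norm_nonneg _) fun i _ => ha i
    calc ‖a i * ∏ i ∈ s, a i - b i * ∏ i ∈ s, b i‖
        = ‖(a i - b i) * ∏ i ∈ s, a i + b i * (∏ i ∈ s, a i - ∏ i ∈ s, b i)‖ := by ring_nf
      _ ≤ ‖a i - b i‖ * ‖∏ i ∈ s, a i‖ + ‖b i‖ * ‖∏ i ∈ s, a i - ∏ i ∈ s, b i‖ := by
          refine (norm_add_le _ _).trans ?_
          rw [norm_mul, norm_mul]
      _ ≤ ‖a i - b i‖ * 1 + 1 * ∑ i ∈ s, ‖a i - b i‖ := by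
          gcongr
          exact hb i
      _ = _ := by ring

/-! ### Campbell's formula and the marked characteristic functional -/

section Campbell

variable {Ω E : Type*} [MeasurableSpace Ω] [MeasurableSpace E] {P : Measure Ω}
  {μ : Measure E} {x : ℕ → Ω → E}

lemma lintegral_tsum_comp_eq (hx : ∀ n, Measurable (x n))
    (hμ : Measure.sum (fun n => P.map (x n)) = μ) {f : E → ℝ≥0∞} (hf : Measurable f) :
    ∫⁻ ω, ∑' n, f (x n ω) ∂P = ∫⁻ y, f y ∂μ := by
  rw [lintegral_tsum (f := fun n ω => f (x n ω)) fun n => (hf.comp (hx n)).aemeasurable, ← hμ,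
    lintegral_sum_measure]
  congr 1; ext n
  rw [lintegral_map hf (hx n)]

lemma ae_forall_of_ae_sum_map (hx : ∀ n, Measurable (x n))
    (hμ : Measure.sum (fun n => P.map (x n)) = μ) {p : E → Prop} (hp : ∀ᵐ y ∂μ, p y) :
    ∀ᵐ ω ∂P, ∀ n, p (x n ω) := by
  rw [← hμ, Measure.ae_sum_iff] at hp
  exact ae_all_iff.2 fun n => ae_of_ae_map (hx n).aemeasurable (hp n)

lemma ae_summable_and_integrable_tsum {f : ℕ → Ω → ℝ} (hf : ∀ n, Measurable (f n))
    (hfin : ∑' n, ∫⁻ ω, ‖f n ω‖ₑ ∂P ≠ ∞) :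
    (∀ᵐ ω ∂P, Summable fun n => f n ω) ∧ Integrable (fun ω => ∑' n, f n ω) P := by
  rw [← lintegral_tsum fun n => (hf n).enorm.aemeasurable] at hfin
  constructor
  · filter_upwards [ae_lt_top (Measurable.tsum fun n => (hf n).enorm) hfin] with ω hω
    refine Summable.of_norm ?_
    simpa using ENNReal.summable_toReal hω.ne
  · exact ⟨(Measurable.tsum hf).aestronglyMeasurable,
      lt_of_le_of_lt (lintegral_mono fun ω => enorm_tsum_le_tsum_enorm) hfin.lt_top⟩

/-- **Campbell's formula** for integrable functions. -/
lemma campbell (hx : ∀ n, Measurable (x n))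
    (hμ : Measure.sum (fun n => P.map (x n)) = μ) {G : E → ℝ} (hG : Measurable G)
    (hGi : Integrable G μ) :
    (∀ᵐ ω ∂P, Summable fun n => G (x n ω)) ∧ Integrable (fun ω => ∑' n, G (x n ω)) P ∧
      ∫ ω, ∑' n, G (x n ω) ∂P = ∫ y, G y ∂μ := by
  have hmeas : ∀ n, Measurable fun ω => G (x n ω) := fun n => hG.comp (hx n)
  have hfin : ∑' n, ∫⁻ ω, ‖G (x n ω)‖ₑ ∂P ≠ ∞ := by
    rw [← lintegral_tsum fun n => (hmeas n).enorm.aemeasurable,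
      lintegral_tsum_comp_eq hx hμ (f := fun y => ‖G y‖ₑ) (by fun_prop)]
    exact hGi.2.ne
  obtain ⟨hsum, hint⟩ := ae_summable_and_integrable_tsum hmeas hfin
  refine ⟨hsum, hint, ?_⟩
  rw [integral_tsum (fun n => (hmeas n).aestronglyMeasurable) hfin]
  rw [← hμ] at hGi ⊢
  rw [integral_sum_measure hGi]
  congr 1; ext n
  rw [integral_map (hx n).aemeasurable hG.aestronglyMeasurable]

/-- The bound does not depend on m, which is what allows an L¹ approximation of the test function
before m tends to infinity. -/
lemma enorm_integral_prod_sub_le [IsProbabilityMeasure P] (hx : ∀ n, Measurable (x n))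
    (hμ : Measure.sum (fun n => P.map (x n)) = μ) {f g : E → ℂ} (hf : Measurable f)
    (hg : Measurable g) (hf1 : ∀ y, ‖f y‖ ≤ 1) (hg1 : ∀ y, ‖g y‖ ≤ 1) (m : ℕ) :
    ‖∫ ω, ∏ n ∈ Finset.range m, f (x n ω) ∂P - ∫ ω, ∏ n ∈ Finset.range m, g (x n ω) ∂P‖ₑ
      ≤ ∫⁻ y, ‖f y - g y‖ₑ ∂μ := by
  have hi : ∀ {f : E → ℂ}, Measurable f → (∀ y, ‖f y‖ ≤ 1) →
      Integrable (fun ω => ∏ n ∈ Finset.range m, f (x n ω)) P := fun {f} hf hf1 => by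
    refine Integrable.of_bound (C := 1) ?_ ?_
    · exact (Finset.measurable_fun_prod _ fun n _ => hf.comp (hx n)).aestronglyMeasurable
    · filter_upwards with ω
      rw [norm_prod]
      exact Finset.prod_le_one (fun _ _ => norm_nonneg _) fun n _ => hf1 _
  rw [← integral_sub (hi hf hf1) (hi hg hg1), ← lintegral_tsum_comp_eq hx hμ (by fun_prop)]
  refine (enorm_integral_le_lintegral_enorm _).trans (lintegral_mono fun ω => ?_)
  refine le_trans ?_ (ENNReal.sum_le_tsum (Finset.range m))
  have h := norm_prod_sub_prod_le_sum (Finset.range m) (fun n => f (x n ω)) (fun n => g (x n ω))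
    (fun n => hf1 _) (fun n => hg1 _)
  rw [← ofReal_norm]
  refine (ENNReal.ofReal_le_ofReal h).trans ?_
  rw [ENNReal.ofReal_sum_of_nonneg fun _ _ => norm_nonneg _]
  simp_rw [ofReal_norm]
  exact le_rfl

/-- The generating functional of a Poisson random measure. -/
theorem IsPoissonRandomMeasure.tendsto_integral_prod [IsProbabilityMeasure P] [SigmaFinite μ]
    (hx : ∀ n, Measurable (x n))
    (h : IsPoissonRandomMeasure (fun ω => Measure.sum fun n => Measure.dirac (x n ω)) μ P)
    {g : E → ℂ} (hg : Measurable g) (hg1 : ∀ y, ‖g y‖ ≤ 1) (hgi : Integrable (fun y => g y - 1) μ) :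
    Tendsto (fun m => ∫ ω, ∏ n ∈ Finset.range m, g (x n ω) ∂P) atTop
      (𝓝 (Complex.exp (∫ y, (g y - 1) ∂μ))) := by
  have hμ := h.sum_map_eq hx
  have hfm : Measurable fun y => g y - 1 := hg.sub_const 1
  -- The approximants take values in this set, so that their factors 1 + F k still have modulus at
  -- most 1.
  let s : Set ℂ := {c | ‖1 + c‖ ≤ 1}
  have h0 : (0 : ℂ) ∈ s := by simp [s]
  let F : ℕ → SimpleFunc E ℂ := SimpleFunc.approxOn (fun y => g y - 1) hfm s 0 h0
  have hFs : ∀ k y, ‖1 + F k y‖ ≤ 1 := fun k y => SimpleFunc.approxOn_mem hfm h0 k y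
  have hFi : ∀ k, Integrable (F k) μ := fun k =>
    SimpleFunc.integrable_approxOn hfm hgi h0 (integrable_zero _ _ _) k
  have hL1 : Tendsto (fun k => ∫⁻ y, ‖F k y - (g y - 1)‖ₑ ∂μ) atTop (𝓝 0) :=
    SimpleFunc.tendsto_approxOn_L1_enorm hfm h0
      (ae_of_all _ fun y => subset_closure (by simpa [s] using hg1 y)) (by simpa using hgi.2)
  have hexp : Tendsto (fun k => Complex.exp (∫ y, F k y ∂μ)) atTop
      (𝓝 (Complex.exp (∫ y, (g y - 1) ∂μ))) :=
    (Complex.continuous_exp.tendsto _).comp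
      (tendsto_integral_of_L1 _ hgi.1 (Eventually.of_forall hFi) hL1)
  rw [Metric.tendsto_atTop] at hexp ⊢
  intro ε hε
  obtain ⟨k₁, hk₁⟩ := hexp (ε / 3) (by positivity)
  obtain ⟨k₂, hk₂⟩ := eventually_atTop.1 (hL1.eventually
    (gt_mem_nhds (show (0 : ℝ≥0∞) < ENNReal.ofReal (ε / 3) by simpa using hε)))
  let k := max k₁ k₂
  obtain ⟨M, hM⟩ := Metric.tendsto_atTop.1
    (h.tendsto_integral_prod_simpleFunc hx (F k) (hFi k) (hFs k)) (ε / 3) (by positivity)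
  refine ⟨M, fun m hm => ?_⟩
  have e1 : dist (∫ ω, ∏ n ∈ Finset.range m, g (x n ω) ∂P)
      (∫ ω, ∏ n ∈ Finset.range m, (1 + F k (x n ω)) ∂P) < ε / 3 := by
    rw [dist_comm, dist_eq_norm]
    have h1 := enorm_integral_prod_sub_le hx hμ (f := fun y => 1 + F k y)
      (measurable_const.add (F k).measurable) hg (hFs k) hg1 m
    have h2 : ∫⁻ y, ‖1 + F k y - g y‖ₑ ∂μ < ENNReal.ofReal (ε / 3) := by
      refine lt_of_eq_of_lt ?_ (hk₂ k (le_max_right _ _))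
      congr 1; ext y; congr 1; ring
    have h3 := lt_of_le_of_lt h1 h2
    rw [← ofReal_norm, ENNReal.ofReal_lt_ofReal_iff (by positivity)] at h3
    exact h3
  calc _ ≤ _ := dist_triangle4 _ (∫ ω, ∏ n ∈ Finset.range m, (1 + F k (x n ω)) ∂P)
        (Complex.exp (∫ y, F k y ∂μ)) _
    _ < ε / 3 + ε / 3 + ε / 3 := by
        gcongr
        · exact hM m hm
        · exact hk₁ k (le_max_left _ _)
    _ = ε := by ring

variable {F : Type*} [MeasurableSpace F] {κ : Measure F} {w : ℕ → Ω → F}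

lemma sum_map_marked_eq [IsProbabilityMeasure P] [SFinite κ] (hx : ∀ n, Measurable (x n))
    (hμ : Measure.sum (fun n => P.map (x n)) = μ) (hw : ∀ n, Measurable (w n))
    (hwκ : ∀ n, P.map (w n) = κ) (hxw : ∀ n, IndepFun (x n) (w n) P) :
    Measure.sum (fun n => P.map fun ω => (x n ω, w n ω)) = μ.prod κ := by
  rw [← hμ, Measure.prod_sum_left]
  congr 1; ext1 n
  rw [← hwκ n]
  exact (indepFun_iff_map_prod_eq_prod_map_map (hx n).aemeasurable (hw n).aemeasurable).1 (hxw n)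

/-- Freeze the starting points; the marks are then independent with law κ, and the integral splits
over the factors. -/
lemma integral_prod_exp_marked [IsProbabilityMeasure P] [IsProbabilityMeasure κ]
    (hx : ∀ n, Measurable (x n)) (hw : ∀ n, Measurable (w n)) (hwκ : ∀ n, P.map (w n) = κ)
    (hwind : iIndepFun w P) (hxw : IndepFun (fun ω n => x n ω) (fun ω n => w n ω) P)
    {G : E × F → ℝ} (hG : Measurable G) (m : ℕ) :
    ∫ ω, ∏ n ∈ Finset.range m, Complex.exp (Complex.I * G (x n ω, w n ω)) ∂P =
      ∫ ω, ∏ n ∈ Finset.range m, (∫ b, Complex.exp (Complex.I * G (x n ω, b)) ∂κ) ∂P := by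
  have hxm : Measurable fun ω n => x n ω := measurable_pi_lambda _ hx
  have hwm : Measurable fun ω n => w n ω := measurable_pi_lambda _ hw
  have hlaw := (indepFun_iff_map_prod_eq_prod_map_map hxm.aemeasurable hwm.aemeasurable).1 hxw
  let Φ : (ℕ → E) × (ℕ → F) → ℂ :=
    fun q => ∏ n ∈ Finset.range m, Complex.exp (Complex.I * G (q.1 n, q.2 n))
  have hΦ : Measurable Φ := Finset.measurable_fun_prod _ fun n _ => by fun_prop
  have hΦ1 : ∀ q, ‖Φ q‖ ≤ 1 := fun q => by
    rw [norm_prod]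
    exact Finset.prod_le_one (fun _ _ => norm_nonneg _) fun n _ =>
      (Complex.norm_exp_I_mul_ofReal _).le
  have := Measure.isProbabilityMeasure_map (μ := P) hxm.aemeasurable
  have := Measure.isProbabilityMeasure_map (μ := P) hwm.aemeasurable
  have h1 : ∫ ω, Φ (fun n => x n ω, fun n => w n ω) ∂P =
      ∫ a, ∫ b, Φ (a, b) ∂(P.map fun ω n => w n ω) ∂(P.map fun ω n => x n ω) := by
    rw [← integral_prod, ← hlaw, integral_map (hxm.prodMk hwm).aemeasurable hΦ.aestronglyMeasurable]
    exact Integrable.of_bound hΦ.aestronglyMeasurable 1 (ae_of_all _ hΦ1)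
  have h2 : ∀ a : ℕ → E, ∫ b, Φ (a, b) ∂(P.map fun ω n => w n ω) =
      ∏ n ∈ Finset.range m, ∫ b, Complex.exp (Complex.I * G (a n, b)) ∂κ := by
    intro a
    rw [integral_map (f := fun b => Φ (a, b)) hwm.aemeasurable
      (hΦ.comp (measurable_const.prodMk measurable_id)).aestronglyMeasurable]
    have hind := (hwind.precomp (g := fun i : Finset.range m => (i : ℕ))
      Subtype.val_injective)
    have h3 := hind.integral_fun_prod_comp
      (f := fun (i : Finset.range m) (b : F) => Complex.exp (Complex.I * G (a i, b)))
      (fun i => (hw i).aemeasurable) fun i => by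
        have : Measurable fun b => Complex.exp (Complex.I * G (a i, b)) := by fun_prop
        exact this.aestronglyMeasurable
    simp only [Φ]
    simp_rw [← Finset.prod_coe_sort (Finset.range m)]
    rw [h3]
    refine Finset.prod_congr rfl fun i _ => ?_
    rw [← hwκ i, integral_map (hw i).aemeasurable]
    have : Measurable fun b => Complex.exp (Complex.I * G (a i, b)) := by fun_prop
    exact this.aestronglyMeasurable
  refine h1.trans ?_
  simp_rw [h2]
  rw [integral_map hxm.aemeasurable]
  have hgm : Measurable fun y => ∫ b, Complex.exp (Complex.I * G (y, b)) ∂κ := by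
    have : StronglyMeasurable fun q : E × F => Complex.exp (Complex.I * G q) :=
      Measurable.stronglyMeasurable (by fun_prop)
    exact this.integral_prod_right'.measurable
  exact (Finset.measurable_fun_prod _ fun n _ =>
    hgm.comp (measurable_pi_apply n)).aestronglyMeasurable

/-- The characteristic functional of an independently marked Poisson random measure. -/
theorem IsPoissonRandomMeasure.integral_exp_tsum_marked [IsProbabilityMeasure P] [SigmaFinite μ]
    [IsProbabilityMeasure κ]
    (h : IsPoissonRandomMeasure (fun ω => Measure.sum fun n => Measure.dirac (x n ω)) μ P)
    (hx : ∀ n, Measurable (x n)) (hw : ∀ n, Measurable (w n)) (hwκ : ∀ n, P.map (w n) = κ)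
    (hwind : iIndepFun w P) (hxw : IndepFun (fun ω n => x n ω) (fun ω n => w n ω) P)
    {G : E × F → ℝ} (hG : Measurable G) (hGi : Integrable G (μ.prod κ)) :
    ∫ ω, Complex.exp (Complex.I * ((∑' n, G (x n ω, w n ω) : ℝ) : ℂ)) ∂P =
      Complex.exp (∫ q, (Complex.exp (Complex.I * G q) - 1) ∂(μ.prod κ)) := by
  have hμ := h.sum_map_eq hx
  have hxw' : ∀ n, IndepFun (x n) (w n) P := fun n =>
    hxw.comp (measurable_pi_apply n) (measurable_pi_apply n)
  have hμκ := sum_map_marked_eq hx hμ hw hwκ hxw'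
  have hsum := (campbell (fun n => (hx n).prodMk (hw n)) hμκ hG hGi).1
  have hem : Measurable fun q : E × F => Complex.exp (Complex.I * G q) := by fun_prop
  -- Averaging over the mark reduces to an unmarked Poisson measure with a test function of modulus
  -- at most 1.
  let g : E → ℂ := fun y => ∫ b, Complex.exp (Complex.I * G (y, b)) ∂κ
  have hgm : Measurable g := hem.stronglyMeasurable.integral_prod_right'.measurable
  have hei : ∀ y, Integrable (fun b => Complex.exp (Complex.I * G (y, b))) κ := fun y =>
    Integrable.of_bound (hem.comp measurable_prodMk_left).aestronglyMeasurable 1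
      (ae_of_all _ fun b => (Complex.norm_exp_I_mul_ofReal _).le)
  have hg1 : ∀ y, ‖g y‖ ≤ 1 := fun y => by
    refine (norm_integral_le_integral_norm _).trans ?_
    simp_rw [Complex.norm_exp_I_mul_ofReal]
    simp
  have hg_sub : ∀ y, g y - 1 = ∫ b, (Complex.exp (Complex.I * G (y, b)) - 1) ∂κ := fun y => by
    rw [integral_sub (hei y) (integrable_const _)]
    simp [g]
  have hi1 : Integrable (fun q => Complex.exp (Complex.I * G q) - 1) (μ.prod κ) :=
    hGi.mono (hem.sub_const 1).aestronglyMeasurable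
      (ae_of_all _ fun q => Real.norm_exp_I_mul_ofReal_sub_one_le)
  have hgi : Integrable (fun y => g y - 1) μ := by
    simp_rw [hg_sub]
    exact hi1.integral_prod_left
  have hlim := h.tendsto_integral_prod hx hgm hg1 hgi
  have hint : ∫ y, (g y - 1) ∂μ = ∫ q, (Complex.exp (Complex.I * G q) - 1) ∂(μ.prod κ) := by
    simp_rw [hg_sub]
    exact (integral_prod _ hi1).symm
  rw [hint] at hlim
  -- The partial products have the same expectations with and without averaging over the marks;
  -- their limit is computed in both ways.
  refine tendsto_nhds_unique ?_ hlim
  have hlim2 : Tendsto (fun m => ∫ ω, ∏ n ∈ Finset.range m,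
      Complex.exp (Complex.I * G (x n ω, w n ω)) ∂P) atTop
      (𝓝 (∫ ω, Complex.exp (Complex.I * ((∑' n, G (x n ω, w n ω) : ℝ) : ℂ)) ∂P)) := by
    refine tendsto_integral_of_dominated_convergence (fun _ => 1) (fun m => ?_)
      (integrable_const _) (fun m => ?_) ?_
    · exact (Finset.measurable_fun_prod _ fun n _ =>
        hem.comp ((hx n).prodMk (hw n))).aestronglyMeasurable
    · filter_upwards with ω
      rw [norm_prod]
      exact Finset.prod_le_one (fun _ _ => norm_nonneg _) fun n _ =>
        (Complex.norm_exp_I_mul_ofReal _).le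
    · filter_upwards [hsum] with ω hω
      have h1 := hω.hasSum.tendsto_sum_nat
      have h2 : Tendsto (fun m => Complex.exp (Complex.I *
          ((∑ n ∈ Finset.range m, G (x n ω, w n ω) : ℝ) : ℂ))) atTop
          (𝓝 (Complex.exp (Complex.I * ((∑' n, G (x n ω, w n ω) : ℝ) : ℂ)))) :=
        ((by fun_prop : Continuous fun r : ℝ => Complex.exp (Complex.I * (r : ℂ))).tendsto
          _).comp h1
      refine h2.congr fun m => ?_
      rw [← Complex.exp_sum, Complex.ofReal_sum, Finset.mul_sum]
  exact hlim2.congr fun m => integral_prod_exp_marked hx hw hwκ hwind hxw hG m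

end Campbell

/-! ### Time-ordered integrals -/

lemma measurable_setLIntegral_Ioi {X : Type*} [MeasurableSpace X] {μ : Measure ℝ} [SFinite μ]
    {H : X × ℝ → ℝ≥0∞} (hH : Measurable H) {t : X → ℝ} (ht : Measurable t) :
    Measurable fun q : X => ∫⁻ v in Set.Ioi (t q), H (q, v) ∂μ := by
  have e : ∀ q : X, ∫⁻ v in Set.Ioi (t q), H (q, v) ∂μ =
      ∫⁻ v, {z : X × ℝ | t z.1 < z.2}.indicator H (q, v) ∂μ := fun q => by
    rw [← lintegral_indicator measurableSet_Ioi]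
    rfl
  simp_rw [e]
  exact (hH.indicator
    (measurableSet_lt (ht.comp measurable_fst) measurable_snd)).lintegral_prod_right'

section OrderedIntegrals

variable {μ : Measure ℝ} [SFinite μ] {F H : ℝ → ℝ≥0∞}

lemma measurable_setLIntegral_Ioi_self (hH : Measurable H) :
    Measurable fun u : ℝ => ∫⁻ v in Set.Ioi u, H v ∂μ :=
  measurable_setLIntegral_Ioi (X := ℝ) (H := fun z => H z.2) (hH.comp measurable_snd) measurable_id

lemma measurable_mul_setLIntegral_Ioi (hF : Measurable F) (hH : Measurable H) :
    Measurable fun u : ℝ => F u * ∫⁻ v in Set.Ioi u, H v ∂μ :=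
  hF.mul (measurable_setLIntegral_Ioi_self hH)

/-- Split according to which of the two times comes first; the diagonal is negligible because μ has
no atoms. -/
lemma lintegral_mul_lintegral_eq_ordered [NullSingletonClass μ] (hF : Measurable F)
    (hH : Measurable H) :
    (∫⁻ u, F u ∂μ) * ∫⁻ u, H u ∂μ =
      ∫⁻ u, F u * ∫⁻ v in Set.Ioi u, H v ∂μ ∂μ + ∫⁻ u, H u * ∫⁻ v in Set.Ioi u, F v ∂μ ∂μ := by
  have h1 : (∫⁻ u, F u ∂μ) * ∫⁻ u, H u ∂μ =
      ∫⁻ u, (F u * ∫⁻ v in Set.Ioi u, H v ∂μ) + (F u * ∫⁻ v in Set.Iio u, H v ∂μ) ∂μ := by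
    rw [← lintegral_mul_const _ hF]
    congr 1; ext u
    rw [← mul_add, ← lintegral_add_compl H (measurableSet_Ioi (a := u)), Set.compl_Ioi,
      setLIntegral_congr Iio_ae_eq_Iic]
  rw [h1, lintegral_add_left (measurable_mul_setLIntegral_Ioi hF hH)]
  congr 1
  have e1 : ∀ u, F u * ∫⁻ v in Set.Iio u, H v ∂μ =
      ∫⁻ v, (Set.Iio u).indicator (fun v => F u * H v) v ∂μ := fun u => by
    rw [← lintegral_const_mul _ hH, lintegral_indicator measurableSet_Iio]
  have e2 : ∀ v, H v * ∫⁻ u in Set.Ioi v, F u ∂μ =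
      ∫⁻ u, (Set.Ioi v).indicator (fun u => H v * F u) u ∂μ := fun v => by
    rw [← lintegral_const_mul _ hF, lintegral_indicator measurableSet_Ioi]
  simp_rw [e1, e2]
  rw [lintegral_lintegral_swap]
  · congr 1; ext v; congr 1; ext u
    by_cases huv : v < u
    · rw [Set.indicator_of_mem (show v ∈ Set.Iio u from huv),
        Set.indicator_of_mem (show u ∈ Set.Ioi v from huv), mul_comm]
    · rw [Set.indicator_of_notMem (show v ∉ Set.Iio u from huv),
        Set.indicator_of_notMem (show u ∉ Set.Ioi v from huv)]
  · have : Measurable ({z : ℝ × ℝ | z.2 < z.1}.indicator fun z => F z.1 * H z.2) :=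
      (by fun_prop : Measurable fun z : ℝ × ℝ => F z.1 * H z.2).indicator
        (measurableSet_lt measurable_snd measurable_fst)
    exact this.aemeasurable

lemma lintegral_sq_eq_ordered [NullSingletonClass μ] (hF : Measurable F) :
    (∫⁻ u, F u ∂μ) ^ 2 = 2 * ∫⁻ u, F u * ∫⁻ v in Set.Ioi u, F v ∂μ ∂μ := by
  rw [sq, lintegral_mul_lintegral_eq_ordered hF hF, two_mul]

/-- The 6 = 3! orderings contribute equally. It arises as 2·(1 + 2): square one pair of factors,
then insert the third time either before the ordered pair or after its first element, where a
further square appears. -/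
lemma lintegral_cube_eq_ordered [NullSingletonClass μ] (hF : Measurable F) :
    (∫⁻ u, F u ∂μ) ^ 3 =
      6 * ∫⁻ u, F u * ∫⁻ v in Set.Ioi u, F v * ∫⁻ w in Set.Ioi v, F w ∂μ ∂μ ∂μ := by
  have hG : Measurable fun u => F u * ∫⁻ v in Set.Ioi u, F v ∂μ :=
    measurable_mul_setLIntegral_Ioi hF hF
  have h1 : ∀ u, (∫⁻ v in Set.Ioi u, F v ∂μ) ^ 2 =
      2 * ∫⁻ v in Set.Ioi u, F v * ∫⁻ w in Set.Ioi v, F w ∂μ ∂μ := fun u => by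
    rw [lintegral_sq_eq_ordered hF]
    congr 1
    refine setLIntegral_congr_fun measurableSet_Ioi fun v hv => ?_
    rw [Measure.restrict_restrict measurableSet_Ioi, Set.Ioi_inter_Ioi,
      max_eq_left (Set.mem_Ioi.1 hv).le]
  rw [pow_succ', lintegral_sq_eq_ordered hF, mul_left_comm,
    lintegral_mul_lintegral_eq_ordered hF hG]
  have h2 : ∫⁻ u, F u * (∫⁻ v in Set.Ioi u, F v ∂μ) * ∫⁻ v in Set.Ioi u, F v ∂μ ∂μ =
      2 * ∫⁻ u, F u * ∫⁻ v in Set.Ioi u, F v * ∫⁻ w in Set.Ioi v, F w ∂μ ∂μ ∂μ := by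
    rw [← lintegral_const_mul _ (measurable_mul_setLIntegral_Ioi hF hG)]
    congr 1; ext u
    rw [mul_assoc, ← sq, h1, mul_left_comm]
  rw [h2]
  ring

end OrderedIntegrals

/-! ### Integrals of powers -/

lemma lintegral_rpow_neg_Ioc {a S : ℝ} (ha : a < 1) (hS : 0 ≤ S) :
    ∫⁻ r in Set.Ioc 0 S, ENNReal.ofReal (r ^ (-a)) = ENNReal.ofReal (S ^ (1 - a) / (1 - a)) := by
  rw [← ofReal_integral_eq_lintegral_ofReal (integrableOn_rpow_neg_Ioc ha S),
    ← intervalIntegral.integral_of_le hS, integral_rpow (Or.inl (by linarith))]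
  · rw [Real.zero_rpow (by linarith)]
    congr 1
    rw [sub_zero]
    congr 1 <;> ring_nf
  · filter_upwards [ae_restrict_mem measurableSet_Ioc] with r hr
    exact Real.rpow_nonneg hr.1.le _

lemma lintegral_rpow_neg_sub {a S v : ℝ} (ha : a < 1) (hvS : v ≤ S) :
    ∫⁻ w in Set.Ioc v S, ENNReal.ofReal ((w - v) ^ (-a)) =
      ENNReal.ofReal ((S - v) ^ (1 - a) / (1 - a)) := by
  rw [← lintegral_rpow_neg_Ioc ha (sub_nonneg.2 hvS), ← lintegral_indicator measurableSet_Ioc,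
    ← lintegral_indicator measurableSet_Ioc,
    ← lintegral_sub_right_eq_self ((Set.Ioc 0 (S - v)).indicator _) v]
  congr 1; ext w
  simp only [Set.indicator, Set.mem_Ioc, sub_pos, sub_le_sub_iff_right]

lemma lintegral_rpow_neg_sub_le {a S v : ℝ} (ha : a < 1) (hv : 0 ≤ v) :
    ∫⁻ w in Set.Ioc v S, ENNReal.ofReal ((w - v) ^ (-a)) ≤
      ENNReal.ofReal (S ^ (1 - a) / (1 - a)) := by
  rcases le_or_gt v S with h | h
  · rw [lintegral_rpow_neg_sub ha h]
    refine ENNReal.ofReal_le_ofReal ?_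
    have : 0 < 1 - a := by linarith
    gcongr
    linarith
  · rw [Set.Ioc_eq_empty (by linarith)]
    simp

/-! ### First and third moments of time integrals -/

/-- The position at time `u` of the particle started at `p.1` with displacements `p.2`. -/
noncomputable def particlePos (p : ℝ × (ℝ≥0 → ℝ)) (u : ℝ) : ℝ := p.1 + cadlagEval p.2 u.toNNReal

lemma measurable_particlePos :
    Measurable fun z : (ℝ × (ℝ≥0 → ℝ)) × ℝ => particlePos z.1 z.2 :=
  (measurable_fst.comp measurable_fst).add (measurable_cadlagEval.comp
    ((measurable_snd.comp measurable_fst).prodMk (measurable_real_toNNReal.comp measurable_snd)))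

@[fun_prop]
lemma Measurable.particlePos {X : Type*} [MeasurableSpace X] {p : X → ℝ × (ℝ≥0 → ℝ)} {u : X → ℝ}
    (hp : Measurable p) (hu : Measurable u) : Measurable fun z => particlePos (p z) (u z) :=
  measurable_particlePos.comp (hp.prodMk hu)

section Moments

variable {α γ : ℝ} {κ : Measure (ℝ≥0 → ℝ)}

lemma IsStablePathLaw.lintegral_time_le (h : IsStablePathLaw α κ) (hα : 1 < α) (hγ' : γ < 1)
    {C : ℝ≥0} (hC : ∀ z, stablePotential α γ 1 z ≤ C) {f : ℝ → ℝ≥0∞} (hf : Measurable f) {S : ℝ}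
    (hS : 0 ≤ S) :
    ∫⁻ p, (∫⁻ u in Set.Ioc 0 S, f (particlePos p u)) ∂((powerIntensity γ).prod κ) ≤
      C * (∫⁻ x, f x) * ENNReal.ofReal (S ^ (1 - γ / α) / (1 - γ / α)) := by
  have := h.isProbabilityMeasure
  have hα0 : 0 < α := by linarith
  have hγα : γ / α < 1 := by rw [div_lt_one hα0]; linarith
  rw [lintegral_lintegral_swap (by fun_prop), ← lintegral_rpow_neg_Ioc hγα hS,
    ← lintegral_const_mul _ (by fun_prop)]
  refine setLIntegral_mono (by fun_prop) fun u hu => ?_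
  have hu' : 0 < u.toNNReal := Real.toNNReal_pos.2 hu.1
  have h1 := h.lintegral_single_le hα0 hC hf hu'
  rw [Real.coe_toNNReal u hu.1.le] at h1
  refine h1.trans (le_of_eq ?_)
  rw [neg_div]
  ring

/-- Order the times as u < v < w, apply the three-point bound, and integrate out w, v, u in this
order. Each inner gap is enlarged to length S, which makes the three time integrals independent of
one another. -/
lemma IsStablePathLaw.lintegral_time_cube_le (h : IsStablePathLaw α κ) (hα : 1 < α) (hγ' : γ < 1)
    {C : ℝ≥0} (hC : ∀ z, stablePotential α γ 1 z ≤ C) {f : ℝ → ℝ≥0∞} (hf : Measurable f) {S : ℝ}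
    (hS : 0 ≤ S) :
    ∫⁻ p, (∫⁻ u in Set.Ioc 0 S, f (particlePos p u)) ^ 3 ∂((powerIntensity γ).prod κ) ≤
      6 * (C * ENNReal.ofReal (stableDensity α 1 0) ^ 2 * (∫⁻ x, f x) ^ 3 *
        (ENNReal.ofReal (S ^ (1 - γ / α) / (1 - γ / α)) *
          ENNReal.ofReal (S ^ (1 - 1 / α) / (1 - 1 / α)) ^ 2)) := by
  have := h.isProbabilityMeasure
  have hα0 : 0 < α := by linarith
  have hγα : γ / α < 1 := by rw [div_lt_one hα0]; linarith
  have h1α : 1 / α < 1 := by rw [div_lt_one hα0]; linarith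
  set μS : Measure ℝ := volume.restrict (Set.Ioc 0 S) with hμS
  set D := ENNReal.ofReal (stableDensity α 1 0) with hD
  set J := ENNReal.ofReal (S ^ (1 - 1 / α) / (1 - 1 / α)) with hJ
  have hm3 : Measurable fun z : ((ℝ × (ℝ≥0 → ℝ)) × ℝ) × ℝ =>
      f (particlePos z.1.1 z.2) * ∫⁻ w in Set.Ioi z.2, f (particlePos z.1.1 w) ∂μS :=
    (by fun_prop : Measurable fun z : ((ℝ × (ℝ≥0 → ℝ)) × ℝ) × ℝ => f (particlePos z.1.1 z.2)).mul
      (measurable_setLIntegral_Ioi (X := ((ℝ × (ℝ≥0 → ℝ)) × ℝ) × ℝ) (t := fun z => z.2)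
        (H := fun y => f (particlePos y.1.1.1 y.2)) (by fun_prop) measurable_snd)
  have hm2 : Measurable fun z : (ℝ × (ℝ≥0 → ℝ)) × ℝ => f (particlePos z.1 z.2) *
      ∫⁻ v in Set.Ioi z.2, f (particlePos z.1 v) *
        ∫⁻ w in Set.Ioi v, f (particlePos z.1 w) ∂μS ∂μS :=
    (by fun_prop : Measurable fun z : (ℝ × (ℝ≥0 → ℝ)) × ℝ => f (particlePos z.1 z.2)).mul
      (measurable_setLIntegral_Ioi (X := (ℝ × (ℝ≥0 → ℝ)) × ℝ) (t := fun z => z.2)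
        (H := fun y => f (particlePos y.1.1 y.2) *
          ∫⁻ w in Set.Ioi y.2, f (particlePos y.1.1 w) ∂μS) hm3 measurable_snd)
  have hcube : ∀ p, (∫⁻ u, f (particlePos p u) ∂μS) ^ 3 =
      6 * ∫⁻ u, f (particlePos p u) * ∫⁻ v in Set.Ioi u, f (particlePos p v) *
        ∫⁻ w in Set.Ioi v, f (particlePos p w) ∂μS ∂μS ∂μS := fun p =>
    lintegral_cube_eq_ordered (by fun_prop)
  simp_rw [hcube]
  rw [lintegral_const_mul _ (Measurable.lintegral_prod_right' hm2)]
  gcongr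
  rw [lintegral_lintegral_swap hm2.aemeasurable]
  have hrestr : ∀ v, 0 < v → μS.restrict (Set.Ioi v) = volume.restrict (Set.Ioc v S) := by
    intro v hv
    rw [hμS, Measure.restrict_restrict measurableSet_Ioi]
    congr 1; ext w
    simp only [Set.mem_inter_iff, Set.mem_Ioi, Set.mem_Ioc]
    constructor
    · rintro ⟨h1, _, h3⟩; exact ⟨h1, h3⟩
    · rintro ⟨h1, h3⟩; exact ⟨h1, hv.trans h1, h3⟩
  have hKm : Measurable fun u : ℝ => C * D ^ 2 * (∫⁻ x, f x) ^ 3 * J ^ 2 *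
      ENNReal.ofReal (u ^ (-(γ / α))) := by fun_prop
  calc _ ≤ ∫⁻ u, C * D ^ 2 * (∫⁻ x, f x) ^ 3 * J ^ 2 * ENNReal.ofReal (u ^ (-(γ / α))) ∂μS := by
        refine setLIntegral_mono hKm fun u hu => ?_
        have hu0 : 0 < u.toNNReal := Real.toNNReal_pos.2 hu.1
        have e1 : ∀ p, f (particlePos p u) * ∫⁻ v in Set.Ioi u, f (particlePos p v) *
            ∫⁻ w in Set.Ioi v, f (particlePos p w) ∂μS ∂μS =
            ∫⁻ v in Set.Ioi u, ∫⁻ w in Set.Ioi v, f (particlePos p u) *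
              (f (particlePos p v) * f (particlePos p w)) ∂μS ∂μS := fun p => by
          rw [← lintegral_const_mul _ (measurable_mul_setLIntegral_Ioi (by fun_prop) (by fun_prop))]
          congr 1; ext v
          rw [← mul_assoc, ← lintegral_const_mul _ (by fun_prop)]
          simp_rw [mul_assoc]
        simp_rw [e1]
        have hm4 : Measurable fun z : (ℝ × (ℝ≥0 → ℝ)) × ℝ => ∫⁻ w in Set.Ioi z.2,
            f (particlePos z.1 u) * (f (particlePos z.1 z.2) * f (particlePos z.1 w)) ∂μS :=
          measurable_setLIntegral_Ioi (X := (ℝ × (ℝ≥0 → ℝ)) × ℝ) (t := fun z => z.2)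
            (H := fun y => f (particlePos y.1.1 u) * (f (particlePos y.1.1 y.1.2) *
              f (particlePos y.1.1 y.2))) (by fun_prop) measurable_snd
        rw [lintegral_lintegral_swap hm4.aemeasurable, hrestr u hu.1]
        calc _ ≤ ∫⁻ v in Set.Ioc u S, C * D ^ 2 * (∫⁻ x, f x) ^ 3 * J *
                ENNReal.ofReal (u ^ (-(γ / α))) * ENNReal.ofReal ((v - u) ^ (-(1 / α))) := by
              refine setLIntegral_mono (by fun_prop) fun v hv => ?_
              have hv0 : 0 < v := hu.1.trans hv.1
              have huv : u.toNNReal < v.toNNReal := (Real.toNNReal_lt_toNNReal_iff hv0).2 hv.1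
              rw [lintegral_lintegral_swap (by fun_prop), hrestr v hv0]
              calc _ ≤ ∫⁻ w in Set.Ioc v S, C * D ^ 2 * (∫⁻ x, f x) ^ 3 *
                      ENNReal.ofReal (u ^ (-(γ / α))) * ENNReal.ofReal ((v - u) ^ (-(1 / α))) *
                      ENNReal.ofReal ((w - v) ^ (-(1 / α))) := by
                    refine setLIntegral_mono (by fun_prop) fun w hw => ?_
                    have hw0 : 0 < w := hv0.trans hw.1
                    have hvw : v.toNNReal < w.toNNReal :=
                      (Real.toNNReal_lt_toNNReal_iff hw0).2 hw.1
                    have h1 := h.lintegral_triple_le hα0 hC hf hu0 huv hvw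
                    rw [Real.coe_toNNReal u hu.1.le, Real.coe_toNNReal v hv0.le,
                      Real.coe_toNNReal w hw0.le] at h1
                    refine h1.trans (le_of_eq ?_)
                    rw [neg_div, neg_div,
                      ENNReal.ofReal_mul (Real.rpow_nonneg (sub_nonneg.2 hv.1.le) _),
                      ENNReal.ofReal_mul (Real.rpow_nonneg (sub_nonneg.2 hw.1.le) _)]
                    ring
                _ ≤ _ := by
                    rw [lintegral_const_mul _ (by fun_prop)]
                    refine (mul_le_mul_right (lintegral_rpow_neg_sub_le h1α hv0.le) _).trans
                      (le_of_eq ?_)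
                    rw [hJ]; ring
          _ ≤ _ := by
              rw [lintegral_const_mul _ (by fun_prop)]
              refine (mul_le_mul_right (lintegral_rpow_neg_sub_le h1α hu.1.le) _).trans
                (le_of_eq ?_)
              rw [hJ]; ring
    _ = _ := by
        rw [lintegral_const_mul _ (by fun_prop), hμS, lintegral_rpow_neg_Ioc hγα hS]
        ring

end Moments

/-! ### The limiting covariance kernel -/

lemma setLIntegral_rect_eq_ordered {s s' : ℝ} {g : ℝ × ℝ → ℝ≥0∞} (hg : Measurable g) :
    ∫⁻ z in Set.Ioc 0 s ×ˢ Set.Ioc 0 s', g z =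
      (∫⁻ r in Set.Ioc 0 s, ∫⁻ r' in Set.Ioc r s', g (r, r')) +
        ∫⁻ r' in Set.Ioc 0 s', ∫⁻ r in Set.Ioc r' s, g (r, r') := by
  have hsplit : ∀ z : ℝ × ℝ, z.1 ≠ z.2 →
      (Set.Ioc 0 s ×ˢ Set.Ioc 0 s').indicator g z =
        {z : ℝ × ℝ | z.1 ∈ Set.Ioc 0 s ∧ z.2 ∈ Set.Ioc z.1 s'}.indicator g z +
        {z : ℝ × ℝ | z.2 ∈ Set.Ioc 0 s' ∧ z.1 ∈ Set.Ioc z.2 s}.indicator g z := by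
    rintro ⟨r, r'⟩ hne
    dsimp only at hne
    simp only [Set.indicator, Set.mem_prod, Set.mem_Ioc, Set.mem_ofPred_eq]
    rcases lt_or_gt_of_ne hne with h | h
    · by_cases h1 : (0 < r ∧ r ≤ s) ∧ (0 < r' ∧ r' ≤ s')
      · rw [if_pos h1, if_pos ⟨h1.1, h, h1.2.2⟩, if_neg (by intro hc; linarith [hc.2.1]), add_zero]
      · rw [if_neg h1, if_neg (fun hc => h1 ⟨hc.1, hc.1.1.trans h, hc.2.2⟩),
          if_neg (by intro hc; linarith [hc.2.1]), add_zero]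
    · by_cases h1 : (0 < r ∧ r ≤ s) ∧ (0 < r' ∧ r' ≤ s')
      · rw [if_pos h1, if_pos (c := (0 < r' ∧ r' ≤ s') ∧ _) ⟨h1.2, h, h1.1.2⟩,
          if_neg (by intro hc; linarith [hc.2.1]), zero_add]
      · rw [if_neg h1, if_neg (c := (0 < r' ∧ r' ≤ s') ∧ _)
          (fun hc => h1 ⟨⟨hc.1.1.trans h, hc.2.2⟩, hc.1⟩),
          if_neg (by intro hc; linarith [hc.2.1]), zero_add]
  have hdiag : ∀ᵐ z : ℝ × ℝ, z.1 ≠ z.2 := by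
    rw [Measure.volume_eq_prod, Measure.ae_prod_iff_ae_ae]
    · refine ae_of_all _ fun r => ?_
      filter_upwards [Measure.ae_ne volume r] with r' h using h.symm
    · exact (measurableSet_eq_fun measurable_fst measurable_snd).compl
  have hm1 : MeasurableSet {z : ℝ × ℝ | z.1 ∈ Set.Ioc 0 s ∧ z.2 ∈ Set.Ioc z.1 s'} := by
    simp only [Set.mem_Ioc]
    measurability
  have hm2 : MeasurableSet {z : ℝ × ℝ | z.2 ∈ Set.Ioc 0 s' ∧ z.1 ∈ Set.Ioc z.2 s} := by
    simp only [Set.mem_Ioc]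
    measurability
  rw [← lintegral_indicator (measurableSet_Ioc.prod measurableSet_Ioc),
    lintegral_congr_ae (hdiag.mono hsplit), lintegral_add_left (hg.indicator hm1),
    Measure.volume_eq_prod]
  congr 1
  · rw [lintegral_prod _ (hg.indicator hm1).aemeasurable, ← lintegral_indicator measurableSet_Ioc]
    congr 1; ext r
    by_cases hr : r ∈ Set.Ioc 0 s
    · rw [Set.indicator_of_mem hr, ← lintegral_indicator measurableSet_Ioc]
      congr 1; ext r'
      simp only [Set.indicator, Set.mem_ofPred_eq, hr, true_and]
    · rw [Set.indicator_of_notMem hr]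
      simp only [Set.indicator, Set.mem_ofPred_eq, hr, false_and, if_false, lintegral_zero]
  · rw [lintegral_prod_symm _ (hg.indicator hm2).aemeasurable,
      ← lintegral_indicator measurableSet_Ioc]
    congr 1; ext r'
    by_cases hr : r' ∈ Set.Ioc 0 s'
    · rw [Set.indicator_of_mem hr, ← lintegral_indicator measurableSet_Ioc]
      congr 1; ext r
      simp only [Set.indicator, Set.mem_ofPred_eq, hr, true_and]
    · rw [Set.indicator_of_notMem hr]
      simp only [Set.indicator, Set.mem_ofPred_eq, hr, false_and, if_false, lintegral_zero]

/-- The limiting covariance density `min(r, r') ^ (-a) |r - r'| ^ (-c)`. -/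
noncomputable def covKernel (a c : ℝ) (z : ℝ × ℝ) : ℝ := (min z.1 z.2) ^ (-a) * |z.1 - z.2| ^ (-c)

lemma measurable_covKernel (a c : ℝ) : Measurable (covKernel a c) := by
  unfold covKernel; fun_prop

lemma integrableOn_rpow_neg_mul_sub_rpow {a b m s : ℝ} (ha : a < 1) (hb : 0 ≤ b) (hm : m ≤ s) :
    IntegrableOn (fun r : ℝ => r ^ (-a) * (s - r) ^ b) (Set.Ioc 0 m) := by
  have h1 := integrableOn_rpow_neg_Ioc ha m
  refine Integrable.mul_bdd (c := s ^ b) h1 (by fun_prop) ?_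
  filter_upwards [ae_restrict_mem measurableSet_Ioc] with r hr
  rw [Real.norm_of_nonneg (Real.rpow_nonneg (by linarith [hr.2]) _)]
  exact Real.rpow_le_rpow (by linarith [hr.2]) (by linarith [hr.1]) hb

/-- Integrating the later time over (r, s'] gives (s' - r)^{1-c}/(1 - c), and nothing when r exceeds
s'. This triangle produces one of the two terms of the weighted covariance. -/
lemma lintegral_covKernel_upper {a c s s' : ℝ} (ha : a < 1) (hc : c < 1) :
    ∫⁻ r in Set.Ioc 0 s, ∫⁻ r' in Set.Ioc r s', ENNReal.ofReal (covKernel a c (r, r')) =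
      ENNReal.ofReal (1 / (1 - c) *
        ∫ r in Set.Ioc 0 (min s s'), r ^ (-a) * (s' - r) ^ (1 - c)) := by
  have hc' : 0 < 1 - c := by linarith
  have hinner : ∀ r ∈ Set.Ioc 0 s, ∫⁻ r' in Set.Ioc r s', ENNReal.ofReal (covKernel a c (r, r')) =
      (Set.Iic s').indicator
        (fun r => ENNReal.ofReal (1 / (1 - c) * (r ^ (-a) * (s' - r) ^ (1 - c)))) r := by
    intro r hr
    by_cases hrs : r ≤ s'
    · rw [Set.indicator_of_mem (show r ∈ Set.Iic s' from hrs)]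
      have : ∀ r' ∈ Set.Ioc r s', ENNReal.ofReal (covKernel a c (r, r')) =
          ENNReal.ofReal (r ^ (-a)) * ENNReal.ofReal ((r' - r) ^ (-c)) := fun r' hr' => by
        rw [← ENNReal.ofReal_mul (Real.rpow_nonneg hr.1.le _), covKernel]
        dsimp only
        rw [min_eq_left hr'.1.le, abs_sub_comm, abs_of_pos (sub_pos.2 hr'.1)]
      rw [setLIntegral_congr_fun measurableSet_Ioc this, lintegral_const_mul _ (by fun_prop),
        lintegral_rpow_neg_sub hc hrs, ← ENNReal.ofReal_mul (Real.rpow_nonneg hr.1.le _)]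
      congr 1
      ring
    · rw [Set.indicator_of_notMem (show r ∉ Set.Iic s' from hrs),
        Set.Ioc_eq_empty (fun h => hrs h.le)]
      simp
  rw [setLIntegral_congr_fun measurableSet_Ioc hinner, setLIntegral_indicator measurableSet_Iic,
    Set.inter_comm, Set.Ioc_inter_Iic]
  rw [← integral_const_mul, ofReal_integral_eq_lintegral_ofReal]
  · exact (integrableOn_rpow_neg_mul_sub_rpow ha hc'.le (min_le_right _ _)).const_mul _
  · filter_upwards [ae_restrict_mem measurableSet_Ioc] with r hr
    have h1 : 0 ≤ r ^ (-a) := Real.rpow_nonneg hr.1.le _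
    have h2 : 0 ≤ (s' - r) ^ (1 - c) :=
      Real.rpow_nonneg (by linarith [hr.2.trans (min_le_right s s')]) _
    positivity

lemma covKernel_swap (a c : ℝ) (r r' : ℝ) : covKernel a c (r, r') = covKernel a c (r', r) := by
  simp only [covKernel, min_comm r r', abs_sub_comm r r']

/-- The triangles above and below the diagonal yield the terms with s' - r and s - r. With c = 1/α
the prefactor is the 1/(1 - 1/α) in `limitFactor`. -/
lemma lintegral_covKernel {a c : ℝ} (ha : a < 1) (hc : c < 1) (s s' : ℝ≥0) :
    ∫⁻ z in Set.Ioc 0 (s : ℝ) ×ˢ Set.Ioc 0 (s' : ℝ), ENNReal.ofReal (covKernel a c z) =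
      ENNReal.ofReal (1 / (1 - c) * weightedFBMCov (-a) (1 - c) s s') := by
  have hc' : 0 < 1 - c := by linarith
  rw [setLIntegral_rect_eq_ordered (measurable_covKernel a c).ennreal_ofReal,
    lintegral_covKernel_upper ha hc]
  simp_rw [fun r r' => covKernel_swap a c r r']
  rw [lintegral_covKernel_upper ha hc, min_comm (s' : ℝ) s, ← ENNReal.ofReal_add]
  · congr 1
    rw [← mul_add, weightedFBMCov, intervalIntegral.integral_of_le (by positivity), NNReal.coe_min,
      ← integral_add]
    · congr 2; ext r; ring
    · exact integrableOn_rpow_neg_mul_sub_rpow ha hc'.le (min_le_right _ _)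
    · exact integrableOn_rpow_neg_mul_sub_rpow ha hc'.le (min_le_left _ _)
  all_goals
    refine mul_nonneg (by positivity) (setIntegral_nonneg measurableSet_Ioc fun r hr => ?_)
    refine mul_nonneg (Real.rpow_nonneg hr.1.le _) (Real.rpow_nonneg ?_ _)
  · linarith [hr.2.trans (min_le_right (s : ℝ) s')]
  · linarith [hr.2.trans (min_le_left (s : ℝ) s')]

lemma covKernel_nonneg {a c : ℝ} {z : ℝ × ℝ} (h1 : 0 ≤ z.1) (h2 : 0 ≤ z.2) :
    0 ≤ covKernel a c z :=
  mul_nonneg (Real.rpow_nonneg (le_min h1 h2) _) (Real.rpow_nonneg (abs_nonneg _) _)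

lemma ae_rect_nonneg_covKernel (a c : ℝ) (s s' : ℝ) :
    ∀ᵐ z ∂((volume : Measure (ℝ × ℝ)).restrict (Set.Ioc 0 s ×ˢ Set.Ioc 0 s')),
      0 ≤ covKernel a c z := by
  filter_upwards [ae_restrict_mem (measurableSet_Ioc.prod measurableSet_Ioc)] with z hz
  exact covKernel_nonneg hz.1.1.le hz.2.1.le

lemma weightedFBMCov_nonneg (a b : ℝ) (s s' : ℝ≥0) : 0 ≤ weightedFBMCov a b s s' := by
  unfold weightedFBMCov
  refine intervalIntegral.integral_nonneg (by positivity) fun r hr => ?_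
  have h1 : r ≤ s := hr.2.trans (by exact_mod_cast min_le_left s s')
  have h2 : r ≤ s' := hr.2.trans (by exact_mod_cast min_le_right s s')
  exact mul_nonneg (Real.rpow_nonneg hr.1 _)
    (add_nonneg (Real.rpow_nonneg (by linarith) _) (Real.rpow_nonneg (by linarith) _))

lemma integrableOn_covKernel {a c : ℝ} (ha : a < 1) (hc : c < 1) (s s' : ℝ≥0) :
    IntegrableOn (covKernel a c) (Set.Ioc 0 (s : ℝ) ×ˢ Set.Ioc 0 (s' : ℝ)) := by
  refine ⟨(measurable_covKernel a c).aestronglyMeasurable, ?_⟩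
  rw [hasFiniteIntegral_iff_ofReal (ae_rect_nonneg_covKernel a c _ _), lintegral_covKernel ha hc]
  exact ENNReal.ofReal_lt_top

lemma integral_covKernel {a c : ℝ} (ha : a < 1) (hc : c < 1) (s s' : ℝ≥0) :
    ∫ z in Set.Ioc 0 (s : ℝ) ×ˢ Set.Ioc 0 (s' : ℝ), covKernel a c z =
      1 / (1 - c) * weightedFBMCov (-a) (1 - c) s s' := by
  have hc' : 0 < 1 - c := by linarith
  rw [integral_eq_lintegral_of_nonneg_ae (ae_rect_nonneg_covKernel a c _ _)
    (measurable_covKernel a c).aestronglyMeasurable, lintegral_covKernel ha hc,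
    ENNReal.toReal_ofReal (mul_nonneg (by positivity) (weightedFBMCov_nonneg _ _ _ _))]

/-! ### Mixed moments at two times -/

section PairMoment

variable {α γ : ℝ} {κ : Measure (ℝ≥0 → ℝ)} {φ : ℝ → ℝ}

/-- The mixed moment at times `u`, `v` of `φ` along a particle, under its intensity measure. -/
noncomputable def pairMoment (γ : ℝ) (κ : Measure (ℝ≥0 → ℝ)) (φ : ℝ → ℝ) (u v : ℝ) : ℝ :=
  ∫ p, φ (particlePos p u) * φ (particlePos p v) ∂((powerIntensity γ).prod κ)

lemma pairMoment_comm (u v : ℝ) : pairMoment γ κ φ u v = pairMoment γ κ φ v u := by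
  unfold pairMoment
  simp_rw [mul_comm]

/-- The normalized mixed moment, as a function of the spatial scales of the two time steps. -/
noncomputable def pairKernel (α γ : ℝ) (φ : ℝ → ℝ) (a b : ℝ) : ℝ :=
  ∫ z : ℝ × ℝ, φ z.1 * φ z.2 *
    ((stablePotential α γ 1 (a * z.1)).toReal * stableDensity α 1 (b * (z.2 - z.1)))

/-- The joint law of position and increment has an explicit product density; scaling both factors to
time 1 isolates all dependence on the time scale in two powers and two spatial dilations. -/
lemma IsStablePathLaw.pairMoment_eq (h : IsStablePathLaw α κ) (hα : 0 < α) {C : ℝ≥0}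
    (hC : ∀ z, stablePotential α γ 1 z ≤ C) (hφ : Measurable φ) {u v : ℝ} (hu : 0 < u)
    (huv : u < v) :
    pairMoment γ κ φ u v = u ^ (-γ / α) * (v - u) ^ (-1 / α) *
      pairKernel α γ φ (u ^ (-1 / α)) ((v - u) ^ (-1 / α)) := by
  have hm := measurable_cadlagEval_time
  have hV := measurable_stablePotential α γ u
  have hvu : 0 < v - u := sub_pos.2 huv
  have hp := measurable_stableDensity hα hvu
  have e : ∀ p : ℝ × (ℝ≥0 → ℝ), φ (particlePos p u) * φ (particlePos p v) =
    (fun q : ℝ × ℝ => φ q.1 * φ (q.1 + q.2))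
      (p.1 + cadlagEval p.2 u.toNNReal,
        cadlagEval p.2 v.toNNReal - cadlagEval p.2 u.toNNReal) := fun p => by
    dsimp only
    rw [add_add_sub_cancel]
    rfl
  have h1 := h.map_double (γ := γ) (Real.toNNReal_pos.2 hu)
    ((Real.toNNReal_lt_toNNReal_iff (hu.trans huv)).2 huv)
  rw [Real.coe_toNNReal _ hu.le, Real.coe_toNNReal _ (hu.trans huv).le] at h1
  rw [pairMoment]
  simp_rw [e]
  rw [← integral_map (φ := fun p : ℝ × (ℝ≥0 → ℝ) => (p.1 + cadlagEval p.2 u.toNNReal,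
      cadlagEval p.2 v.toNNReal - cadlagEval p.2 u.toNNReal))
      (f := fun q : ℝ × ℝ => φ q.1 * φ (q.1 + q.2)) (by fun_prop)
      (Measurable.aestronglyMeasurable (by fun_prop)),
    h1, particleIntensity, stableLaw, prod_withDensity hV hp.ennreal_ofReal,
    integral_withDensity_eq_integral_toReal_smul (by fun_prop)]
  -- The shear (y, b) ↦ (y, y + b) passes from position and increment to the two positions.
  · have hs := (measurePreserving_prod_add (volume : Measure ℝ) (volume : Measure ℝ)).integral_comp
      (MeasurableEquiv.shearAddRight ℝ).measurableEmbedding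
      (fun z : ℝ × ℝ => φ z.1 * φ z.2 * ((stablePotential α γ u z.1).toReal *
        stableDensity α (v - u) (z.2 - z.1)))
    rw [pairKernel, ← integral_const_mul]
    calc _ = ∫ z : ℝ × ℝ, φ z.1 * φ (z.1 + z.2) * ((stablePotential α γ u z.1).toReal *
          stableDensity α (v - u) (z.1 + z.2 - z.1)) ∂(volume.prod volume) := by
          congr 1; ext z
          rw [ENNReal.toReal_mul, ENNReal.toReal_ofReal (h.stableDensity_nonneg _ hvu _),
            add_sub_cancel_left, smul_eq_mul, mul_comm]
      _ = _ := by
          rw [hs, ← Measure.volume_eq_prod]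
          congr 1; ext z
          rw [stablePotential_scale hα hu, stableDensity_scale hα hvu, ENNReal.toReal_mul,
            ENNReal.toReal_ofReal (by positivity)]
          ring
  · refine ae_of_all _ fun z => ENNReal.mul_lt_top ?_ ENNReal.ofReal_lt_top
    rw [stablePotential_scale hα hu]
    exact ENNReal.mul_lt_top ENNReal.ofReal_lt_top ((hC _).trans_lt ENNReal.coe_lt_top)

/-- As the dilations vanish, potential and density are evaluated ever closer to 0, where both are
continuous; boundedness of both leaves |φ ⊗ φ| as an integrable majorant. -/
lemma tendsto_pairKernel (hα : 0 < α) (hγ : 0 ≤ γ) (hγ' : γ < 1)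
    [IsProbabilityMeasure (stableLaw α 1)] (hφ : Measurable φ) (hφi : Integrable φ)
    {ι : Type*} {l : Filter ι} [l.IsCountablyGenerated] {a b : ι → ℝ} (ha : Tendsto a l (𝓝 0))
    (hb : Tendsto b l (𝓝 0)) :
    Tendsto (fun i => pairKernel α γ φ (a i) (b i)) l
      (𝓝 ((∫ x, φ x) ^ 2 * ((stablePotential α γ 1 0).toReal * stableDensity α 1 0))) := by
  obtain ⟨C, hC⟩ := exists_stablePotential_bound hα hγ hγ'
  have hV := measurable_stablePotential α γ 1
  have hp := measurable_stableDensity hα one_pos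
  have hlim : (∫ x, φ x) ^ 2 * ((stablePotential α γ 1 0).toReal * stableDensity α 1 0) =
      ∫ z : ℝ × ℝ, φ z.1 * φ z.2 * ((stablePotential α γ 1 0).toReal * stableDensity α 1 0) := by
    rw [integral_mul_const, Measure.volume_eq_prod, integral_prod_mul, sq]
  have hφφ : Integrable (fun z : ℝ × ℝ => φ z.1 * φ z.2) := hφi.mul_prod hφi
  rw [hlim]
  refine tendsto_integral_filter_of_dominated_convergence
    (fun z => ‖φ z.1 * φ z.2‖ * (C * stableDensity α 1 0)) ?_ ?_ (hφφ.norm.mul_const _) ?_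
  · refine Eventually.of_forall fun i => Measurable.aestronglyMeasurable ?_
    fun_prop
  · refine Eventually.of_forall fun i => ae_of_all _ fun z => ?_
    rw [norm_mul, norm_mul (ENNReal.toReal _), Real.norm_of_nonneg ENNReal.toReal_nonneg]
    gcongr
    · exact ENNReal.toReal_mono ENNReal.coe_ne_top (hC _)
    · exact abs_stableDensity_le _
  · refine ae_of_all _ fun z => Tendsto.const_mul _ (Tendsto.mul ?_ ?_)
    · refine (ENNReal.tendsto_toReal ((hC 0).trans_lt ENNReal.coe_lt_top).ne).comp
        ((tendsto_stablePotential_zero hα hγ hγ').comp ?_)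
      simpa using ha.mul_const z.1
    · refine ((continuous_stableDensity hα one_pos).tendsto 0).comp ?_
      simpa using hb.mul_const (z.2 - z.1)

/-- The kernel that appears in the limit already dominates before it, with a constant independent of
time. -/
lemma IsStablePathLaw.lintegral_pair_le (h : IsStablePathLaw α κ) (hα : 0 < α) {C : ℝ≥0}
    (hC : ∀ z, stablePotential α γ 1 z ≤ C) (hφ : Measurable φ) {z : ℝ × ℝ} (h1 : 0 < z.1)
    (h2 : 0 < z.2) (hne : z.1 ≠ z.2) :
    ∫⁻ p, ‖φ (particlePos p z.1) * φ (particlePos p z.2)‖ₑ ∂((powerIntensity γ).prod κ) ≤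
      C * ENNReal.ofReal (stableDensity α 1 0) * (∫⁻ x, ‖φ x‖ₑ) ^ 2 *
        ENNReal.ofReal (covKernel (γ / α) (1 / α) z) := by
  obtain ⟨u, v⟩ := z
  dsimp only at h1 h2 hne
  wlog huv : u < v generalizing u v
  · rw [covKernel_swap]
    simp_rw [mul_comm (φ (particlePos _ u))]
    exact this v u h2 h1 hne.symm (lt_of_le_of_ne (not_lt.1 huv) hne.symm)
  have hle := h.lintegral_double_le hα hC hφ.enorm (Real.toNNReal_pos.2 h1)
    ((Real.toNNReal_lt_toNNReal_iff h2).2 huv)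
  rw [Real.coe_toNNReal _ h1.le, Real.coe_toNNReal _ h2.le] at hle
  simp_rw [enorm_mul]
  refine hle.trans (le_of_eq ?_)
  rw [covKernel]
  dsimp only
  rw [min_eq_left huv.le, abs_sub_comm, abs_of_pos (sub_pos.2 huv), neg_div, neg_div,
    ENNReal.ofReal_mul (Real.rpow_nonneg h1.le _),
    ENNReal.ofReal_mul (Real.rpow_nonneg (sub_pos.2 huv).le _)]
  ring

/-- The total time weight `∫₀ˢ φ(x + w_u) du` of a particle. -/
noncomputable def timeIntegral (φ : ℝ → ℝ) (S : ℝ) (p : ℝ × (ℝ≥0 → ℝ)) : ℝ :=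
  ∫ u in Set.Ioc 0 S, φ (particlePos p u)

lemma ae_rect_ne (s s' : ℝ) :
    ∀ᵐ z ∂((volume : Measure (ℝ × ℝ)).restrict (Set.Ioc 0 s ×ˢ Set.Ioc 0 s')),
      (0 < z.1 ∧ 0 < z.2) ∧ z.1 ≠ z.2 := by
  have hdiag : ∀ᵐ z : ℝ × ℝ, z.1 ≠ z.2 := by
    rw [Measure.volume_eq_prod, Measure.ae_prod_iff_ae_ae]
    · refine ae_of_all _ fun r => ?_
      filter_upwards [Measure.ae_ne volume r] with r' h using h.symm
    · exact (measurableSet_eq_fun measurable_fst measurable_snd).compl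
  filter_upwards [ae_restrict_of_ae hdiag,
    ae_restrict_mem (measurableSet_Ioc.prod measurableSet_Ioc)] with z h hz
  exact ⟨⟨hz.1.1, hz.2.1⟩, h⟩

/-- Fubini, justified by the integrability of the dominating kernel over the rectangle of times. -/
lemma IsStablePathLaw.integral_timeIntegral_mul (h : IsStablePathLaw α κ) (hα : 1 < α)
    (hγ' : γ < 1) {C : ℝ≥0} (hC : ∀ z, stablePotential α γ 1 z ≤ C) (hφ : Measurable φ)
    (hφi : Integrable φ) (s s' : ℝ≥0) :
    Integrable (fun p => timeIntegral φ s p * timeIntegral φ s' p) ((powerIntensity γ).prod κ) ∧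
    ∫ p, timeIntegral φ s p * timeIntegral φ s' p ∂((powerIntensity γ).prod κ) =
      ∫ z in Set.Ioc 0 (s : ℝ) ×ˢ Set.Ioc 0 (s' : ℝ), pairMoment γ κ φ z.1 z.2 := by
  have := h.isProbabilityMeasure
  have hα0 : 0 < α := by linarith
  have hγα : γ / α < 1 := by rw [div_lt_one hα0]; linarith
  have hα1 : 1 / α < 1 := by rw [div_lt_one hα0]; linarith
  have e : ∀ p, timeIntegral φ s p * timeIntegral φ s' p =
      ∫ z in Set.Ioc 0 (s : ℝ) ×ˢ Set.Ioc 0 (s' : ℝ),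
        φ (particlePos p z.1) * φ (particlePos p z.2) := fun p => by
    rw [Measure.volume_eq_prod, setIntegral_prod_mul (fun u => φ (particlePos p u))
      (fun u => φ (particlePos p u))]
    rfl
  have hint : Integrable (Function.uncurry fun (p : ℝ × (ℝ≥0 → ℝ)) (z : ℝ × ℝ) =>
      φ (particlePos p z.1) * φ (particlePos p z.2)) (((powerIntensity γ).prod κ).prod
        (volume.restrict (Set.Ioc 0 (s : ℝ) ×ˢ Set.Ioc 0 (s' : ℝ)))) := by
    refine ⟨Measurable.aestronglyMeasurable (by unfold Function.uncurry; fun_prop), ?_⟩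
    rw [hasFiniteIntegral_iff_enorm, lintegral_prod_symm' _ (by unfold Function.uncurry; fun_prop)]
    refine (lintegral_mono_ae (g := fun z => C * ENNReal.ofReal (stableDensity α 1 0) *
      (∫⁻ x, ‖φ x‖ₑ) ^ 2 * ENNReal.ofReal (covKernel (γ / α) (1 / α) z)) ?_).trans_lt ?_
    · filter_upwards [ae_rect_ne (s : ℝ) (s' : ℝ)] with z hz
      exact h.lintegral_pair_le hα0 hC hφ hz.1.1 hz.1.2 hz.2
    · rw [lintegral_const_mul _ (measurable_covKernel _ _).ennreal_ofReal,
        lintegral_covKernel hγα hα1]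
      exact ENNReal.mul_lt_top (ENNReal.mul_lt_top (ENNReal.mul_lt_top ENNReal.coe_lt_top
        ENNReal.ofReal_lt_top) (ENNReal.pow_lt_top hφi.2)) ENNReal.ofReal_lt_top
  simp_rw [e]
  exact ⟨hint.integral_prod_left, integral_integral_swap hint⟩

/-- The degree of homogeneity, -(1 + γ)/α in the application, exactly cancels the normalizing power
of T, so one majorant serves every T > 0. -/
lemma covKernel_smul {a c T : ℝ} (hT : 0 < T) {z : ℝ × ℝ} (h1 : 0 ≤ z.1) (h2 : 0 ≤ z.2) :
    covKernel a c (T • z) = T ^ (-(a + c)) * covKernel a c z := by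
  simp only [covKernel, Prod.smul_fst, Prod.smul_snd, smul_eq_mul]
  rw [← mul_min_of_nonneg _ _ hT.le, ← mul_sub, abs_mul, abs_of_pos hT,
    Real.mul_rpow hT.le (le_min h1 h2), Real.mul_rpow hT.le (abs_nonneg _), neg_add,
    Real.rpow_add hT]
  ring

lemma IsStablePathLaw.abs_pairMoment_le (h : IsStablePathLaw α κ) (hα : 0 < α) {C : ℝ≥0}
    (hC : ∀ z, stablePotential α γ 1 z ≤ C) (hφ : Measurable φ) (hφi : Integrable φ) {z : ℝ × ℝ}
    (h1 : 0 < z.1) (h2 : 0 < z.2) (hne : z.1 ≠ z.2) :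
    |pairMoment γ κ φ z.1 z.2| ≤ (C * ENNReal.ofReal (stableDensity α 1 0) *
      (∫⁻ x, ‖φ x‖ₑ) ^ 2).toReal * covKernel (γ / α) (1 / α) z := by
  have hk := covKernel_nonneg (a := γ / α) (c := 1 / α) h1.le h2.le
  have hfin : C * ENNReal.ofReal (stableDensity α 1 0) * (∫⁻ x, ‖φ x‖ₑ) ^ 2 ≠ ∞ :=
    (ENNReal.mul_lt_top (ENNReal.mul_lt_top ENNReal.coe_lt_top
      ENNReal.ofReal_lt_top) (ENNReal.pow_lt_top hφi.2)).ne
  rw [← Real.norm_eq_abs, ← toReal_enorm, ← ENNReal.toReal_ofReal hk, ← ENNReal.toReal_mul]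
  exact ENNReal.toReal_mono (ENNReal.mul_ne_top hfin ENNReal.ofReal_ne_top)
    ((enorm_integral_le_lintegral_enorm _).trans (h.lintegral_pair_le hα hC hφ h1 h2 hne))

/-- For u < v the dilations (Tu)^{-1/α} and (T(v - u))^{-1/α} tend to 0, while the explicit powers
of T cancel. -/
lemma IsStablePathLaw.tendsto_pairMoment (h : IsStablePathLaw α κ) (hα : 0 < α) (hγ : 0 ≤ γ)
    (hγ' : γ < 1) (hφ : Measurable φ) (hφi : Integrable φ) {z : ℝ × ℝ}
    (h1 : 0 < z.1) (h2 : 0 < z.2) (hne : z.1 ≠ z.2) :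
    Tendsto (fun T : ℝ => T ^ ((1 + γ) / α) * pairMoment γ κ φ (T * z.1) (T * z.2)) atTop
      (𝓝 ((∫ x, φ x) ^ 2 * ((stablePotential α γ 1 0).toReal * stableDensity α 1 0) *
        covKernel (γ / α) (1 / α) z)) := by
  have := h.isProbabilityMeasure_stableLaw 1 one_pos
  obtain ⟨C, hC⟩ := exists_stablePotential_bound hα hγ hγ'
  obtain ⟨u, v⟩ := z
  dsimp only at h1 h2 hne ⊢
  wlog huv : u < v generalizing u v
  · rw [covKernel_swap]
    simp_rw [pairMoment_comm (_ * u)]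
    exact this v u h2 h1 hne.symm (lt_of_le_of_ne (not_lt.1 huv) hne.symm)
  have hvu := sub_pos.2 huv
  have hscale : ∀ r : ℝ, 0 < r → Tendsto (fun T : ℝ => (T * r) ^ (-1 / α)) atTop (𝓝 0) := by
    intro r hr
    rw [neg_div]
    exact (tendsto_rpow_neg_atTop (one_div_pos.2 hα)).comp (tendsto_id.atTop_mul_const hr)
  refine ((tendsto_pairKernel hα hγ hγ' hφ hφi (hscale u h1)
    (hscale (v - u) hvu)).mul_const _).congr' ?_
  filter_upwards [eventually_gt_atTop 0] with T hT
  rw [h.pairMoment_eq hα hC hφ (mul_pos hT h1) (mul_lt_mul_of_pos_left huv hT), ← mul_sub,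
    covKernel]
  dsimp only
  rw [min_eq_left huv.le, abs_sub_comm, abs_of_pos hvu, Real.mul_rpow hT.le h1.le (z := -γ / α),
    Real.mul_rpow (x := T) (y := v - u) (z := -1 / α) hT.le hvu.le]
  have : T ^ ((1 + γ) / α) * (T ^ (-γ / α) * T ^ (-1 / α)) = 1 := by
    rw [← Real.rpow_add hT, ← Real.rpow_add hT, ← add_div, ← add_div]
    ring_nf
    exact Real.rpow_zero T
  rw [← neg_div, ← neg_div]
  linear_combination (-(u ^ (-γ / α) * (v - u) ^ (-1 / α) * pairKernel α γ φ ((T * u) ^ (-1 / α))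
    (T ^ (-1 / α) * (v - u) ^ (-1 / α)))) * this

end PairMoment

/-! ### Asymptotics of the second and third moments -/

section TimeMoments

variable {α γ : ℝ} {κ : Measure (ℝ≥0 → ℝ)} {φ : ℝ → ℝ}

open scoped Pointwise in
lemma setIntegral_rect_scale (g : ℝ × ℝ → ℝ) {T : ℝ} (hT : 0 < T) (s s' : ℝ) :
    ∫ z in Set.Ioc 0 (T * s) ×ˢ Set.Ioc 0 (T * s'), g z =
      T ^ (2 : ℝ) * ∫ z in Set.Ioc 0 s ×ˢ Set.Ioc 0 s', g (T • z) := by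
  have h := Measure.setIntegral_comp_smul_of_pos (volume : Measure (ℝ × ℝ)) g
    (Set.Ioc 0 s ×ˢ Set.Ioc 0 s') hT
  have hset : T • (Set.Ioc 0 s ×ˢ Set.Ioc 0 s') = Set.Ioc 0 (T * s) ×ˢ Set.Ioc 0 (T * s') := by
    ext ⟨a, b⟩
    rw [Set.mem_smul_set_iff_inv_smul_mem₀ hT.ne']
    simp only [Prod.smul_mk, smul_eq_mul, Set.mem_prod, Set.mem_Ioc, inv_mul_le_iff₀ hT,
      mul_pos_iff_of_pos_left (inv_pos.2 hT)]
  rw [hset, Module.finrank_prod, Module.finrank_self, smul_eq_mul] at h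
  rw [h, Real.rpow_ofNat]
  field_simp
  ring

/-- Rescaling the two times by T gives T², which together with the squared norming leaves
T^{(1+γ)/α} on the mixed moment. Its pointwise limit then passes through the time integral by
domination. -/
lemma IsStablePathLaw.tendsto_second_moment (h : IsStablePathLaw α κ) (hα : 1 < α) (hγ : 0 ≤ γ)
    (hγ' : γ < 1) (hφ : Measurable φ) (hφi : Integrable φ) (s s' : ℝ≥0) :
    Tendsto (fun T : ℝ≥0 => (T : ℝ) ^ (-(2 * (1 - (1 + γ) / (2 * α)))) *
      ∫ p, timeIntegral φ (T * s) p * timeIntegral φ (T * s') p ∂((powerIntensity γ).prod κ)) atTop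
      (𝓝 ((∫ x, φ x) ^ 2 * limitFactor α γ * weightedFBMCov (-γ / α) (1 - 1 / α) s s')) := by
  have := h.isProbabilityMeasure
  have := h.isProbabilityMeasure_stableLaw 1 one_pos
  have hα0 : 0 < α := by linarith
  have hγα : γ / α < 1 := by rw [div_lt_one hα0]; linarith
  have hα1 : 1 / α < 1 := by rw [div_lt_one hα0]; linarith
  obtain ⟨C, hC⟩ := exists_stablePotential_bound hα0 hγ hγ'
  have hmeas : Measurable fun z : ℝ × ℝ => pairMoment γ κ φ z.1 z.2 := by
    unfold pairMoment
    refine (StronglyMeasurable.integral_prod_right'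
      (f := fun q : (ℝ × ℝ) × (ℝ × (ℝ≥0 → ℝ)) =>
        φ (particlePos q.2 q.1.1) * φ (particlePos q.2 q.1.2)) ?_).measurable
    exact Measurable.stronglyMeasurable (by fun_prop)
  have hlim : (∫ x, φ x) ^ 2 * limitFactor α γ * weightedFBMCov (-γ / α) (1 - 1 / α) s s' =
      ∫ z in Set.Ioc 0 (s : ℝ) ×ˢ Set.Ioc 0 (s' : ℝ), (∫ x, φ x) ^ 2 *
        ((stablePotential α γ 1 0).toReal * stableDensity α 1 0) *
        covKernel (γ / α) (1 / α) z := by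
    rw [integral_const_mul, integral_covKernel hγα hα1, neg_div, limitFactor,
      toReal_stablePotential_zero hα0 (h.stableDensity_nonneg 1 one_pos)]
    ring
  have hmain : Tendsto (fun T : ℝ => ∫ z in Set.Ioc 0 (s : ℝ) ×ˢ Set.Ioc 0 (s' : ℝ),
      T ^ ((1 + γ) / α) * pairMoment γ κ φ (T * z.1) (T * z.2)) atTop
      (𝓝 ((∫ x, φ x) ^ 2 * limitFactor α γ * weightedFBMCov (-γ / α) (1 - 1 / α) s s')) := by
    rw [hlim]
    refine tendsto_integral_filter_of_dominated_convergence
      (fun z => (C * ENNReal.ofReal (stableDensity α 1 0) *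
      (∫⁻ x, ‖φ x‖ₑ) ^ 2).toReal * covKernel (γ / α) (1 / α) z) ?_ ?_
      ((integrableOn_covKernel hγα hα1 s s').const_mul _) ?_
    · refine Eventually.of_forall fun T => Measurable.aestronglyMeasurable ?_
      exact (hmeas.comp (measurable_id.const_smul T)).const_mul _
    · filter_upwards [eventually_gt_atTop 0] with T hT
      filter_upwards [ae_rect_ne (s : ℝ) (s' : ℝ)] with z hz
      have hb := h.abs_pairMoment_le hα0 hC hφ hφi (z := T • z) (mul_pos hT hz.1.1)
        (mul_pos hT hz.1.2) (fun hc => hz.2 (mul_left_cancel₀ hT.ne' hc))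
      rw [covKernel_smul hT hz.1.1.le hz.1.2.le] at hb
      rw [Real.norm_eq_abs, abs_mul, abs_of_pos (Real.rpow_pos_of_pos hT _)]
      refine (mul_le_mul_of_nonneg_left hb (by positivity)).trans (le_of_eq ?_)
      have : T ^ ((1 + γ) / α) * T ^ (-(γ / α + 1 / α)) = 1 := by
        rw [← Real.rpow_add hT, ← add_div, add_comm 1 γ, add_neg_cancel, Real.rpow_zero]
      linear_combination ((C * ENNReal.ofReal (stableDensity α 1 0) *
      (∫⁻ x, ‖φ x‖ₑ) ^ 2).toReal * covKernel (γ / α) (1 / α) z) * this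
    · filter_upwards [ae_rect_ne (s : ℝ) (s' : ℝ)] with z hz
      exact h.tendsto_pairMoment hα0 hγ hγ' hφ hφi hz.1.1 hz.1.2 hz.2
  refine (hmain.comp (NNReal.tendsto_coe_atTop.2 tendsto_id)).congr' ?_
  filter_upwards [eventually_gt_atTop 0] with T hT
  have hT' : (0 : ℝ) < T := by exact_mod_cast hT
  have h2 := (h.integral_timeIntegral_mul hα hγ' hC hφ hφi (T * s) (T * s')).2
  push_cast at h2
  rw [h2, setIntegral_rect_scale _ hT', ← mul_assoc, ← Real.rpow_add hT', Function.comp_apply,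
    integral_const_mul]
  congr 2
  field_simp
  ring

/-- In the bound on the cube, the powers of T add up to (1 - γ/α) + 2(1 - 1/α) - 3(1 - (1 + γ)/(2α))
= -(1 - γ)/(2α), which is negative since γ < 1. -/
lemma IsStablePathLaw.tendsto_third_moment (h : IsStablePathLaw α κ) (hα : 1 < α) (hγ : 0 ≤ γ)
    (hγ' : γ < 1) (hφ : Measurable φ) (hφi : Integrable φ) (S : ℝ≥0) :
    Tendsto (fun T : ℝ≥0 => ENNReal.ofReal ((T : ℝ) ^ (-(3 * (1 - (1 + γ) / (2 * α))))) *
      ∫⁻ p, (∫⁻ u in Set.Ioc 0 ((T : ℝ) * S), ‖φ (particlePos p u)‖ₑ) ^ 3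
        ∂((powerIntensity γ).prod κ)) atTop (𝓝 0) := by
  have := h.isProbabilityMeasure_stableLaw 1 one_pos
  have hα0 : 0 < α := by linarith
  obtain ⟨C, hC⟩ := exists_stablePotential_bound hα0 hγ hγ'
  have hγα : 0 < 1 - γ / α := by rw [sub_pos, div_lt_one hα0]; linarith
  have hα1 : 0 < 1 - 1 / α := by rw [sub_pos, div_lt_one hα0]; linarith
  set K : ℝ≥0∞ := 6 * (C * ENNReal.ofReal (stableDensity α 1 0) ^ 2 * (∫⁻ x, ‖φ x‖ₑ) ^ 3 *
        (ENNReal.ofReal ((S : ℝ) ^ (1 - γ / α) / (1 - γ / α)) *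
          ENNReal.ofReal ((S : ℝ) ^ (1 - 1 / α) / (1 - 1 / α)) ^ 2)) with hK
  have hKtop : K ≠ ∞ := ENNReal.mul_ne_top (by simp) (ENNReal.mul_ne_top (ENNReal.mul_ne_top
    (ENNReal.mul_ne_top ENNReal.coe_ne_top (ENNReal.pow_ne_top ENNReal.ofReal_ne_top))
    (ENNReal.pow_ne_top hφi.2.ne))
    (ENNReal.mul_ne_top ENNReal.ofReal_ne_top (ENNReal.pow_ne_top ENNReal.ofReal_ne_top)))
  have hlim : Tendsto (fun T : ℝ≥0 => ENNReal.ofReal ((T : ℝ) ^ (-((1 - γ) / (2 * α)))) * K)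
      atTop (𝓝 0) := by
    have h0 : Tendsto (fun T : ℝ≥0 => (T : ℝ) ^ (-((1 - γ) / (2 * α)))) atTop (𝓝 0) :=
      (tendsto_rpow_neg_atTop (div_pos (by linarith) (by linarith))).comp
        (NNReal.tendsto_coe_atTop.2 tendsto_id)
    have := ENNReal.Tendsto.mul_const (ENNReal.tendsto_ofReal h0) (Or.inr hKtop)
    simpa using this
  refine tendsto_of_tendsto_of_tendsto_of_le_of_le' tendsto_const_nhds hlim
    (Eventually.of_forall fun _ => zero_le) ?_
  filter_upwards [eventually_gt_atTop 0] with T hT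
  have hT' : (0 : ℝ) < T := by exact_mod_cast hT
  refine (mul_le_mul_right (h.lintegral_time_cube_le hα hγ' hC hφ.enorm
    (mul_nonneg hT'.le S.coe_nonneg)) _).trans (le_of_eq ?_)
  have e : ∀ b : ℝ, ENNReal.ofReal (((T : ℝ) * S) ^ b / b) =
      ENNReal.ofReal ((T : ℝ) ^ b) * ENNReal.ofReal ((S : ℝ) ^ b / b) := fun b => by
    rw [Real.mul_rpow hT'.le S.coe_nonneg, mul_div_assoc, ENNReal.ofReal_mul (by positivity)]
  have hexp : ENNReal.ofReal ((T : ℝ) ^ (-((1 - γ) / (2 * α)))) =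
      ENNReal.ofReal ((T : ℝ) ^ (-(3 * (1 - (1 + γ) / (2 * α))))) *
        (ENNReal.ofReal ((T : ℝ) ^ (1 - γ / α)) * ENNReal.ofReal ((T : ℝ) ^ (1 - 1 / α)) ^ 2) := by
    rw [← ENNReal.ofReal_pow (by positivity), ← ENNReal.ofReal_mul (by positivity),
      ← ENNReal.ofReal_mul (by positivity), ← Real.rpow_mul_natCast hT'.le, ← Real.rpow_add hT',
      ← Real.rpow_add hT']
    congr 2
    push_cast
    field_simp
    ring
  rw [e, e, hexp, hK]
  ring

end TimeMoments

/-! ### The system of pairs as a marked Poisson process -/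

/-- Joint independence means that the joint law is an infinite product measure, and an infinite
product over pairs of indices is a product of the row products. -/
lemma ProbabilityTheory.iIndepFun.curry {ι κ Ω 𝓧 : Type*} [MeasurableSpace Ω] [MeasurableSpace 𝓧]
    {P : Measure Ω} {X : ι → κ → Ω → 𝓧} (hX : ∀ i j, Measurable (X i j))
    (h : iIndepFun (fun p : (_ : ι) × κ => X p.1 p.2) P) :
    iIndepFun (fun i ω j => X i j ω) P := by
  have := h.isProbabilityMeasure
  have : ∀ i j, IsProbabilityMeasure (P.map (X i j)) :=
    fun i j => Measure.isProbabilityMeasure_map (hX i j).aemeasurable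
  have hrow : ∀ i, P.map (fun ω j => X i j ω) = Measure.infinitePi fun j => P.map (X i j) :=
    fun i => (iIndepFun_iff_map_fun_eq_infinitePi_map (hX i)).1
      (h.precomp (g := fun j => (⟨i, j⟩ : (_ : ι) × κ)) fun j k hjk => by simpa using hjk)
  have hall := (iIndepFun_iff_map_fun_eq_infinitePi_map
    (X := fun p : (_ : ι) × κ => X p.1 p.2) fun p => hX p.1 p.2).1 h
  rw [iIndepFun_iff_map_fun_eq_infinitePi_map fun i => measurable_pi_lambda _ (hX i)]
  simp_rw [hrow]
  rw [← Measure.infinitePi_map_piCurry (fun i j => P.map (X i j)),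
    ← hall, Measure.map_map (MeasurableEquiv.measurable _)
      (measurable_pi_lambda (fun ω (p : (_ : ι) × κ) => X p.1 p.2 ω) fun p => hX p.1 p.2)]
  rfl

/-- Regroups (both starting points, both paths) as (first particle, second particle); in this form
the mean measure is a product and moments of product weights factor. -/
lemma measurePreserving_prodProdProdComm {A B C D : Type*} [MeasurableSpace A] [MeasurableSpace B]
    [MeasurableSpace C] [MeasurableSpace D] (μ₁ : Measure A) (μ₂ : Measure B) (κ₁ : Measure C)
    (κ₂ : Measure D) [SFinite μ₁] [SFinite μ₂] [SFinite κ₁] [SFinite κ₂] :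
    MeasurePreserving (fun q : (A × B) × (C × D) => ((q.1.1, q.2.1), (q.1.2, q.2.2)))
      ((μ₁.prod μ₂).prod (κ₁.prod κ₂)) ((μ₁.prod κ₁).prod (μ₂.prod κ₂)) := by
  refine ⟨by fun_prop, Measure.ext_of_lintegral _ fun f hf => ?_⟩
  rw [lintegral_map hf (by fun_prop), lintegral_prod _ (by fun_prop),
    lintegral_prod _ (by fun_prop), lintegral_prod _ (by fun_prop),
    lintegral_prod _ (by fun_prop)]
  refine lintegral_congr fun a => ?_
  have h1 : ∀ b, ∫⁻ q : C × D, f ((a, q.1), (b, q.2)) ∂(κ₁.prod κ₂) =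
      ∫⁻ c, ∫⁻ d, f ((a, c), (b, d)) ∂κ₂ ∂κ₁ := fun b => lintegral_prod _ (by fun_prop)
  have h2 : ∀ c, ∫⁻ q : B × D, f ((a, c), q) ∂(μ₂.prod κ₂) =
      ∫⁻ b, ∫⁻ d, f ((a, c), (b, d)) ∂κ₂ ∂μ₂ := fun c => lintegral_prod _ (by fun_prop)
  simp_rw [h1, h2]
  exact lintegral_lintegral_swap (by fun_prop)

section System

variable {Ω : Type*} [MeasurableSpace Ω] {P : Measure Ω} {α₁ α₂ : ℝ} {μ : Measure (ℝ × ℝ)}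
  {x : ℕ → Ω → ℝ × ℝ} {ξ ζ : ℕ → ℝ≥0 → Ω → ℝ}

/-- The starting point and the displacements of both members of the `n`-th pair. -/
def pairPath (x : ℕ → Ω → ℝ × ℝ) (ξ ζ : ℕ → ℝ≥0 → Ω → ℝ) (n : ℕ) (ω : Ω) :
    (ℝ × (ℝ≥0 → ℝ)) × (ℝ × (ℝ≥0 → ℝ)) :=
  (((x n ω).1, fun t => ξ n t ω), ((x n ω).2, fun t => ζ n t ω))

namespace IsStablePairSystem

lemma measurable_fst_path (h : IsStablePairSystem α₁ α₂ μ x ξ ζ P) (n : ℕ) :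
    Measurable fun ω t => ξ n t ω := (h.stable_fst n).measurable_path

lemma measurable_snd_path (h : IsStablePairSystem α₁ α₂ μ x ξ ζ P) (n : ℕ) :
    Measurable fun ω t => ζ n t ω := (h.stable_snd n).measurable_path

lemma measurable_pairPath (h : IsStablePairSystem α₁ α₂ μ x ξ ζ P) (n : ℕ) :
    Measurable (pairPath x ξ ζ n) :=
  ((measurable_fst.comp (h.measurable_points n)).prodMk (h.measurable_fst_path n)).prodMk
    ((measurable_snd.comp (h.measurable_points n)).prodMk (h.measurable_snd_path n))

lemma iIndepFun_marks (h : IsStablePairSystem α₁ α₂ μ x ξ ζ P) :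
    iIndepFun (fun n ω => ((fun t => ξ n t ω), (fun t => ζ n t ω))) P := by
  -- The Boolean selects the second or the first member of the pair, so that the family of single
  -- motions can be grouped by n.
  let g : (_ : ℕ) × Bool → ℕ ⊕ ℕ := fun p => if p.2 then Sum.inr p.1 else Sum.inl p.1
  have hg : Function.Injective g := by
    rintro ⟨n, a⟩ ⟨m, b⟩ hab
    cases a <;> cases b <;> simp_all [g]
  have h1 := iIndepFun.curry (X := fun n b ω t => Sum.elim ξ ζ (g ⟨n, b⟩) t ω) (fun n b => by
    cases b
    · exact h.measurable_fst_path n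
    · exact h.measurable_snd_path n) (h.indep_motions.precomp hg)
  exact h1.comp (fun _ r => (r false, r true)) fun _ => by fun_prop

lemma indepFun_points_marks (h : IsStablePairSystem α₁ α₂ μ x ξ ζ P) :
    IndepFun (fun ω n => x n ω) (fun ω n => ((fun t => ξ n t ω), (fun t => ζ n t ω))) P := by
  have hψ : Measurable fun (w : ℕ ⊕ ℕ → ℝ≥0 → ℝ) (n : ℕ) => (w (Sum.inl n), w (Sum.inr n)) := by
    fun_prop
  exact h.indep_points.comp measurable_id hψ

variable [IsProbabilityMeasure P]

lemma map_marks (h : IsStablePairSystem α₁ α₂ μ x ξ ζ P) (n : ℕ) :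
    P.map (fun ω => ((fun t => ξ n t ω), (fun t => ζ n t ω))) =
      (P.map fun ω t => ξ 0 t ω).prod (P.map fun ω t => ζ 0 t ω) := by
  have hind := h.indep_motions.indepFun (i := Sum.inl n) (j := Sum.inr n) (by simp)
  rw [(h.stable_fst 0).map_eq_map (h.stable_fst n), (h.stable_snd 0).map_eq_map (h.stable_snd n)]
  exact (indepFun_iff_map_prod_eq_prod_map_map (h.measurable_fst_path n).aemeasurable
    (h.measurable_snd_path n).aemeasurable).1 hind

variable {μ₁ μ₂ : Measure ℝ} [SigmaFinite μ₁] [SigmaFinite μ₂]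

lemma sum_map_pairPath (h : IsStablePairSystem α₁ α₂ (μ₁.prod μ₂) x ξ ζ P) :
    Measure.sum (fun n => P.map (pairPath x ξ ζ n)) =
      (μ₁.prod (P.map fun ω t => ξ 0 t ω)).prod (μ₂.prod (P.map fun ω t => ζ 0 t ω)) := by
  have hw : ∀ n, Measurable fun ω => ((fun t => ξ n t ω), (fun t => ζ n t ω)) :=
    fun n => (h.measurable_fst_path n).prodMk (h.measurable_snd_path n)
  have h1 := sum_map_marked_eq h.measurable_points (h.poisson.sum_map_eq h.measurable_points) hw
    h.map_marks fun n =>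
      h.indepFun_points_marks.comp (measurable_pi_apply n) (measurable_pi_apply n)
  rw [← (measurePreserving_prodProdProdComm _ _ _ _).map_eq, ← h1,
    Measure.map_sum (by fun_prop)]
  congr 1; ext1 n
  rw [Measure.map_map (by fun_prop) ((h.measurable_points n).prodMk (hw n))]
  rfl

lemma integral_exp_tsum_pairPath (h : IsStablePairSystem α₁ α₂ (μ₁.prod μ₂) x ξ ζ P)
    {G : (ℝ × (ℝ≥0 → ℝ)) × (ℝ × (ℝ≥0 → ℝ)) → ℝ} (hG : Measurable G)
    (hGi : Integrable G ((μ₁.prod (P.map fun ω t => ξ 0 t ω)).prod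
      (μ₂.prod (P.map fun ω t => ζ 0 t ω)))) :
    ∫ ω, Complex.exp (Complex.I * ((∑' n, G (pairPath x ξ ζ n ω) : ℝ) : ℂ)) ∂P =
      Complex.exp (∫ q, (Complex.exp (Complex.I * G q) - 1)
        ∂((μ₁.prod (P.map fun ω t => ξ 0 t ω)).prod (μ₂.prod (P.map fun ω t => ζ 0 t ω)))) := by
  have := Measure.isProbabilityMeasure_map (μ := P) (h.measurable_fst_path 0).aemeasurable
  have := Measure.isProbabilityMeasure_map (μ := P) (h.measurable_snd_path 0).aemeasurable
  have hmp := measurePreserving_prodProdProdComm μ₁ μ₂ (P.map fun ω t => ξ 0 t ω)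
    (P.map fun ω t => ζ 0 t ω)
  have h1 := h.poisson.integral_exp_tsum_marked h.measurable_points
    (fun n => (h.measurable_fst_path n).prodMk (h.measurable_snd_path n)) h.map_marks
    h.iIndepFun_marks h.indepFun_points_marks (hG.comp hmp.measurable)
    ((hmp.integrable_comp hG.aestronglyMeasurable).2 hGi)
  rw [← hmp.map_eq, integral_map hmp.measurable.aemeasurable
    (Measurable.aestronglyMeasurable (by fun_prop))]
  exact h1

end IsStablePairSystem

end System

/-! ### The occupation time as a sum over pairs -/

section TimeIntegral

variable {α γ : ℝ} {κ : Measure (ℝ≥0 → ℝ)} {φ φ' : ℝ → ℝ}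

lemma measurable_timeIntegral (hφ : Measurable φ) (S : ℝ) : Measurable (timeIntegral φ S) := by
  refine (StronglyMeasurable.integral_prod_right' (ν := volume.restrict (Set.Ioc 0 S))
    (f := fun q : (ℝ × (ℝ≥0 → ℝ)) × ℝ => φ (particlePos q.1 q.2)) ?_).measurable
  exact Measurable.stronglyMeasurable (by fun_prop)

lemma enorm_timeIntegral_le (φ : ℝ → ℝ) (S : ℝ) (p : ℝ × (ℝ≥0 → ℝ)) :
    ‖timeIntegral φ S p‖ₑ ≤ ∫⁻ u in Set.Ioc 0 S, ‖φ (particlePos p u)‖ₑ :=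
  enorm_integral_le_lintegral_enorm _

lemma IsStablePathLaw.lintegral_time_lt_top (h : IsStablePathLaw α κ) (hα : 1 < α) (hγ : 0 ≤ γ)
    (hγ' : γ < 1) (hφ : Measurable φ) (hφi : Integrable φ) (S : ℝ≥0) :
    ∫⁻ p, (∫⁻ u in Set.Ioc 0 (S : ℝ), ‖φ (particlePos p u)‖ₑ) ∂((powerIntensity γ).prod κ) < ∞ := by
  have := h.isProbabilityMeasure_stableLaw 1 one_pos
  obtain ⟨C, hC⟩ := exists_stablePotential_bound (zero_lt_one.trans hα) hγ hγ'
  exact (h.lintegral_time_le hα hγ' hC hφ.enorm S.coe_nonneg).trans_lt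
    (ENNReal.mul_lt_top (ENNReal.mul_lt_top ENNReal.coe_lt_top hφi.2) ENNReal.ofReal_lt_top)

lemma IsStablePathLaw.integrable_timeIntegral (h : IsStablePathLaw α κ) (hα : 1 < α) (hγ : 0 ≤ γ)
    (hγ' : γ < 1) (hφ : Measurable φ) (hφi : Integrable φ) (S : ℝ≥0) :
    Integrable (timeIntegral φ S) ((powerIntensity γ).prod κ) :=
  ⟨(measurable_timeIntegral hφ _).aestronglyMeasurable,
    (lintegral_mono fun p => enorm_timeIntegral_le φ _ p).trans_lt
      (h.lintegral_time_lt_top hα hγ hγ' hφ hφi S)⟩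

/-- Almost no particle spends time in a Lebesgue null set. -/
lemma IsStablePathLaw.ae_ae_comp_particlePos_eq (h : IsStablePathLaw α κ) (hα : 1 < α) (hγ : 0 ≤ γ)
    (hγ' : γ < 1) (hφ : φ =ᵐ[volume] φ') (S : ℝ≥0) :
    ∀ᵐ p ∂((powerIntensity γ).prod κ), ∀ᵐ u ∂(volume.restrict (Set.Ioc 0 (S : ℝ))),
      φ (particlePos p u) = φ' (particlePos p u) := by
  have := h.isProbabilityMeasure_stableLaw 1 one_pos
  obtain ⟨C, hC⟩ := exists_stablePotential_bound (zero_lt_one.trans hα) hγ hγ'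
  obtain ⟨N, hN, hNm, hN0⟩ := exists_measurable_superset_of_null (ae_iff.1 hφ)
  have hf : Measurable (N.indicator (1 : ℝ → ℝ≥0∞)) := measurable_one.indicator hNm
  have h1 := h.lintegral_time_le hα hγ' hC hf S.coe_nonneg
  rw [lintegral_indicator_one hNm, hN0, mul_zero, zero_mul, nonpos_iff_eq_zero,
    lintegral_eq_zero_iff (by fun_prop)] at h1
  filter_upwards [h1] with p hp
  rw [Pi.zero_apply, lintegral_eq_zero_iff (by fun_prop)] at hp
  filter_upwards [hp] with u hu
  by_contra hne
  simp [Set.indicator_of_mem (hN hne)] at hu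

end TimeIntegral

section Occupation

variable {Ω : Type*} [MeasurableSpace Ω] {P : Measure Ω} [IsProbabilityMeasure P]
  {α₁ α₂ γ₁ γ₂ : ℝ} {x : ℕ → Ω → ℝ × ℝ} {ξ ζ : ℕ → ℝ≥0 → Ω → ℝ} {φ ψ φ' ψ' : ℝ → ℝ}

lemma lintegral_rect_enorm_mul {f g : ℝ → ℝ} (hf : Measurable f) (hg : Measurable g) (s t : ℝ) :
    ∫⁻ z in Set.Ioc 0 s ×ˢ Set.Ioc 0 t, ‖f z.1 * g z.2‖ₑ =
      (∫⁻ u in Set.Ioc 0 s, ‖f u‖ₑ) * ∫⁻ v in Set.Ioc 0 t, ‖g v‖ₑ := by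
  simp_rw [enorm_mul]
  rw [Measure.volume_eq_prod, ← Measure.prod_restrict,
    lintegral_prod_mul hf.enorm.aemeasurable hg.enorm.aemeasurable]

/-- The occupation time is the sum over all pairs of the products of their time integrals. -/
theorem IsStablePairSystem.ae_occupationTime_eq
    (h : IsStablePairSystem α₁ α₂ ((powerIntensity γ₁).prod (powerIntensity γ₂)) x ξ ζ P)
    (hγ₁ : 0 ≤ γ₁) (hγ₁' : γ₁ < 1) (hα₁ : 1 < α₁) (hγ₂ : 0 ≤ γ₂) (hγ₂' : γ₂ < 1) (hα₂ : 1 < α₂)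
    (hφ' : Measurable φ') (hφi : Integrable φ') (hφ : φ =ᵐ[volume] φ')
    (hψ' : Measurable ψ') (hψi : Integrable ψ') (hψ : ψ =ᵐ[volume] ψ') (s t : ℝ≥0) :
    ∀ᵐ ω ∂P,
      (∀ᵐ p : ℝ × ℝ ∂(volume.restrict (Set.Ioc 0 (s : ℝ) ×ˢ Set.Ioc 0 (t : ℝ))),
        Summable (pairTerm x ξ ζ φ ψ p.1.toNNReal p.2.toNNReal ω)) ∧
      IntegrableOn (fun p : ℝ × ℝ =>
        configurationPairing x ξ ζ φ ψ p.1.toNNReal p.2.toNNReal ω)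
        (Set.Ioc 0 (s : ℝ) ×ˢ Set.Ioc 0 (t : ℝ)) ∧
      occupationTime x ξ ζ φ ψ s t ω =
        ∑' n, timeIntegral φ' s (pairPath x ξ ζ n ω).1 *
          timeIntegral ψ' t (pairPath x ξ ζ n ω).2 := by
  have hκ₁ := (h.stable_fst 0).isStablePathLaw (zero_lt_one.trans hα₁)
  have hκ₂ := (h.stable_snd 0).isStablePathLaw (zero_lt_one.trans hα₂)
  have := hκ₁.isProbabilityMeasure
  have := hκ₂.isProbabilityMeasure
  have hm := h.measurable_pairPath
  have hsum := h.sum_map_pairPath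
  have hver₁ := ae_forall_of_ae_sum_map hm hsum
    (Measure.quasiMeasurePreserving_fst.ae (hκ₁.ae_ae_comp_particlePos_eq hα₁ hγ₁ hγ₁' hφ s))
  have hver₂ := ae_forall_of_ae_sum_map hm hsum
    (Measure.quasiMeasurePreserving_snd.ae (hκ₂.ae_ae_comp_particlePos_eq hα₂ hγ₂ hγ₂' hψ t))
  have hg : Measurable fun q : (ℝ × (ℝ≥0 → ℝ)) × (ℝ × (ℝ≥0 → ℝ)) =>
      (∫⁻ u in Set.Ioc 0 (s : ℝ), ‖φ' (particlePos q.1 u)‖ₑ) *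
        ∫⁻ v in Set.Ioc 0 (t : ℝ), ‖ψ' (particlePos q.2 v)‖ₑ := by fun_prop
  -- The expected total absolute weight is a product of two finite one-particle integrals. Its
  -- finiteness gives almost sure absolute convergence, on which every later exchange of sum and
  -- integral rests.
  have htop := lintegral_tsum_comp_eq hm hsum hg
  rw [lintegral_prod_mul (f := fun p => ∫⁻ u in Set.Ioc 0 (s : ℝ), ‖φ' (particlePos p u)‖ₑ)
    (g := fun p => ∫⁻ v in Set.Ioc 0 (t : ℝ), ‖ψ' (particlePos p v)‖ₑ)
    (by fun_prop) (by fun_prop)] at htop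
  have hfin := ae_lt_top (Measurable.tsum fun n => hg.comp (hm n)) (htop.trans_ne
    (ENNReal.mul_ne_top (hκ₁.lintegral_time_lt_top hα₁ hγ₁ hγ₁' hφ' hφi s).ne
      (hκ₂.lintegral_time_lt_top hα₂ hγ₂ hγ₂' hψ' hψi t).ne))
  filter_upwards [hver₁, hver₂, hfin, ae_all_iff.2 fun n => (h.stable_fst n).ae_cadlagEval_eq,
    ae_all_iff.2 fun n => (h.stable_snd n).ae_cadlagEval_eq] with ω h1 h2 h3 h4 h5
  let f : ℕ → ℝ × ℝ → ℝ := fun n z => φ' (particlePos (pairPath x ξ ζ n ω).1 z.1) *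
    ψ' (particlePos (pairPath x ξ ζ n ω).2 z.2)
  have hf : ∀ n, Measurable (f n) := fun n => by fun_prop
  -- Outside one null set of times, all pairs simultaneously see the measurable representatives and
  -- the regularized paths.
  have hterm : ∀ᵐ p : ℝ × ℝ ∂(volume.restrict (Set.Ioc 0 (s : ℝ) ×ˢ Set.Ioc 0 (t : ℝ))),
      ∀ n, pairTerm x ξ ζ φ ψ p.1.toNNReal p.2.toNNReal ω n = f n p := by
    rw [Measure.volume_eq_prod, ← Measure.prod_restrict]
    refine ae_all_iff.2 fun n => ?_
    filter_upwards [Measure.quasiMeasurePreserving_fst.ae (h1 n),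
      Measure.quasiMeasurePreserving_snd.ae (h2 n)] with p hp1 hp2
    rw [pairTerm, ← h4 n, ← h5 n]
    exact congr_arg₂ _ hp1 hp2
  have hftop : ∑' n, ∫⁻ z in Set.Ioc 0 (s : ℝ) ×ˢ Set.Ioc 0 (t : ℝ), ‖f n z‖ₑ ≠ ∞ := by
    have e : ∀ n, ∫⁻ z in Set.Ioc 0 (s : ℝ) ×ˢ Set.Ioc 0 (t : ℝ), ‖f n z‖ₑ = _ := fun n =>
      lintegral_rect_enorm_mul (f := fun u => φ' (particlePos (pairPath x ξ ζ n ω).1 u))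
        (g := fun v => ψ' (particlePos (pairPath x ξ ζ n ω).2 v)) (by fun_prop) (by fun_prop) s t
    simp_rw [e]
    exact h3.ne
  obtain ⟨hs, hi⟩ := ae_summable_and_integrable_tsum hf hftop
  have hconf : (fun p : ℝ × ℝ => configurationPairing x ξ ζ φ ψ p.1.toNNReal p.2.toNNReal ω)
      =ᵐ[volume.restrict (Set.Ioc 0 (s : ℝ) ×ˢ Set.Ioc 0 (t : ℝ))] fun p => ∑' n, f n p := by
    filter_upwards [hterm] with p hp
    rw [configurationPairing]
    exact tsum_congr hp
  have hint := hi.congr hconf.symm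
  refine ⟨?_, hint, ?_⟩
  · filter_upwards [hs, hterm] with p hp hp'
    exact hp.congr fun n => (hp' n).symm
  · rw [occupationTime, intervalIntegral.integral_of_le s.coe_nonneg]
    simp_rw [intervalIntegral.integral_of_le t.coe_nonneg]
    rw [Measure.volume_eq_prod] at hint
    rw [← setIntegral_prod (fun p : ℝ × ℝ =>
      configurationPairing x ξ ζ φ ψ p.1.toNNReal p.2.toNNReal ω) hint, ← Measure.volume_eq_prod,
      integral_congr_ae hconf, integral_tsum (fun n => (hf n).aestronglyMeasurable) hftop]
    refine tsum_congr fun n => ?_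
    rw [Measure.volume_eq_prod]
    exact setIntegral_prod_mul (fun u => φ' (particlePos (pairPath x ξ ζ n ω).1 u))
      (fun v => ψ' (particlePos (pairPath x ξ ζ n ω).2 v)) _ _

end Occupation

/-! ### From moments to the Gaussian exponent -/

/-- Taylor's remainder for |z| ≤ 1, and 2 + |z| + |z|²/2 ≤ 4|z|³ beyond. The constant is not sharp;
only the cubic order matters. -/
lemma norm_exp_I_mul_sub_le (z : ℝ) :
    ‖Complex.exp (Complex.I * z) - 1 - Complex.I * z + ((z ^ 2 / 2 : ℝ) : ℂ)‖ ≤ 4 * |z| ^ 3 := by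
  have hn : ‖Complex.I * z‖ = |z| := by simp
  rcases le_or_gt |z| 1 with hz | hz
  · have h := Complex.exp_bound (x := Complex.I * z) (by rw [hn]; exact hz) (n := 3) (by norm_num)
    rw [hn] at h
    have e : Complex.exp (Complex.I * z) - 1 - Complex.I * z + ((z ^ 2 / 2 : ℝ) : ℂ) =
        Complex.exp (Complex.I * z) - ∑ m ∈ Finset.range 3, (Complex.I * z) ^ m / m.factorial := by
      simp only [Finset.sum_range_succ, Finset.sum_range_zero]
      push_cast [Nat.factorial]
      linear_combination (z : ℂ) ^ 2 / 2 * Complex.I_sq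
    rw [e]
    refine h.trans ?_
    rw [mul_comm]
    gcongr
    norm_num [Nat.factorial]
  · have h1 : ‖Complex.exp (Complex.I * z)‖ = 1 := by
      rw [mul_comm]
      exact Complex.norm_exp_ofReal_mul_I z
    have h2 : ‖((z ^ 2 / 2 : ℝ) : ℂ)‖ = |z| ^ 2 / 2 := by
      rw [Complex.norm_real, Real.norm_of_nonneg (by positivity), sq_abs]
    have h3 := norm_add_le (Complex.exp (Complex.I * z) - 1 - Complex.I * z) ((z ^ 2 / 2 : ℝ) : ℂ)
    have h4 := norm_sub_le (Complex.exp (Complex.I * z) - 1) (Complex.I * z)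
    have h5 := norm_sub_le (Complex.exp (Complex.I * z)) 1
    rw [h1, norm_one] at h5
    rw [hn] at h4
    rw [h2] at h3
    nlinarith [sq_nonneg (|z| - 1), mul_pos (sub_pos.2 hz) (sub_pos.2 hz),
      pow_pos (sub_pos.2 hz) 3]

section Lindeberg

variable {E : Type*} [MeasurableSpace E] {m : Measure E}

lemma integrable_exp_I_mul_sub_one {Z : E → ℝ} (hZ : Measurable Z) (hZi : Integrable Z m) :
    Integrable (fun q => Complex.exp (Complex.I * Z q) - 1) m :=
  hZi.norm.mono' (Measurable.aestronglyMeasurable (by fun_prop))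
    (ae_of_all _ fun _ => Real.norm_exp_I_mul_ofReal_sub_one_le)

/-- The exponent of a compensated Poisson integral converges to that of a Gaussian law if second
moments converge and third moments vanish. -/
lemma tendsto_integral_exp_sub_one_sub {ι : Type*} {l : Filter ι} {Z : ι → E → ℝ}
    (hZ : ∀ i, Measurable (Z i)) (hZi : ∀ i, Integrable (Z i) m)
    (hZ2 : ∀ i, Integrable (fun q => Z i q ^ 2) m) {σ : ℝ}
    (h2 : Tendsto (fun i => ∫ q, Z i q ^ 2 ∂m) l (𝓝 σ))
    (h3 : Tendsto (fun i => ∫⁻ q, ‖Z i q‖ₑ ^ 3 ∂m) l (𝓝 0)) :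
    Tendsto (fun i => ∫ q, (Complex.exp (Complex.I * Z i q) - 1) ∂m -
      Complex.I * ((∫ q, Z i q ∂m : ℝ) : ℂ)) l (𝓝 (-((σ / 2 : ℝ) : ℂ))) := by
  have hrem : Tendsto (fun i => ∫ q, (Complex.exp (Complex.I * Z i q) - 1 - Complex.I * Z i q +
      ((Z i q ^ 2 / 2 : ℝ) : ℂ)) ∂m) l (𝓝 0) := by
    rw [tendsto_zero_iff_enorm_tendsto_zero]
    have h4 : Tendsto (fun i => 4 * ∫⁻ q, ‖Z i q‖ₑ ^ 3 ∂m) l (𝓝 0) := by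
      simpa using ENNReal.Tendsto.const_mul h3 (Or.inr (show (4 : ℝ≥0∞) ≠ ∞ by simp))
    refine tendsto_of_tendsto_of_tendsto_of_le_of_le tendsto_const_nhds h4 (fun _ => zero_le)
      fun i => (enorm_integral_le_lintegral_enorm _).trans ?_
    have hm := hZ i
    rw [← lintegral_const_mul _ (by fun_prop)]
    refine lintegral_mono fun q => ?_
    have h := ENNReal.ofReal_le_ofReal (norm_exp_I_mul_sub_le (Z i q))
    rw [ofReal_norm, ENNReal.ofReal_mul (by norm_num), ENNReal.ofReal_pow (abs_nonneg _),
      ← Real.norm_eq_abs, ofReal_norm, ENNReal.ofReal_ofNat] at h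
    exact h
  have h2' : Tendsto (fun i => (((∫ q, Z i q ^ 2 ∂m) / 2 : ℝ) : ℂ)) l (𝓝 ((σ / 2 : ℝ) : ℂ)) :=
    (Complex.continuous_ofReal.tendsto _).comp (h2.div_const 2)
  have h5 := hrem.sub h2'
  rw [zero_sub] at h5
  refine h5.congr fun i => ?_
  have e1 := integrable_exp_I_mul_sub_one (hZ i) (hZi i)
  have e2 : Integrable (fun q => Complex.I * (Z i q : ℂ)) m := (hZi i).ofReal.const_mul _
  have e3 : Integrable (fun q => ((Z i q ^ 2 / 2 : ℝ) : ℂ)) m := ((hZ2 i).div_const 2).ofReal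
  have e12 : Integrable
      (fun q => Complex.exp (Complex.I * Z i q) - 1 - Complex.I * (Z i q : ℂ)) m :=
    e1.sub e2
  rw [integral_add e12 e3, integral_sub e1 e2, integral_const_mul, integral_complex_ofReal,
    integral_complex_ofReal, integral_div, add_sub_cancel_right]

end Lindeberg

/-! ### Lévy's theorem and the characteristic function of the limit -/

lemma charFun_map_toLp_eq {ι Ω : Type*} [Fintype ι] [MeasurableSpace Ω] {P : Measure Ω}
    {V : Ω → ι → ℝ} (hV : AEMeasurable V P) (t : EuclideanSpace ℝ ι) :
    charFun (P.map fun ω => WithLp.toLp 2 (V ω)) t =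
      ∫ ω, Complex.exp (Complex.I * ((∑ j, t j * V ω j : ℝ) : ℂ)) ∂P := by
  have hm : Measurable (WithLp.toLp 2 : (ι → ℝ) → EuclideanSpace ℝ ι) := by fun_prop
  rw [charFun_apply, integral_map (φ := fun ω => WithLp.toLp 2 (V ω)) (hm.comp_aemeasurable hV)
    (by fun_prop)]
  simp only [PiLp.inner_apply, RCLike.inner_apply, conj_trivial, mul_comm Complex.I]

section Limit

variable {Ω Ω' : Type*} [MeasurableSpace Ω] [MeasurableSpace Ω'] {P : Measure Ω}
  [IsProbabilityMeasure P] {P' : Measure Ω'} [IsProbabilityMeasure P'] {k : ℕ}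

/-- **Lévy's continuity theorem** for random vectors, along a countably generated filter. -/
lemma tendstoInDistribution_pi_of_tendsto_integral_exp {ι : Type*} {l : Filter ι}
    [l.IsCountablyGenerated] {X : ι → Ω → Fin k → ℝ} {Y : Ω' → Fin k → ℝ}
    (hX : ∀ i, AEMeasurable (X i) P) (hY : AEMeasurable Y P')
    (h : ∀ θ : Fin k → ℝ,
      Tendsto (fun i => ∫ ω, Complex.exp (Complex.I * ((∑ j, θ j * X i ω j : ℝ) : ℂ)) ∂P) l
        (𝓝 (∫ ω, Complex.exp (Complex.I * ((∑ j, θ j * Y ω j : ℝ) : ℂ)) ∂P'))) :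
    TendstoInDistribution X l Y (fun _ => P) P' := by
  have hm : Measurable (WithLp.toLp 2 : (Fin k → ℝ) → EuclideanSpace ℝ (Fin k)) := by fun_prop
  have hX' : ∀ i, AEMeasurable (fun ω => WithLp.toLp 2 (X i ω)) P :=
    fun i => hm.comp_aemeasurable (hX i)
  have hY' : AEMeasurable (fun ω => WithLp.toLp 2 (Y ω)) P' := hm.comp_aemeasurable hY
  have hLp : TendstoInDistribution (fun i ω => WithLp.toLp 2 (X i ω)) l
      (fun ω => WithLp.toLp 2 (Y ω)) (fun _ => P) P' := by
    -- Countable generation reduces the limit to sequences; the passage to `EuclideanSpace` supplies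
    -- the inner product that characteristic functions need.
    refine ⟨hX', hY', tendsto_of_seq_tendsto fun u hu => ?_⟩
    refine ProbabilityMeasure.tendsto_iff_tendsto_charFun.2 fun t => ?_
    have := (h t).comp hu
    refine Tendsto.congr (fun n => ?_) (this.trans_eq ?_)
    · exact (charFun_map_toLp_eq (hX (u n)) t).symm
    · exact congr_arg _ (charFun_map_toLp_eq hY t).symm
  exact hLp.continuous_comp (PiLp.continuous_ofLp 2 _)

/-- A linear combination of values of a Gaussian process is Gaussian; it is centered, its variance
expands bilinearly in the covariance, and its characteristic function is taken at 1. -/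
lemma IsWeightedFBSheet.integral_exp {a₁ b₁ a₂ b₂ : ℝ} {W : ℝ≥0 × ℝ≥0 → Ω' → ℝ}
    (hW : IsWeightedFBSheet a₁ b₁ a₂ b₂ W P') (D : ℝ) (z : Fin k → ℝ≥0 × ℝ≥0) (θ : Fin k → ℝ) :
    ∫ ω, Complex.exp (Complex.I * ((∑ j, θ j * (D * W (z j) ω) : ℝ) : ℂ)) ∂P' =
      Complex.exp (-(((∑ i, ∑ j, θ i * θ j * (D ^ 2 * (weightedFBMCov a₁ b₁ (z i).1 (z j).1 *
        weightedFBMCov a₂ b₂ (z i).2 (z j).2))) / 2 : ℝ) : ℂ)) := by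
  set V : Ω' → ℝ := fun ω => ∑ j, θ j * (D * W (z j) ω) with hV
  have hG : HasGaussianLaw V P' := by
    have h1 := ((hW.gaussian.comp_right z).smul fun j => θ j * D).hasGaussianLaw_fun_sum
      (I := Finset.univ)
    refine h1.congr (ae_of_all _ fun ω => ?_)
    simp only [hV, smul_eq_mul, Function.comp_apply, mul_assoc]
  have hL2 : ∀ j, MemLp (W (z j)) 2 P' := fun j => (hW.gaussian.hasGaussianLaw_eval (z j)).memLp_two
  have hmean : ∫ ω, V ω ∂P' = 0 := by
    rw [hV, integral_finsetSum _ fun j _ =>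
      (((hL2 j).integrable one_le_two).const_mul D).const_mul (θ j)]
    simp only [integral_const_mul, hW.centered, mul_zero, Finset.sum_const_zero]
  have hsq : ∫ ω, V ω ^ 2 ∂P' = ∑ i, ∑ j, θ i * θ j * (D ^ 2 *
      (weightedFBMCov a₁ b₁ (z i).1 (z j).1 * weightedFBMCov a₂ b₂ (z i).2 (z j).2)) := by
    have e : ∀ ω, V ω ^ 2 = ∑ i, ∑ j, θ i * θ j * (D ^ 2 * (W (z i) ω * W (z j) ω)) := fun ω => by
      rw [hV, sq, Finset.sum_mul_sum]
      refine Finset.sum_congr rfl fun i _ => Finset.sum_congr rfl fun j _ => ?_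
      ring
    have hij : ∀ i j, Integrable (fun ω => θ i * θ j * (D ^ 2 * (W (z i) ω * W (z j) ω))) P' :=
      fun i j => (((hL2 i).integrable_mul (hL2 j)).const_mul _).const_mul _
    simp_rw [e]
    rw [integral_finsetSum _ fun i _ => integrable_finsetSum _ fun j _ => hij i j]
    refine Finset.sum_congr rfl fun i _ => ?_
    rw [integral_finsetSum _ fun j _ => hij i j]
    refine Finset.sum_congr rfl fun j _ => ?_
    rw [integral_const_mul, integral_const_mul, hW.covariance]
  have hc := hG.charFun_map_eq 1
  rw [charFun_apply_real, integral_map hG.aemeasurable (by fun_prop)] at hc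
  simp only [Real.inner_apply, one_mul, Complex.ofReal_one] at hc
  rw [variance_of_integral_eq_zero hG.aemeasurable (by simpa using hmean)] at hc
  simp only [hmean, hsq] at hc
  simp_rw [mul_comm Complex.I]
  rw [hc]
  congr 1
  push_cast
  ring

end Limit

/-! ### Moments of the pair weights -/

section PairWeight

variable {α₁ α₂ γ₁ γ₂ : ℝ} {κ₁ κ₂ : Measure (ℝ≥0 → ℝ)} {φ ψ : ℝ → ℝ}

/-- The contribution of one pair to the occupation time up to `z`. -/
noncomputable def pairWeight (φ ψ : ℝ → ℝ) (z : ℝ≥0 × ℝ≥0)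
    (q : (ℝ × (ℝ≥0 → ℝ)) × (ℝ × (ℝ≥0 → ℝ))) : ℝ :=
  timeIntegral φ z.1 q.1 * timeIntegral ψ z.2 q.2

lemma measurable_pairWeight (hφ : Measurable φ) (hψ : Measurable ψ) (z : ℝ≥0 × ℝ≥0) :
    Measurable (pairWeight φ ψ z) :=
  ((measurable_timeIntegral hφ _).comp measurable_fst).mul
    ((measurable_timeIntegral hψ _).comp measurable_snd)

lemma IsStablePathLaw.integrable_pairWeight (h₁ : IsStablePathLaw α₁ κ₁)
    (h₂ : IsStablePathLaw α₂ κ₂)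
    (hγ₁ : 0 ≤ γ₁) (hγ₁' : γ₁ < 1) (hα₁ : 1 < α₁) (hγ₂ : 0 ≤ γ₂) (hγ₂' : γ₂ < 1) (hα₂ : 1 < α₂)
    (hφ : Measurable φ) (hφi : Integrable φ) (hψ : Measurable ψ) (hψi : Integrable ψ)
    (z : ℝ≥0 × ℝ≥0) :
    Integrable (pairWeight φ ψ z)
      (((powerIntensity γ₁).prod κ₁).prod ((powerIntensity γ₂).prod κ₂)) := by
  have := h₁.isProbabilityMeasure
  have := h₂.isProbabilityMeasure
  exact (h₁.integrable_timeIntegral hα₁ hγ₁ hγ₁' hφ hφi z.1).mul_prod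
    (h₂.integrable_timeIntegral hα₂ hγ₂ hγ₂' hψ hψi z.2)

lemma pairWeight_mul_pairWeight (z z' : ℝ≥0 × ℝ≥0) (q : (ℝ × (ℝ≥0 → ℝ)) × (ℝ × (ℝ≥0 → ℝ))) :
    pairWeight φ ψ z q * pairWeight φ ψ z' q =
      (timeIntegral φ z.1 q.1 * timeIntegral φ z'.1 q.1) *
        (timeIntegral ψ z.2 q.2 * timeIntegral ψ z'.2 q.2) := by
  unfold pairWeight
  ring

lemma IsStablePathLaw.integrable_pairWeight_mul (h₁ : IsStablePathLaw α₁ κ₁)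
    (h₂ : IsStablePathLaw α₂ κ₂)
    (hγ₁ : 0 ≤ γ₁) (hγ₁' : γ₁ < 1) (hα₁ : 1 < α₁) (hγ₂ : 0 ≤ γ₂) (hγ₂' : γ₂ < 1) (hα₂ : 1 < α₂)
    (hφ : Measurable φ) (hφi : Integrable φ) (hψ : Measurable ψ) (hψi : Integrable ψ)
    (z z' : ℝ≥0 × ℝ≥0) :
    Integrable (fun q => pairWeight φ ψ z q * pairWeight φ ψ z' q)
      (((powerIntensity γ₁).prod κ₁).prod ((powerIntensity γ₂).prod κ₂)) := by
  have := h₁.isProbabilityMeasure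
  have := h₂.isProbabilityMeasure
  have := h₁.isProbabilityMeasure_stableLaw 1 one_pos
  have := h₂.isProbabilityMeasure_stableLaw 1 one_pos
  obtain ⟨C₁, hC₁⟩ := exists_stablePotential_bound (zero_lt_one.trans hα₁) hγ₁ hγ₁'
  obtain ⟨C₂, hC₂⟩ := exists_stablePotential_bound (zero_lt_one.trans hα₂) hγ₂ hγ₂'
  simp_rw [pairWeight_mul_pairWeight]
  exact (h₁.integral_timeIntegral_mul hα₁ hγ₁' hC₁ hφ hφi z.1 z'.1).1.mul_prod
    (h₂.integral_timeIntegral_mul hα₂ hγ₂' hC₂ hψ hψi z.2 z'.2).1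

/-- Needed so that squaring `limitConstant` undoes the square root. -/
lemma IsStablePathLaw.limitFactor_nonneg {α : ℝ} {κ : Measure (ℝ≥0 → ℝ)}
    (h : IsStablePathLaw α κ) (hα : 1 < α) (γ : ℝ) : 0 ≤ limitFactor α γ := by
  have hα0 : 0 < α := by linarith
  have hα1 : 0 < 1 - 1 / α := by rw [sub_pos, div_lt_one hα0]; linarith
  have hp := h.stableDensity_nonneg 1 one_pos
  exact mul_nonneg (mul_nonneg (by positivity) (hp 0))
    (integral_nonneg fun x => div_nonneg (hp x) (by positivity))

lemma inv_fluctuationNorming_pow (α₁ α₂ γ₁ γ₂ : ℝ) (n : ℕ) (T : ℝ≥0) :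
    (fluctuationNorming α₁ α₂ γ₁ γ₂ T)⁻¹ ^ n =
      (T : ℝ) ^ (-(n * (1 - (1 + γ₁) / (2 * α₁)))) *
        (T : ℝ) ^ (-(n * (1 - (1 + γ₂) / (2 * α₂)))) := by
  have e : ∀ b : ℝ, (T : ℝ) ^ (-(n * b)) = ((T : ℝ) ^ b)⁻¹ ^ n := fun b => by
    rw [Real.rpow_neg T.coe_nonneg, mul_comm, Real.rpow_mul_natCast T.coe_nonneg, inv_pow]
  rw [fluctuationNorming, e, e, mul_inv, mul_pow]

/-- Weights, mean measure and norming all factor over the two coordinates, so the limit is the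
product of two one-particle limits. -/
lemma IsStablePathLaw.tendsto_integral_pairWeight_mul (h₁ : IsStablePathLaw α₁ κ₁)
    (h₂ : IsStablePathLaw α₂ κ₂)
    (hγ₁ : 0 ≤ γ₁) (hγ₁' : γ₁ < 1) (hα₁ : 1 < α₁) (hγ₂ : 0 ≤ γ₂) (hγ₂' : γ₂ < 1) (hα₂ : 1 < α₂)
    (hφ : Measurable φ) (hφi : Integrable φ) (hψ : Measurable ψ) (hψi : Integrable ψ)
    (z z' : ℝ≥0 × ℝ≥0) :
    Tendsto (fun T : ℝ≥0 => (fluctuationNorming α₁ α₂ γ₁ γ₂ T)⁻¹ ^ 2 *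
      ∫ q, pairWeight φ ψ (T * z.1, T * z.2) q * pairWeight φ ψ (T * z'.1, T * z'.2) q
        ∂(((powerIntensity γ₁).prod κ₁).prod ((powerIntensity γ₂).prod κ₂))) atTop
      (𝓝 (limitConstant α₁ α₂ γ₁ γ₂ φ ψ ^ 2 *
        (weightedFBMCov (-γ₁ / α₁) (1 - 1 / α₁) z.1 z'.1 *
          weightedFBMCov (-γ₂ / α₂) (1 - 1 / α₂) z.2 z'.2))) := by
  have := h₁.isProbabilityMeasure
  have := h₂.isProbabilityMeasure
  have hD : limitConstant α₁ α₂ γ₁ γ₂ φ ψ ^ 2 = ((∫ x, φ x) ^ 2 * limitFactor α₁ γ₁) *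
      ((∫ x, ψ x) ^ 2 * limitFactor α₂ γ₂) := by
    rw [limitConstant, mul_pow, mul_pow, Real.sq_sqrt
      (mul_nonneg (h₁.limitFactor_nonneg hα₁ γ₁) (h₂.limitFactor_nonneg hα₂ γ₂))]
    ring
  rw [hD, mul_mul_mul_comm]
  refine ((h₁.tendsto_second_moment hα₁ hγ₁ hγ₁' hφ hφi z.1 z'.1).mul
    (h₂.tendsto_second_moment hα₂ hγ₂ hγ₂' hψ hψi z.2 z'.2)).congr fun T => ?_
  simp_rw [pairWeight_mul_pairWeight]
  rw [integral_prod_mul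
    (fun p => timeIntegral φ (T * z.1 : ℝ≥0) p * timeIntegral φ (T * z'.1 : ℝ≥0) p)
    (fun p => timeIntegral ψ (T * z.2 : ℝ≥0) p * timeIntegral ψ (T * z'.2 : ℝ≥0) p),
    inv_fluctuationNorming_pow]
  push_cast
  ring

/-- Every weight is dominated by one product of absolute time integrals up to a common horizon. Its
cube factors, and each normalized factor tends to 0. -/
lemma IsStablePathLaw.tendsto_lintegral_pairWeight_cube (h₁ : IsStablePathLaw α₁ κ₁)
    (h₂ : IsStablePathLaw α₂ κ₂)
    (hγ₁ : 0 ≤ γ₁) (hγ₁' : γ₁ < 1) (hα₁ : 1 < α₁) (hγ₂ : 0 ≤ γ₂) (hγ₂' : γ₂ < 1) (hα₂ : 1 < α₂)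
    (hφ : Measurable φ) (hφi : Integrable φ) (hψ : Measurable ψ) (hψi : Integrable ψ) {k : ℕ}
    (z : Fin k → ℝ≥0 × ℝ≥0) (θ : Fin k → ℝ) :
    Tendsto (fun T : ℝ≥0 => ∫⁻ q, ‖∑ j, θ j * ((fluctuationNorming α₁ α₂ γ₁ γ₂ T)⁻¹ *
        pairWeight φ ψ (T * (z j).1, T * (z j).2) q)‖ₑ ^ 3
        ∂(((powerIntensity γ₁).prod κ₁).prod ((powerIntensity γ₂).prod κ₂))) atTop (𝓝 0) := by
  have := h₁.isProbabilityMeasure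
  have := h₂.isProbabilityMeasure
  -- The sum of all coordinates is a convenient upper bound for each of them.
  set S : ℝ≥0 := ∑ j, ((z j).1 + (z j).2) with hS
  have hzS : ∀ j, (z j).1 + (z j).2 ≤ S := fun j =>
    Finset.single_le_sum (f := fun j => (z j).1 + (z j).2) (fun _ _ => zero_le) (Finset.mem_univ j)
  set K : ℝ≥0∞ := ∑ j, ‖θ j‖ₑ with hK
  have hKtop : K ^ 3 ≠ ∞ := ENNReal.pow_ne_top (ENNReal.sum_ne_top.2 fun j _ => enorm_ne_top)
  have hlim := ENNReal.Tendsto.const_mul (a := K ^ 3) (ENNReal.Tendsto.mul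
    (h₁.tendsto_third_moment hα₁ hγ₁ hγ₁' hφ hφi S) (Or.inr (by simp))
    (h₂.tendsto_third_moment hα₂ hγ₂ hγ₂' hψ hψi S) (Or.inr (by simp))) (Or.inr hKtop)
  rw [mul_zero, mul_zero] at hlim
  refine tendsto_of_tendsto_of_tendsto_of_le_of_le tendsto_const_nhds hlim (fun _ => zero_le)
    fun T => ?_
  set F := fluctuationNorming α₁ α₂ γ₁ γ₂ T with hF
  let a : ℝ × (ℝ≥0 → ℝ) → ℝ≥0∞ := fun p =>
    ∫⁻ u in Set.Ioc 0 ((T : ℝ) * S), ‖φ (particlePos p u)‖ₑ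
  let b : ℝ × (ℝ≥0 → ℝ) → ℝ≥0∞ := fun p =>
    ∫⁻ u in Set.Ioc 0 ((T : ℝ) * S), ‖ψ (particlePos p u)‖ₑ
  have ha : Measurable a := by fun_prop
  have hb : Measurable b := by fun_prop
  have hle : ∀ {f : ℝ → ℝ} {r : ℝ≥0} (p : ℝ × (ℝ≥0 → ℝ)), r ≤ S →
      ‖timeIntegral f (T * r : ℝ≥0) p‖ₑ ≤
        ∫⁻ u in Set.Ioc 0 ((T : ℝ) * S), ‖f (particlePos p u)‖ₑ := by
    intro f r p hr
    refine (enorm_timeIntegral_le f _ p).trans (lintegral_mono_set (Set.Ioc_subset_Ioc_right ?_))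
    exact_mod_cast mul_le_mul_right hr T
  have hbound : ∀ q : (ℝ × (ℝ≥0 → ℝ)) × (ℝ × (ℝ≥0 → ℝ)),
      ‖∑ j, θ j * (F⁻¹ * pairWeight φ ψ (T * (z j).1, T * (z j).2) q)‖ₑ ^ 3 ≤
        K ^ 3 * ENNReal.ofReal (F⁻¹ ^ 3) * (a q.1 ^ 3 * b q.2 ^ 3) := by
    intro q
    have hF0 : 0 ≤ F⁻¹ := inv_nonneg.2 (by rw [hF, fluctuationNorming]; positivity)
    have h1 : ‖∑ j, θ j * (F⁻¹ * pairWeight φ ψ (T * (z j).1, T * (z j).2) q)‖ₑ ≤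
        K * (ENNReal.ofReal F⁻¹ * (a q.1 * b q.2)) := by
      refine (enorm_sum_le _ _).trans ?_
      rw [hK, Finset.sum_mul]
      refine Finset.sum_le_sum fun j _ => ?_
      rw [enorm_mul, enorm_mul, Real.enorm_eq_ofReal hF0, pairWeight, enorm_mul]
      gcongr
      · exact hle _ (le_self_add.trans (hzS j))
      · exact hle _ (le_add_self.trans (hzS j))
    refine (pow_le_pow_left' h1 3).trans (le_of_eq ?_)
    rw [ENNReal.ofReal_pow hF0]
    ring
  refine (lintegral_mono hbound).trans (le_of_eq ?_)
  rw [lintegral_const_mul _ (by fun_prop), lintegral_prod_mul (f := fun p => a p ^ 3)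
    (g := fun p => b p ^ 3) (by fun_prop) (by fun_prop), hF, inv_fluctuationNorming_pow,
    ENNReal.ofReal_mul (by positivity)]
  push_cast
  ring

end PairWeight

/-! ### Characteristic functions of the fluctuations and the main theorem -/

section Fluctuation

variable {Ω : Type*} [MeasurableSpace Ω] {P : Measure Ω} [IsProbabilityMeasure P]
  {α₁ α₂ γ₁ γ₂ : ℝ} {x : ℕ → Ω → ℝ × ℝ} {ξ ζ : ℕ → ℝ≥0 → Ω → ℝ} {φ ψ φ' ψ' : ℝ → ℝ}

lemma IsStablePairSystem.occupationTime_moments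
    (h : IsStablePairSystem α₁ α₂ ((powerIntensity γ₁).prod (powerIntensity γ₂)) x ξ ζ P)
    (hγ₁ : 0 ≤ γ₁) (hγ₁' : γ₁ < 1) (hα₁ : 1 < α₁) (hγ₂ : 0 ≤ γ₂) (hγ₂' : γ₂ < 1) (hα₂ : 1 < α₂)
    (hφ' : Measurable φ') (hφi : Integrable φ') (hφ : φ =ᵐ[volume] φ')
    (hψ' : Measurable ψ') (hψi : Integrable ψ') (hψ : ψ =ᵐ[volume] ψ') (s t : ℝ≥0) :
    (∀ᵐ ω ∂P, Summable (fun n => pairWeight φ' ψ' (s, t) (pairPath x ξ ζ n ω)) ∧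
      occupationTime x ξ ζ φ ψ s t ω = ∑' n, pairWeight φ' ψ' (s, t) (pairPath x ξ ζ n ω)) ∧
    Integrable (occupationTime x ξ ζ φ ψ s t) P ∧
    ∫ ω, occupationTime x ξ ζ φ ψ s t ω ∂P = ∫ q, pairWeight φ' ψ' (s, t) q
      ∂(((powerIntensity γ₁).prod (P.map fun ω t => ξ 0 t ω)).prod
        ((powerIntensity γ₂).prod (P.map fun ω t => ζ 0 t ω))) := by
  have hκ₁ := (h.stable_fst 0).isStablePathLaw (zero_lt_one.trans hα₁)
  have hκ₂ := (h.stable_snd 0).isStablePathLaw (zero_lt_one.trans hα₂)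
  obtain ⟨hs, hi, he⟩ := campbell h.measurable_pairPath h.sum_map_pairPath
    (measurable_pairWeight hφ' hψ' (s, t))
    (hκ₁.integrable_pairWeight hκ₂ hγ₁ hγ₁' hα₁ hγ₂ hγ₂' hα₂ hφ' hφi hψ' hψi (s, t))
  have hocc : ∀ᵐ ω ∂P, occupationTime x ξ ζ φ ψ s t ω =
      ∑' n, pairWeight φ' ψ' (s, t) (pairPath x ξ ζ n ω) :=
    (h.ae_occupationTime_eq hγ₁ hγ₁' hα₁ hγ₂ hγ₂' hα₂ hφ' hφi hφ hψ' hψi hψ s t).mono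
      fun ω hω => hω.2.2
  exact ⟨hs.and hocc, hi.congr (hocc.mono fun ω hω => hω.symm), (integral_congr_ae hocc).trans he⟩

/-- The characteristic function of the fluctuations at finitely many points. -/
lemma IsStablePairSystem.integral_exp_occupationFluctuation
    (h : IsStablePairSystem α₁ α₂ ((powerIntensity γ₁).prod (powerIntensity γ₂)) x ξ ζ P)
    (hγ₁ : 0 ≤ γ₁) (hγ₁' : γ₁ < 1) (hα₁ : 1 < α₁) (hγ₂ : 0 ≤ γ₂) (hγ₂' : γ₂ < 1) (hα₂ : 1 < α₂)
    (hφ' : Measurable φ') (hφi : Integrable φ') (hφ : φ =ᵐ[volume] φ')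
    (hψ' : Measurable ψ') (hψi : Integrable ψ') (hψ : ψ =ᵐ[volume] ψ') {k : ℕ}
    (z : Fin k → ℝ≥0 × ℝ≥0) (θ : Fin k → ℝ) (T : ℝ≥0)
    {Z : (ℝ × (ℝ≥0 → ℝ)) × (ℝ × (ℝ≥0 → ℝ)) → ℝ}
    (hZ : ∀ q, Z q = ∑ j, θ j * ((fluctuationNorming α₁ α₂ γ₁ γ₂ T)⁻¹ *
        pairWeight φ' ψ' (T * (z j).1, T * (z j).2) q))
    {m : Measure ((ℝ × (ℝ≥0 → ℝ)) × (ℝ × (ℝ≥0 → ℝ)))}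
    (hm : m = ((powerIntensity γ₁).prod (P.map fun ω t => ξ 0 t ω)).prod
        ((powerIntensity γ₂).prod (P.map fun ω t => ζ 0 t ω))) :
    ∫ ω, Complex.exp (Complex.I * ((∑ j, θ j *
        occupationFluctuation P α₁ α₂ γ₁ γ₂ x ξ ζ φ ψ T (z j) ω : ℝ) : ℂ)) ∂P =
      Complex.exp (∫ q, (Complex.exp (Complex.I * Z q) - 1) ∂m -
        Complex.I * ((∫ q, Z q ∂m : ℝ) : ℂ)) := by
  have hκ₁ := (h.stable_fst 0).isStablePathLaw (zero_lt_one.trans hα₁)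
  have hκ₂ := (h.stable_snd 0).isStablePathLaw (zero_lt_one.trans hα₂)
  have hGi := fun j => hκ₁.integrable_pairWeight hκ₂ hγ₁ hγ₁' hα₁ hγ₂ hγ₂' hα₂ hφ' hφi hψ' hψi
    (T * (z j).1, T * (z j).2)
  rw [← hm] at hGi
  have hGm := fun j => measurable_pairWeight hφ' hψ' (T * (z j).1, T * (z j).2)
  have hZm : Measurable Z := by
    rw [funext hZ]
    exact Finset.measurable_fun_sum _ fun j _ => ((hGm j).const_mul _).const_mul _
  have hZj := fun j => ((hGi j).const_mul (fluctuationNorming α₁ α₂ γ₁ γ₂ T)⁻¹).const_mul (θ j)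
  have hZi : Integrable Z m := by
    rw [funext hZ]
    exact integrable_finsetSum _ fun j _ => hZj j
  have hmom := fun j => h.occupationTime_moments hγ₁ hγ₁' hα₁ hγ₂ hγ₂' hα₂ hφ' hφi hφ hψ' hψi hψ
    (T * (z j).1) (T * (z j).2)
  have hmean : ∫ q, Z q ∂m = ∑ j, θ j * ((fluctuationNorming α₁ α₂ γ₁ γ₂ T)⁻¹ *
      ∫ ω, occupationTime x ξ ζ φ ψ (T * (z j).1) (T * (z j).2) ω ∂P) := by
    simp_rw [hZ]
    rw [integral_finsetSum _ fun j _ => hZj j]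
    refine Finset.sum_congr rfl fun j _ => ?_
    rw [integral_const_mul, integral_const_mul, (hmom j).2.2, hm]
  -- By Campbell's formula the centering in X_T amounts to subtracting ∫ Z dm, so it enters the
  -- characteristic function only as a deterministic phase.
  have hsum : ∀ᵐ ω ∂P, ∑ j, θ j * occupationFluctuation P α₁ α₂ γ₁ γ₂ x ξ ζ φ ψ T (z j) ω =
      ∑' n, Z (pairPath x ξ ζ n ω) - ∫ q, Z q ∂m := by
    filter_upwards [ae_all_iff.2 fun j => (hmom j).1] with ω hω
    have hS := fun j => ((hω j).1.mul_left (fluctuationNorming α₁ α₂ γ₁ γ₂ T)⁻¹).mul_left (θ j)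
    rw [hmean]
    simp_rw [hZ]
    rw [Summable.tsum_finsetSum fun j _ => hS j, ← Finset.sum_sub_distrib]
    refine Finset.sum_congr rfl fun j _ => ?_
    rw [tsum_mul_left, tsum_mul_left, ← (hω j).2, occupationFluctuation]
    ring
  have hexp := h.integral_exp_tsum_pairPath hZm (hm ▸ hZi)
  rw [← hm] at hexp
  rw [Complex.exp_sub, ← hexp, ← integral_div]
  refine integral_congr_ae ?_
  filter_upwards [hsum] with ω hω
  rw [hω, ← Complex.exp_sub, ← mul_sub, Complex.ofReal_sub]

end Fluctuation

theorem theorem3p1 {Ω Ω' : Type*} [MeasurableSpace Ω] [MeasurableSpace Ω']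
    (P : Measure Ω) [IsProbabilityMeasure P] (P' : Measure Ω') [IsProbabilityMeasure P']
    (α₁ α₂ γ₁ γ₂ : ℝ)
    (hγ₁ : 0 ≤ γ₁) (hγ₁' : γ₁ < 1) (hα₁ : 1 < α₁) (hα₁' : α₁ ≤ 2)
    (hγ₂ : 0 ≤ γ₂) (hγ₂' : γ₂ < 1) (hα₂ : 1 < α₂) (hα₂' : α₂ ≤ 2)
    (φ ψ : ℝ → ℝ) (hφ : Integrable φ) (hψ : Integrable ψ)
    (x : ℕ → Ω → ℝ × ℝ) (ξ ζ : ℕ → ℝ≥0 → Ω → ℝ)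
    (hsys : IsStablePairSystem α₁ α₂ ((powerIntensity γ₁).prod (powerIntensity γ₂)) x ξ ζ P)
    (W : ℝ≥0 × ℝ≥0 → Ω' → ℝ)
    (hW : IsWeightedFBSheet (-γ₁ / α₁) (1 - 1 / α₁) (-γ₂ / α₂) (1 - 1 / α₂) W P') :
    -- the series, the time integral and the expectation that define `X_T` converge absolutely
    (∀ s t : ℝ≥0,
      (∀ᵐ ω ∂P,
        (∀ᵐ p : ℝ × ℝ ∂(volume.restrict (Set.Ioc 0 (s : ℝ) ×ˢ Set.Ioc 0 (t : ℝ))),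
          Summable (pairTerm x ξ ζ φ ψ p.1.toNNReal p.2.toNNReal ω)) ∧
        IntegrableOn (fun p : ℝ × ℝ =>
          configurationPairing x ξ ζ φ ψ p.1.toNNReal p.2.toNNReal ω)
          (Set.Ioc 0 (s : ℝ) ×ˢ Set.Ioc 0 (t : ℝ))) ∧
      Integrable (occupationTime x ξ ζ φ ψ s t) P) ∧
    -- convergence of the finite-dimensional distributions
    ∀ (k : ℕ) (z : Fin k → ℝ≥0 × ℝ≥0),
      TendstoInDistribution
        (fun (T : ℝ≥0) (ω : Ω) (j : Fin k) =>
          occupationFluctuation P α₁ α₂ γ₁ γ₂ x ξ ζ φ ψ T (z j) ω)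
        atTop
        (fun (ω' : Ω') (j : Fin k) => limitConstant α₁ α₂ γ₁ γ₂ φ ψ * W (z j) ω')
        (fun _ => P) P' := by
  -- Measurable representatives change neither the occupation times, almost surely, nor the
  -- integrals in the limit constant.
  obtain ⟨φ', hφ'm, hφφ'⟩ := hφ.1.aemeasurable
  obtain ⟨ψ', hψ'm, hψψ'⟩ := hψ.1.aemeasurable
  have hφi := hφ.congr hφφ'
  have hψi := hψ.congr hψψ'
  have hκ₁ := (hsys.stable_fst 0).isStablePathLaw (zero_lt_one.trans hα₁)
  have hκ₂ := (hsys.stable_snd 0).isStablePathLaw (zero_lt_one.trans hα₂)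
  have hocc := fun s t => hsys.occupationTime_moments hγ₁ hγ₁' hα₁ hγ₂ hγ₂' hα₂ hφ'm hφi hφφ'
    hψ'm hψi hψψ' s t
  refine ⟨fun s t => ⟨?_, (hocc s t).2.1⟩, fun k z => ?_⟩
  · filter_upwards [hsys.ae_occupationTime_eq hγ₁ hγ₁' hα₁ hγ₂ hγ₂' hα₂ hφ'm hφi hφφ'
      hψ'm hψi hψψ' s t] with ω hω
    exact ⟨hω.1, hω.2.1⟩
  have hD : limitConstant α₁ α₂ γ₁ γ₂ φ ψ = limitConstant α₁ α₂ γ₁ γ₂ φ' ψ' := by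
    rw [limitConstant, limitConstant, integral_congr_ae hφφ', integral_congr_ae hψψ']
  refine tendstoInDistribution_pi_of_tendsto_integral_exp (fun T => ?_) ?_ fun θ => ?_
  · exact aemeasurable_pi_lambda _ fun j =>
      ((hocc (T * (z j).1) (T * (z j).2)).2.1.aemeasurable.sub_const _).const_mul _
  · exact aemeasurable_pi_lambda _ fun j => (hW.gaussian.aemeasurable (z j)).const_mul _
  rw [hW.integral_exp]
  set m := ((powerIntensity γ₁).prod (P.map fun ω t => ξ 0 t ω)).prod
    ((powerIntensity γ₂).prod (P.map fun ω t => ζ 0 t ω)) with hm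
  let G : Fin k → ℝ≥0 → (ℝ × (ℝ≥0 → ℝ)) × (ℝ × (ℝ≥0 → ℝ)) → ℝ :=
    fun j T => pairWeight φ' ψ' (T * (z j).1, T * (z j).2)
  let Z : ℝ≥0 → (ℝ × (ℝ≥0 → ℝ)) × (ℝ × (ℝ≥0 → ℝ)) → ℝ :=
    fun T q => ∑ j, θ j * ((fluctuationNorming α₁ α₂ γ₁ γ₂ T)⁻¹ * G j T q)
  have hZm : ∀ T, Measurable (Z T) := fun T => Finset.measurable_fun_sum _ fun j _ =>
    ((measurable_pairWeight hφ'm hψ'm _).const_mul _).const_mul _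
  have hZi : ∀ T, Integrable (Z T) m := fun T => integrable_finsetSum _ fun j _ =>
    ((hκ₁.integrable_pairWeight hκ₂ hγ₁ hγ₁' hα₁ hγ₂ hγ₂' hα₂ hφ'm hφi hψ'm hψi _).const_mul
      _).const_mul _
  have hGG : ∀ T i j, Integrable (fun q => θ i * θ j * ((fluctuationNorming α₁ α₂ γ₁ γ₂ T)⁻¹ ^ 2 *
      (G i T q * G j T q))) m := fun T i j =>
    ((hκ₁.integrable_pairWeight_mul hκ₂ hγ₁ hγ₁' hα₁ hγ₂ hγ₂' hα₂ hφ'm hφi hψ'm hψi _ _).const_mul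
      _).const_mul _
  -- Expanding the square matches ∫ Z² dm term by term with the quadratic form in the covariance of
  -- the sheet.
  have hZsq : ∀ T q, Z T q ^ 2 = ∑ i, ∑ j, θ i * θ j *
      ((fluctuationNorming α₁ α₂ γ₁ γ₂ T)⁻¹ ^ 2 * (G i T q * G j T q)) := fun T q => by
    rw [sq, Finset.sum_mul_sum]
    refine Finset.sum_congr rfl fun i _ => Finset.sum_congr rfl fun j _ => ?_
    ring
  have hZ2 : ∀ T, Integrable (fun q => Z T q ^ 2) m := fun T => by
    simp_rw [hZsq]
    exact integrable_finsetSum _ fun i _ => integrable_finsetSum _ fun j _ => hGG T i j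
  have hlim2 : Tendsto (fun T => ∫ q, Z T q ^ 2 ∂m) atTop (𝓝 (∑ i, ∑ j, θ i * θ j *
      (limitConstant α₁ α₂ γ₁ γ₂ φ ψ ^ 2 *
        (weightedFBMCov (-γ₁ / α₁) (1 - 1 / α₁) (z i).1 (z j).1 *
          weightedFBMCov (-γ₂ / α₂) (1 - 1 / α₂) (z i).2 (z j).2)))) := by
    rw [hD]
    refine Tendsto.congr (fun T => ?_) (tendsto_finsetSum _ fun i _ =>
      tendsto_finsetSum _ fun j _ => (hκ₁.tendsto_integral_pairWeight_mul hκ₂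
        hγ₁ hγ₁' hα₁ hγ₂ hγ₂' hα₂ hφ'm hφi hψ'm hψi
        (z i) (z j)).const_mul (θ i * θ j))
    simp_rw [hZsq]
    rw [integral_finsetSum _ fun i _ => integrable_finsetSum _ fun j _ => hGG T i j]
    refine Finset.sum_congr rfl fun i _ => ?_
    rw [integral_finsetSum _ fun j _ => hGG T i j]
    refine Finset.sum_congr rfl fun j _ => ?_
    rw [integral_const_mul, integral_const_mul]
  have hlim3 := hκ₁.tendsto_lintegral_pairWeight_cube hκ₂ hγ₁ hγ₁' hα₁ hγ₂ hγ₂' hα₂ hφ'm hφi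
    hψ'm hψi z θ
  have hexp := tendsto_integral_exp_sub_one_sub hZm hZi hZ2 hlim2 hlim3
  refine ((Complex.continuous_exp.tendsto _).comp hexp).congr fun T => ?_
  exact (hsys.integral_exp_occupationFluctuation hγ₁ hγ₁' hα₁ hγ₂ hγ₂' hα₂ hφ'm hφi hφφ'
    hψ'm hψi hψψ' z θ T (fun _ => rfl) hm).symm
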